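/- All vector spaces are over $\mathbb{C}$; expressions such as $f(x\pm z)$ with $f\in\mathbb{C}((x))$ are expanded in nonnegative powers of the second variable, so that $f(x\pm z)\in\mathbb{C}((x))[[z]]$, and $A((x_1,x_2))=A[[x_1,x_2]][x_1^{-1},x_2^{-1}]$. **Definitions.** A *nonlocal vertex algebra* is a vector space $V$ with a linear map $Y(\cdot,x):V\to \mathrm{Hom}(V,V((x)))$, $Y(v,x)=\sum_{n\in\mathbb{Z}} v_n x^{-n-1}$, and a vector $\mathbf 1\in V$ such that $Y(\mathbf 1,x)v=v$, $Y(v,x)\mathbf 1\in V[[x]]$ with constant term $v$, and for all $u,v\in V$ there is $k\in\mathbb{N}$ with $(x_1-x_2)^kY(u,x_1)Y(v,x_2)\in\mathrm{Hom}(V,V((x_1,x_2)))$ and $\big((x_1-x_2)^kY(u,x_1)Y(v,x_2)\big)|_{x_1=x_2+x_0}=x_0^kY(Y(u,x_0)v,x_2)$. Put $\mathcal D v=v_{-2}\mathbf 1$. A *module* $W$ for it has a linear map $Y_W(\cdot,x):V\to\mathrm{Hom}(W,W((x)))$ with $Y_W(\mathbf 1,x)=1_W$ and, for all $u,v\in V$,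 some $k\in\mathbb{N}$ with $(x_1-x_2)^kY_W(u,x_1)Y_W(v,x_2)\in\mathrm{Hom}(W,W((x_1,x_2)))$ and $\big((x_1-x_2)^kY_W(u,x_1)Y_W(v,x_2)\big)|_{x_1=x_2+x_0}=x_0^kY_W(Y(u,x_0)v,x_2)$. A *vertex algebra* is a nonlocal vertex algebra such that for all $u,v$ there is $k\in\mathbb{N}$ with $(x_1-x_2)^kY(u,x_1)Y(v,x_2)=(x_1-x_2)^kY(v,x_2)Y(u,x_1)$. A homomorphism is a linear map preserving $\mathbf 1$ and $Y$; tensor products carry $Y(u\otimes h,x)(v\otimes k)=Y(u,x)v\otimes Y(h,x)k$ and the vacuum $\mathbf 1\otimes\mathbf 1$; and $\mathbb{C}$ carries $Y(a,x)b=ab$ and the vacuum $1$. A *nonlocal vertex bialgebra* is a nonlocal vertex algebra $H$ with a coalgebra structure $(\Delta,\varepsilon)$ such that $\Delta:H\to H\otimes H$ and $\varepsilon:H\to\mathbb{C}$ are homomorphisms of nonlocal vertex algebras. Write $\Delta(h)=\sum h_{(1)}\otimes h_{(2)}$. An *$H$-module nonlocal vertex algebra* structure on $V$ is a linear map $Y_M(\cdot,x):H\to\mathrm{Hom}(V,V\otimes\mathbb{C}((x)))$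 making $V$ a module for the nonlocal vertex algebra $H$, with $Y_M(h,x)\mathbf 1=\varepsilon(h)\mathbf 1$ and $Y_M(h,x_1)Y(u,x_2)v=\sum Y(Y_M(h_{(1)},x_1-x_2)u,x_2)Y_M(h_{(2)},x_1)v$. A *right $H$-comodule nonlocal vertex algebra* structure on $V$ is a homomorphism $\rho:V\to V\otimes H$ of nonlocal vertex algebras with $(\rho\otimes1)\rho=(1\otimes\Delta)\rho$ and $(1\otimes\varepsilon)\rho=\mathrm{id}_V$; write $\rho(v)=\sum v_{(1)}\otimes v_{(2)}$. Let $\mathfrak L^\rho_H(V)$ be the set of $H$-module nonlocal vertex algebra structures $Y_M$ on $V$ which are compatible with $\rho$: $\rho(Y_M(h,x)v)=(Y_M(h,x)\otimes1)\rho(v)$. Convolution is $(Y_M*Y_M')(h,x)=\sum Y_M(h_{(1)},x)Y'_M(h_{(2)},x)$, with identity $h\mapsto\varepsilon(h)\,\mathrm{id}_V$; $Y_M$ and $Y_M'$ *commute* if $Y_M(h,x)Y'_M(k,z)=Y'_M(k,z)Y_M(h,x)$ for all $h,k\in H$, and a subset of $\mathfrak L^\rho_H(V)$ is *commutative* if any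 two of its elements, equal or not, commute. A *unitary rational quantum Yang–Baxter operator* on $V$ is a linear map $\mathcal S(x):V\otimes V\to V\otimes V\otimes\mathbb{C}((x))$ with $\mathcal S^{12}(x)\mathcal S^{13}(x+z)\mathcal S^{23}(z)=\mathcal S^{23}(z)\mathcal S^{13}(x+z)\mathcal S^{12}(x)$ and $\mathcal S^{21}(x)\mathcal S^{12}(-x)=1$, where $\mathcal S^{21}(x)=\sigma\mathcal S(x)\sigma$ with $\sigma$ the flip. A *quantum vertex algebra* is a nonlocal vertex algebra $V$ with such an operator $\mathcal S(x)$ such that: 1. for all $u,v\in V$ there are $u^{(i)},v^{(i)}\in V$, $f_i\in\mathbb{C}((x))$ ($1\le i\le r$) and $k\in\mathbb{N}$ with $(x-z)^kY(u,x)Y(v,z)=(x-z)^k\sum_i f_i(z-x)Y(v^{(i)},z)Y(u^{(i)},x)$; 2. for all $u,v\in V$ there is $k\in\mathbb{N}$ such that for all $w\in V$, $(x-z)^kY(x)(1\otimes Y(z))(\mathcal S(x-z)(u\otimes v)\otimes w)=(x-z)^kY(z)(1\otimes Y(x))(v\otimes u\otimes w)$, where $Y(x)(u\otimes v)=Y(u,x)v$;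 3. $[\mathcal D\otimes1,\mathcal S(x)]=-\frac{d}{dx}\mathcal S(x)$; 4. $\mathcal S(x)(Y(z)\otimes1)=(Y(z)\otimes1)\mathcal S^{23}(x)\mathcal S^{13}(x+z)$. **Theorem.** Let $H$ be a cocommutative nonlocal vertex bialgebra and let $V$ be a vertex algebra with a right $H$-comodule nonlocal vertex algebra structure $\rho$. Let $Y_M,Y_M^{-1}\in\mathfrak L^\rho_H(V)$ be inverse to each other with respect to $*$ and such that the set $\{Y_M,Y_M^{-1}\}$ is commutative. Define $\mathcal S(x):V\otimes V\to V\otimes V\otimes\mathbb{C}((x))$ by $$\mathcal S(x)(v\otimes u)=\sum Y_M(u_{(2)},-x)v_{(1)}\otimes Y_M^{-1}(v_{(2)},x)u_{(1)}\qquad(u,v\in V).$$ Then $\mathcal S(x)$ is a unitary rational quantum Yang–Baxter operator on $V$. Moreover $\mathfrak D^\rho_{Y_M}(V)$, that is, $V$ with the vacuum vector $\mathbf 1$ and the vertex operator map $\mathfrak D^\rho_{Y_M}(Y)(a,x)=\sum Y(a_{(1)},x)Y_M(a_{(2)},x)$, is, with $\mathcal S(x)$, a quantum vertex algebra. -/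

import Mathlib

open scoped TensorProduct

noncomputable section

namespace VertexAlg

/-! ### Formal Laurent series with coefficients in a vector space

`LaurentSeries A` is `A((x))`.  An iterated `LaurentSeries (LaurentSeries A)` is `A((x₁))((x₂))`:
the inner variable is the first variable `x₁`, the outer one is the second variable `x₂`. -/

section Formal

variable {A B C : Type*} [AddCommGroup A] [Module ℂ A] [AddCommGroup B] [Module ℂ B]
  [AddCommGroup C] [Module ℂ C]

/-- Apply a linear map to every coefficient of a Laurent series. -/
def laurentMap (f : A →ₗ[ℂ] B) : LaurentSeries A →ₗ[ℂ] LaurentSeries B where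
  toFun a := HahnSeries.map a f
  map_add' a b := by ext n; simp
  map_smul' c a := by ext n; simp

theorem laurentMap_coeff (f : A →ₗ[ℂ] B) (a : LaurentSeries A) (n : ℤ) :
    (laurentMap f a).coeff n = f (a.coeff n) := rfl

/-- The product of two Laurent series along a bilinear map `β`:
the coefficient of `x ^ n` is the (finite) sum of `β aᵢ bⱼ` over `i + j = n`. -/
def laurentMulAux (β : A →ₗ[ℂ] B →ₗ[ℂ] C) (a : LaurentSeries A) (b : LaurentSeries B) :
    LaurentSeries C where
  coeff n := ∑ ij ∈ Finset.antidiagonal a.isPWO_support b.isPWO_support n,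
    β (a.coeff ij.1) (b.coeff ij.2)
  isPWO_support' := by
    refine (a.isPWO_support.add b.isPWO_support).mono fun n hn => ?_
    obtain ⟨ij, hij, -⟩ := Finset.exists_ne_zero_of_sum_ne_zero hn
    obtain ⟨h1, h2, h3⟩ := Finset.mem_antidiagonal.1 hij
    exact ⟨ij.1, h1, ij.2, h2, h3⟩

theorem laurentMulAux_coeff (β : A →ₗ[ℂ] B →ₗ[ℂ] C) (a : LaurentSeries A) (b : LaurentSeries B)
    {s t : Set ℤ} (hs : s.IsPWO) (ht : t.IsPWO) (has : a.support ⊆ s) (hbt : b.support ⊆ t)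
    (n : ℤ) : (laurentMulAux β a b).coeff n =
      ∑ ij ∈ Finset.antidiagonal hs ht n, β (a.coeff ij.1) (b.coeff ij.2) := by
  refine Finset.sum_subset (fun ij hij => ?_) (fun ij hij hn => ?_)
  · obtain ⟨h1, h2, h3⟩ := Finset.mem_antidiagonal.1 hij
    exact Finset.mem_antidiagonal.2 ⟨has h1, hbt h2, h3⟩
  · by_cases h1 : a.coeff ij.1 = 0
    · simp [h1]
    by_cases h2 : b.coeff ij.2 = 0
    · simp [h2]
    exact absurd (Finset.mem_antidiagonal.2 ⟨h1, h2, (Finset.mem_antidiagonal.1 hij).2.2⟩) hn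

/-- `laurentMulAux` as a bilinear map. -/
def laurentMul (β : A →ₗ[ℂ] B →ₗ[ℂ] C) :
    LaurentSeries A →ₗ[ℂ] LaurentSeries B →ₗ[ℂ] LaurentSeries C :=
  LinearMap.mk₂ ℂ (laurentMulAux β)
    (fun a a' b => by
      ext n
      have hs := a.isPWO_support.union a'.isPWO_support
      rw [HahnSeries.coeff_add,
        laurentMulAux_coeff β (a + a') b hs b.isPWO_support
          (HahnSeries.support_add_subset a a') subset_rfl,
        laurentMulAux_coeff β a b hs b.isPWO_support Set.subset_union_left subset_rfl,
        laurentMulAux_coeff β a' b hs b.isPWO_support Set.subset_union_right subset_rfl,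
        ← Finset.sum_add_distrib]
      simp)
    (fun c a b => by
      ext n
      rw [laurentMulAux_coeff β (c • a) b a.isPWO_support b.isPWO_support
        (HahnSeries.support_smul_subset c a) subset_rfl]
      simp [laurentMulAux, Finset.smul_sum])
    (fun a b b' => by
      ext n
      have ht := b.isPWO_support.union b'.isPWO_support
      rw [HahnSeries.coeff_add,
        laurentMulAux_coeff β a (b + b') a.isPWO_support ht subset_rfl
          (HahnSeries.support_add_subset b b'),
        laurentMulAux_coeff β a b a.isPWO_support ht subset_rfl Set.subset_union_left,
        laurentMulAux_coeff β a b' a.isPWO_support ht subset_rfl Set.subset_union_right,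
        ← Finset.sum_add_distrib]
      simp)
    (fun c a b => by
      ext n
      rw [laurentMulAux_coeff β a (c • b) a.isPWO_support b.isPWO_support subset_rfl
        (HahnSeries.support_smul_subset c b)]
      simp [laurentMulAux, Finset.smul_sum])

/-- The product `a(x) f(x)` of `a(x) ∈ A((x))` and a scalar series `f(x) ∈ ℂ((x))`. -/
def mulScalar : LaurentSeries A →ₗ[ℂ] LaurentSeries ℂ →ₗ[ℂ] LaurentSeries A :=
  laurentMul (LinearMap.lsmul ℂ A).flip

/-- The product of `a ∈ A((x₁))((x₂))` and a scalar series in `ℂ((x₁))((x₂))`. -/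
def mulScalar₂ : LaurentSeries (LaurentSeries A) →ₗ[ℂ] LaurentSeries (LaurentSeries ℂ) →ₗ[ℂ]
    LaurentSeries (LaurentSeries A) :=
  laurentMul mulScalar

/-- The bilinear map `(a, f(x)) ↦ f(x) a`. -/
def vecMulSeries : A →ₗ[ℂ] LaurentSeries ℂ →ₗ[ℂ] LaurentSeries A :=
  mulScalar ∘ₗ HahnSeries.single.linearMap 0

/-- The canonical map `A ⊗ ℂ((x)) → A((x))`. -/
def toLaurent : A ⊗[ℂ] LaurentSeries ℂ →ₗ[ℂ] LaurentSeries A :=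
  TensorProduct.lift vecMulSeries

/-- The extension of a linear map `φ : A → B((x))` to `A ⊗ ℂ((x))`, namely
`a ⊗ f(x) ↦ f(x) φ(a)`. -/
def extendField (φ : A →ₗ[ℂ] LaurentSeries B) :
    A ⊗[ℂ] LaurentSeries ℂ →ₗ[ℂ] LaurentSeries B :=
  TensorProduct.lift (mulScalar ∘ₗ φ)

theorem extendField_add (φ ψ : A →ₗ[ℂ] LaurentSeries B) :
    extendField (φ + ψ) = extendField φ + extendField ψ := by
  apply TensorProduct.ext'
  intro a f
  simp [extendField]

theorem extendField_smul (c : ℂ) (φ : A →ₗ[ℂ] LaurentSeries B) :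
    extendField (c • φ) = c • extendField φ := by
  apply TensorProduct.ext'
  intro a f
  simp [extendField]

/-- The multiplication of `ℂ((x))` as a bilinear map. -/
def mulSeries : LaurentSeries ℂ →ₗ[ℂ] LaurentSeries ℂ →ₗ[ℂ] LaurentSeries ℂ := mulScalar

theorem mulSeries_eq (f g : LaurentSeries ℂ) : mulSeries f g = f * g := by
  ext n
  rw [HahnSeries.coeff_mul]
  exact Finset.sum_congr rfl fun ij _ => mul_comm (g.coeff ij.2) (f.coeff ij.1)

/-- The multiplication of `ℂ((x₁))((x₂))` as a bilinear map. -/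
def mulSeries₂ : LaurentSeries (LaurentSeries ℂ) →ₗ[ℂ] LaurentSeries (LaurentSeries ℂ) →ₗ[ℂ]
    LaurentSeries (LaurentSeries ℂ) := mulScalar₂

/-- Let `K` be `ℂ((x))` or `ℂ((x₁))((x₂))`, with multiplication `μ`.  The extension of a linear
map `T : A → B ⊗ K` to a `K`-linear map `A ⊗ K → B ⊗ K`: if `T a = ∑ bᵢ ⊗ gᵢ`, then
`a ⊗ f ↦ ∑ bᵢ ⊗ gᵢ f`. -/
def extendScalars {K : Type*} [AddCommMonoid K] [Module ℂ K] (μ : K →ₗ[ℂ] K →ₗ[ℂ] K)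
    (T : A →ₗ[ℂ] B ⊗[ℂ] K) : A ⊗[ℂ] K →ₗ[ℂ] B ⊗[ℂ] K :=
  LinearMap.lTensor B (TensorProduct.lift μ) ∘ₗ (TensorProduct.assoc ℂ B K K).toLinearMap ∘ₗ
    LinearMap.rTensor K T

/-- `f(x) ↦ f(-x)` on `ℂ((x))`. -/
def negVar : LaurentSeries ℂ →ₗ[ℂ] LaurentSeries ℂ where
  toFun f :=
    { coeff := fun n => (-1 : ℂ) ^ n * f.coeff n
      isPWO_support' := f.isPWO_support.mono fun n hn h => hn (by simp [h]) }
  map_add' f g := by ext n; simp [mul_add]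
  map_smul' c f := by ext n; simp [mul_left_comm]

/-- `f(x) ↦ f(x₁) ∈ ℂ((x₁))((x₂))`. -/
def atFst : LaurentSeries ℂ →ₗ[ℂ] LaurentSeries (LaurentSeries ℂ) :=
  HahnSeries.single.linearMap 0

/-- `f(x) ↦ f(x₂) ∈ ℂ((x₁))((x₂))`. -/
def atSnd : LaurentSeries ℂ →ₗ[ℂ] LaurentSeries (LaurentSeries ℂ) :=
  laurentMap (HahnSeries.single.linearMap 0)

/-- `f(x) ↦ f(x₁ + c x₂) ∈ ℂ((x₁))((x₂))`, expanded in nonnegative powers of `x₂` by Taylor's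
formula `∑ i ≥ 0, c ^ i (f⁽ⁱ⁾(x₁) / i!) x₂ ^ i`; `hasseDeriv` is the divided power derivative. -/
def taylor (c : ℂ) : LaurentSeries ℂ →ₗ[ℂ] LaurentSeries (LaurentSeries ℂ) where
  toFun f :=
    { coeff := fun i => if 0 ≤ i then c ^ i.toNat • LaurentSeries.hasseDeriv ℂ i.toNat f else 0
      isPWO_support' := by
        refine (BddBelow.isWF ⟨0, fun i hi => ?_⟩).isPWO
        by_contra h
        exact hi (if_neg h) }
  map_add' f g := by
    ext i n
    by_cases h : 0 ≤ i <;> simp [h]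
  map_smul' a f := by
    ext i n
    by_cases h : 0 ≤ i <;> simp [h, mul_left_comm]

/-- `f(x) ↦ f(x₁ + x₂)`, expanded in nonnegative powers of `x₂`. -/
def atAdd : LaurentSeries ℂ →ₗ[ℂ] LaurentSeries (LaurentSeries ℂ) := taylor 1

/-- `f(x) ↦ f(x₁ - x₂)`, expanded in nonnegative powers of `x₂`. -/
def atSub : LaurentSeries ℂ →ₗ[ℂ] LaurentSeries (LaurentSeries ℂ) := taylor (-1)

/-- The formal series in `A[[x₁^{±1}, x₂^{±1}]]` (the family of its coefficients, that of
`x₁ ^ m x₂ ^ n` at `m n`) given by an element of `A((x₁))((x₂))`. -/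
def coeff₂ (F : LaurentSeries (LaurentSeries A)) : ℤ → ℤ → A :=
  fun m n => (F.coeff n).coeff m

/-- The formal series in `A[[x₁^{±1}, x₂^{±1}]]` given by an element of `A((x₂))((x₁))`, that is,
with the inner variable now named `x₂` and the outer variable named `x₁`. -/
def coeff₂Swap (F : LaurentSeries (LaurentSeries A)) : ℤ → ℤ → A :=
  fun m n => (F.coeff m).coeff n

/-- Multiplication of a formal series in `A[[x₁^{±1}, x₂^{±1}]]` by `x₁ - x₂`. -/
def mulSub (F : ℤ → ℤ → A) : ℤ → ℤ → A :=
  fun m n => F (m - 1) n - F m (n - 1)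

/-- Multiplication of a formal series by `(x₁ - x₂) ^ k`. -/
def mulSubPow (k : ℕ) (F : ℤ → ℤ → A) : ℤ → ℤ → A := mulSub^[k] F

/-- The formal series `F` belongs to `A((x₁, x₂)) = A[[x₁, x₂]][x₁⁻¹, x₂⁻¹]`. -/
def IsJointLaurent (F : ℤ → ℤ → A) : Prop :=
  ∃ N : ℤ, ∀ m n : ℤ, m < N ∨ n < N → F m n = 0

/-- For `F(x₁, x₂) ∈ A((x₁, x₂))`, the series `F(x₂ + x₀, x₂) ∈ A((x₂))[[x₀]]`, where
`(x₂ + x₀) ^ m = ∑ i ≥ 0, (m choose i) x₂ ^ (m - i) x₀ ^ i`.  The value at `i p` is the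
coefficient of `x₀ ^ i x₂ ^ p`; the sum in it has finitely many nonzero terms. -/
def substAdd (F : ℤ → ℤ → A) : ℤ → ℤ → A := fun i p =>
  if 0 ≤ i then ∑ᶠ m : ℤ, Ring.choose m i.toNat • F m (p - m + i) else 0

end Formal

/-! ### Nonlocal vertex algebras

A vertex operator map is a linear map `Y : V → Hom(V, V((x)))`; the coefficient of `x ^ n` in
`Y u v` is `u_{-n-1} v`. -/

section Basic

variable {V : Type*} [AddCommGroup V] [Module ℂ V] {W : Type*} [AddCommGroup W] [Module ℂ W]

/-- For given `u v`, and vertex operators `YW` acting on `W`: there is `k ≥ 0` such that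
`(x₁ - x₂)^k YW(u, x₁) YW(v, x₂) ∈ Hom(W, W((x₁, x₂)))` and
`((x₁ - x₂)^k YW(u, x₁) YW(v, x₂))|_{x₁ = x₂ + x₀} = x₀^k YW(Y(u, x₀) v, x₂)`. -/
def Associative (Y : V →ₗ[ℂ] V →ₗ[ℂ] LaurentSeries V) (YW : V →ₗ[ℂ] W →ₗ[ℂ] LaurentSeries W)
    (u v : V) : Prop :=
  ∃ k : ℕ, ∀ w : W,
    IsJointLaurent (mulSubPow k (coeff₂ (laurentMap (YW u) (YW v w)))) ∧
    substAdd (mulSubPow k (coeff₂ (laurentMap (YW u) (YW v w)))) =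
      fun i p => (YW ((Y u v).coeff (i - k)) w).coeff p

/-- `(V, Y, vac)` is a nonlocal vertex algebra. -/
structure IsNonlocalVertexAlgebra (Y : V →ₗ[ℂ] V →ₗ[ℂ] LaurentSeries V) (vac : V) : Prop where
  vacuum : ∀ v, Y vac v = HahnSeries.single 0 v
  creation_regular : ∀ v, ∀ n : ℤ, n < 0 → (Y v vac).coeff n = 0
  creation_limit : ∀ v, (Y v vac).coeff 0 = v
  associative : ∀ u v, Associative Y Y u v

/-- `(V, Y, vac)` is a vertex algebra: a nonlocal vertex algebra such that for all `u v` there is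
`k ≥ 0` with `(x₁ - x₂)^k Y(u, x₁) Y(v, x₂) = (x₁ - x₂)^k Y(v, x₂) Y(u, x₁)`. -/
structure IsVertexAlgebra (Y : V →ₗ[ℂ] V →ₗ[ℂ] LaurentSeries V) (vac : V) : Prop
    extends IsNonlocalVertexAlgebra Y vac where
  locality : ∀ u v, ∃ k : ℕ, ∀ w,
    mulSubPow k (coeff₂ (laurentMap (Y u) (Y v w))) =
      mulSubPow k (coeff₂Swap (laurentMap (Y v) (Y u w)))

/-- `f` is a homomorphism of nonlocal vertex algebras. -/
structure IsHom (Y : V →ₗ[ℂ] V →ₗ[ℂ] LaurentSeries V) (vac : V)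
    (Y' : W →ₗ[ℂ] W →ₗ[ℂ] LaurentSeries W) (vac' : W) (f : V →ₗ[ℂ] W) : Prop where
  map_vac : f vac = vac'
  map_vertex : ∀ u v, laurentMap f (Y u v) = Y' (f u) (f v)

/-- The vertex operator map of a tensor product:
`(u ⊗ h, v ⊗ k) ↦ Y(u, x) v ⊗ Y'(h, x) k`. -/
def tensorVertex (Y : V →ₗ[ℂ] V →ₗ[ℂ] LaurentSeries V) (Y' : W →ₗ[ℂ] W →ₗ[ℂ] LaurentSeries W) :
    V ⊗[ℂ] W →ₗ[ℂ] V ⊗[ℂ] W →ₗ[ℂ] LaurentSeries (V ⊗[ℂ] W) :=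
  (TensorProduct.map₂ Y Y').compr₂ (TensorProduct.lift (laurentMul (TensorProduct.mk ℂ V W)))

/-- The vertex operator map `Y(a, x) b = a b` of the one-dimensional vertex algebra `ℂ`. -/
def scalarVertex : ℂ →ₗ[ℂ] ℂ →ₗ[ℂ] LaurentSeries ℂ :=
  (LinearMap.mul ℂ ℂ).compr₂ (HahnSeries.single.linearMap 0)

/-- The operator `𝒟 v = v_{-2} vac`. -/
def translation (Y : V →ₗ[ℂ] V →ₗ[ℂ] LaurentSeries V) (vac : V) : V →ₗ[ℂ] V :=
  HahnSeries.coeff.linearMap 1 ∘ₗ Y.flip vac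

end Basic

/-! ### Quantum vertex algebras -/

section Quantum

variable {V : Type*} [AddCommGroup V] [Module ℂ V]

/-- The map `(a ⊗ b) ⊗ f ↦ f(x₁ - x₂) Y(a, x₁) Y(b, x₂) w ∈ V((x₁))((x₂))`. -/
def twoPoint (Y : V →ₗ[ℂ] V →ₗ[ℂ] LaurentSeries V) (w : V) :
    (V ⊗[ℂ] V) ⊗[ℂ] LaurentSeries ℂ →ₗ[ℂ] LaurentSeries (LaurentSeries V) :=
  TensorProduct.lift <| (mulScalar₂.compl₂ atSub) ∘ₗ TensorProduct.lift
    (LinearMap.mk₂ ℂ (fun a b => laurentMap (Y a) (Y b w))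
      (fun a a' b => by ext m n; simp [laurentMap])
      (fun c a b => by ext m n; simp [laurentMap])
      (fun a b b' => by simp)
      (fun c a b => by simp))

/-- A weak quantum vertex algebra: a nonlocal vertex algebra with `𝒮`-locality
`(x₁ - x₂)^k Y(u, x₁) Y(v, x₂) = (x₁ - x₂)^k ∑ i, fᵢ(x₂ - x₁) Y(v⁽ⁱ⁾, x₂) Y(u⁽ⁱ⁾, x₁)`, where
`fᵢ(x₂ - x₁)` is expanded in nonnegative powers of `x₁`. -/
structure IsWeakQuantumVertexAlgebra (Y : V →ₗ[ℂ] V →ₗ[ℂ] LaurentSeries V) (vac : V) : Prop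
    extends IsNonlocalVertexAlgebra Y vac where
  S_locality : ∀ u v, ∃ (r : ℕ) (u' v' : Fin r → V) (f : Fin r → LaurentSeries ℂ) (k : ℕ), ∀ w,
    mulSubPow k (coeff₂ (laurentMap (Y u) (Y v w))) =
      mulSubPow k (coeff₂Swap (∑ i, twoPoint Y w ((v' i ⊗ₜ u' i) ⊗ₜ f i)))

/-- `S^{12}`, with the variable of `S(x)` replaced through `φ : ℂ((x)) → K`. -/
def S12 {K : Type*} [AddCommMonoid K] [Module ℂ K]
    (S : V ⊗[ℂ] V →ₗ[ℂ] (V ⊗[ℂ] V) ⊗[ℂ] LaurentSeries ℂ) (φ : LaurentSeries ℂ →ₗ[ℂ] K) :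
    (V ⊗[ℂ] V) ⊗[ℂ] V →ₗ[ℂ] ((V ⊗[ℂ] V) ⊗[ℂ] V) ⊗[ℂ] K :=
  (TensorProduct.rightComm ℂ (V ⊗[ℂ] V) K V).toLinearMap ∘ₗ
    LinearMap.rTensor V (LinearMap.lTensor (V ⊗[ℂ] V) φ ∘ₗ S)

/-- `S^{13}`, with the variable of `S(x)` replaced through `φ : ℂ((x)) → K`. -/
def S13 {K : Type*} [AddCommMonoid K] [Module ℂ K]
    (S : V ⊗[ℂ] V →ₗ[ℂ] (V ⊗[ℂ] V) ⊗[ℂ] LaurentSeries ℂ) (φ : LaurentSeries ℂ →ₗ[ℂ] K) :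
    (V ⊗[ℂ] V) ⊗[ℂ] V →ₗ[ℂ] ((V ⊗[ℂ] V) ⊗[ℂ] V) ⊗[ℂ] K :=
  LinearMap.rTensor K (TensorProduct.rightComm ℂ V V V).toLinearMap ∘ₗ S12 S φ ∘ₗ
    (TensorProduct.rightComm ℂ V V V).toLinearMap

/-- `S^{23}`, with the variable of `S(x)` replaced through `φ : ℂ((x)) → K`. -/
def S23 {K : Type*} [AddCommMonoid K] [Module ℂ K]
    (S : V ⊗[ℂ] V →ₗ[ℂ] (V ⊗[ℂ] V) ⊗[ℂ] LaurentSeries ℂ) (φ : LaurentSeries ℂ →ₗ[ℂ] K) :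
    (V ⊗[ℂ] V) ⊗[ℂ] V →ₗ[ℂ] ((V ⊗[ℂ] V) ⊗[ℂ] V) ⊗[ℂ] K :=
  LinearMap.rTensor K (TensorProduct.assoc ℂ V V V).symm.toLinearMap ∘ₗ
    (TensorProduct.assoc ℂ V (V ⊗[ℂ] V) K).symm.toLinearMap ∘ₗ
    LinearMap.lTensor V (LinearMap.lTensor (V ⊗[ℂ] V) φ ∘ₗ S) ∘ₗ
    (TensorProduct.assoc ℂ V V V).toLinearMap

/-- `S^{21}(x) = σ S(x) σ`. -/
def S21 (S : V ⊗[ℂ] V →ₗ[ℂ] (V ⊗[ℂ] V) ⊗[ℂ] LaurentSeries ℂ) :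
    V ⊗[ℂ] V →ₗ[ℂ] (V ⊗[ℂ] V) ⊗[ℂ] LaurentSeries ℂ :=
  LinearMap.rTensor (LaurentSeries ℂ) (TensorProduct.comm ℂ V V).toLinearMap ∘ₗ S ∘ₗ
    (TensorProduct.comm ℂ V V).toLinearMap

/-- Rational quantum Yang-Baxter operators; the equation
`S^{12}(x) S^{13}(x + z) S^{23}(z) = S^{23}(z) S^{13}(x + z) S^{12}(x)` is one of maps
`V ⊗ V ⊗ V → V ⊗ V ⊗ V ⊗ ℂ((x))((z))`. -/
def IsRationalYangBaxter (S : V ⊗[ℂ] V →ₗ[ℂ] (V ⊗[ℂ] V) ⊗[ℂ] LaurentSeries ℂ) : Prop :=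
  extendScalars mulSeries₂ (S12 S atFst) ∘ₗ extendScalars mulSeries₂ (S13 S atAdd) ∘ₗ S23 S atSnd =
    extendScalars mulSeries₂ (S23 S atSnd) ∘ₗ extendScalars mulSeries₂ (S13 S atAdd) ∘ₗ S12 S atFst

/-- Unitarity: `S^{21}(x) S^{12}(-x) = 1`. -/
def IsUnitaryOperator (S : V ⊗[ℂ] V →ₗ[ℂ] (V ⊗[ℂ] V) ⊗[ℂ] LaurentSeries ℂ) : Prop :=
  ∀ t : V ⊗[ℂ] V, extendScalars mulSeries (S21 S) (LinearMap.lTensor (V ⊗[ℂ] V) negVar (S t)) = t ⊗ₜ 1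

/-- The map `Y(z) ⊗ 1`, sending `((a ⊗ b) ⊗ c) ⊗ F(x, z)` to `F(x, z) (Y(a, z) b ⊗ c)`, from
`V ⊗ V ⊗ V ⊗ ℂ((x))((z))` to `(V ⊗ V ⊗ ℂ((x)))((z))`. -/
def vertexTensorOne (Y : V →ₗ[ℂ] V →ₗ[ℂ] LaurentSeries V) :
    ((V ⊗[ℂ] V) ⊗[ℂ] V) ⊗[ℂ] LaurentSeries (LaurentSeries ℂ) →ₗ[ℂ]
      LaurentSeries ((V ⊗[ℂ] V) ⊗[ℂ] LaurentSeries ℂ) :=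
  TensorProduct.lift <|
    laurentMul (TensorProduct.mk ℂ (V ⊗[ℂ] V) (LaurentSeries ℂ)) ∘ₗ
      TensorProduct.lift
        (laurentMul (TensorProduct.mk ℂ V V) |>.compl₂ (HahnSeries.single.linearMap 0)) ∘ₗ
      LinearMap.rTensor V (TensorProduct.lift Y)

/-- `(V, Y, vac)` with `S(x)` is a quantum vertex algebra. -/
structure IsQuantumVertexAlgebra (Y : V →ₗ[ℂ] V →ₗ[ℂ] LaurentSeries V) (vac : V)
    (S : V ⊗[ℂ] V →ₗ[ℂ] (V ⊗[ℂ] V) ⊗[ℂ] LaurentSeries ℂ) : Prop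
    extends IsWeakQuantumVertexAlgebra Y vac where
  yangBaxter : IsRationalYangBaxter S
  unitary : IsUnitaryOperator S
  /-- `(x - z)^k Y(x) (1 ⊗ Y(z)) (S(x - z)(u ⊗ v) ⊗ w) = (x - z)^k Y(z) (1 ⊗ Y(x)) (v ⊗ u ⊗ w)` -/
  S_locality' : ∀ u v, ∃ k : ℕ, ∀ w,
    mulSubPow k (coeff₂ (twoPoint Y w (S (u ⊗ₜ v)))) =
      mulSubPow k (coeff₂Swap (laurentMap (Y v) (Y u w)))
  /-- `[𝒟 ⊗ 1, S(x)] = - d/dx S(x)` -/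
  shift : ∀ t : V ⊗[ℂ] V,
    LinearMap.rTensor (LaurentSeries ℂ) (LinearMap.rTensor V (translation Y vac)) (S t) -
        S (LinearMap.rTensor V (translation Y vac) t) =
      - LinearMap.lTensor (V ⊗[ℂ] V) (LaurentSeries.derivative ℂ) (S t)
  /-- `S(x) (Y(z) ⊗ 1) = (Y(z) ⊗ 1) S^{23}(x) S^{13}(x + z)` -/
  hexagon : ∀ u v w : V,
    laurentMap (S ∘ₗ (TensorProduct.mk ℂ V V).flip w) (Y u v) =
      vertexTensorOne Y (extendScalars mulSeries₂ (S23 S atFst) (S13 S atAdd ((u ⊗ₜ v) ⊗ₜ w)))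

end Quantum

/-! ### Vertex bialgebras, their modules and comodules, and the deformation -/

section Hopf

variable {H : Type*} [AddCommGroup H] [Module ℂ H] [Coalgebra ℂ H]
  {V : Type*} [AddCommGroup V] [Module ℂ V]

/-- `H`, with its coalgebra structure, is a nonlocal vertex bialgebra. -/
structure IsNonlocalVertexBialgebra (YH : H →ₗ[ℂ] H →ₗ[ℂ] LaurentSeries H) (vacH : H) : Prop
    extends IsNonlocalVertexAlgebra YH vacH where
  comul_hom : IsHom YH vacH (tensorVertex YH YH) (vacH ⊗ₜ[ℂ] vacH) Coalgebra.comul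
  counit_hom : IsHom YH vacH scalarVertex 1 Coalgebra.counit

/-- The bilinear map `(a ⊗ f, b ⊗ g) ↦ f(x₁ - x₂) g(x₁) Y(a, x₂) b ∈ V((x₁))((x₂))`. -/
def twistedAction (Y : V →ₗ[ℂ] V →ₗ[ℂ] LaurentSeries V) :
    V ⊗[ℂ] LaurentSeries ℂ →ₗ[ℂ] V ⊗[ℂ] LaurentSeries ℂ →ₗ[ℂ] LaurentSeries (LaurentSeries V) :=
  (TensorProduct.map₂ Y
    (mulSeries₂.compl₁₂ atSub atFst)).compr₂
    (TensorProduct.lift (laurentMul vecMulSeries))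

/-- `YM : H → Hom(V, V ⊗ ℂ((x)))` makes `(V, Y, vac)` an `H`-module nonlocal vertex algebra. -/
structure IsModuleNonlocalVertexAlgebra (YH : H →ₗ[ℂ] H →ₗ[ℂ] LaurentSeries H) (vacH : H)
    (Y : V →ₗ[ℂ] V →ₗ[ℂ] LaurentSeries V) (vac : V)
    (YM : H →ₗ[ℂ] V →ₗ[ℂ] V ⊗[ℂ] LaurentSeries ℂ) : Prop where
  module_vacuum : ∀ v, YM vacH v = v ⊗ₜ 1
  module_associative : ∀ h k, Associative YH (YM.compr₂ toLaurent) h k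
  act_vacuum : ∀ h, YM h vac = (Coalgebra.counit (R := ℂ) h • vac) ⊗ₜ 1
  /-- `YM(h, x₁) Y(u, x₂) v = ∑ Y(YM(h₍₁₎, x₁ - x₂) u, x₂) YM(h₍₂₎, x₁) v` -/
  act_vertex : ∀ h u v, laurentMap (toLaurent ∘ₗ YM h) (Y u v) =
    TensorProduct.lift ((twistedAction Y).compl₁₂ (YM.flip u) (YM.flip v))
      (Coalgebra.comul (R := ℂ) h)

/-- `ρ : V → V ⊗ H` makes `(V, Y, vac)` a right `H`-comodule nonlocal vertex algebra. -/
structure IsComoduleNonlocalVertexAlgebra (YH : H →ₗ[ℂ] H →ₗ[ℂ] LaurentSeries H) (vacH : H)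
    (Y : V →ₗ[ℂ] V →ₗ[ℂ] LaurentSeries V) (vac : V) (ρ : V →ₗ[ℂ] V ⊗[ℂ] H) : Prop where
  hom : IsHom Y vac (tensorVertex Y YH) (vac ⊗ₜ[ℂ] vacH) ρ
  coassoc : (TensorProduct.assoc ℂ V H H).toLinearMap ∘ₗ LinearMap.rTensor H ρ ∘ₗ ρ =
    LinearMap.lTensor V Coalgebra.comul ∘ₗ ρ
  counit : (TensorProduct.rid ℂ V).toLinearMap ∘ₗ LinearMap.lTensor V Coalgebra.counit ∘ₗ ρ =
    LinearMap.id

/-- `YM` is an `H`-module nonlocal vertex algebra structure which is compatible with `ρ`: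
`ρ (YM(h, x) v) = (YM(h, x) ⊗ 1) ρ(v)`. -/
structure IsCompatibleModule (YH : H →ₗ[ℂ] H →ₗ[ℂ] LaurentSeries H) (vacH : H)
    (Y : V →ₗ[ℂ] V →ₗ[ℂ] LaurentSeries V) (vac : V) (ρ : V →ₗ[ℂ] V ⊗[ℂ] H)
    (YM : H →ₗ[ℂ] V →ₗ[ℂ] V ⊗[ℂ] LaurentSeries ℂ) : Prop
    extends IsModuleNonlocalVertexAlgebra YH vacH Y vac YM where
  compatible : ∀ h v, LinearMap.rTensor (LaurentSeries ℂ) ρ (YM h v) =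
    TensorProduct.rightComm ℂ V (LaurentSeries ℂ) H (LinearMap.rTensor H (YM h) (ρ v))

/-- `YM(h, x) YM'(k, z) = YM'(k, z) YM(h, x)` for all `h k`, coefficient by coefficient. -/
def Commute (YM YM' : H →ₗ[ℂ] V →ₗ[ℂ] V ⊗[ℂ] LaurentSeries ℂ) : Prop :=
  ∀ (h k : H) (v : V) (m n : ℤ),
    (toLaurent (YM h ((toLaurent (YM' k v)).coeff n))).coeff m =
      (toLaurent (YM' k ((toLaurent (YM h v)).coeff m))).coeff n

/-- The convolution `(YM * YM')(h, x) = ∑ YM(h₍₁₎, x) YM'(h₍₂₎, x)`. -/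
def convolution (YM YM' : H →ₗ[ℂ] V →ₗ[ℂ] V ⊗[ℂ] LaurentSeries ℂ) :
    H →ₗ[ℂ] V →ₗ[ℂ] V ⊗[ℂ] LaurentSeries ℂ :=
  TensorProduct.lift
    (LinearMap.mk₂ ℂ (fun h k => extendScalars mulSeries (YM h) ∘ₗ YM' k)
      (fun h h' k => by
        ext1 v; simp [extendScalars, LinearMap.rTensor_add])
      (fun c h k => by
        ext1 v; simp [extendScalars, LinearMap.rTensor_smul])
      (fun h k k' => by ext1 v; simp)
      (fun c h k => by ext1 v; simp)) ∘ₗ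
    Coalgebra.comul

/-- The identity for convolution: `h ↦ (v ↦ ε(h) v)`. -/
def counitAction : H →ₗ[ℂ] V →ₗ[ℂ] V ⊗[ℂ] LaurentSeries ℂ :=
  (LinearMap.toSpanSingleton ℂ _ ((TensorProduct.mk ℂ V (LaurentSeries ℂ)).flip 1)) ∘ₗ
    Coalgebra.counit

/-- The deformed vertex operator map `(a, v) ↦ ∑ Y(a₍₁₎, x) YM(a₍₂₎, x) v`, where
`ρ(a) = ∑ a₍₁₎ ⊗ a₍₂₎`. -/
def deformedVertex (Y : V →ₗ[ℂ] V →ₗ[ℂ] LaurentSeries V) (ρ : V →ₗ[ℂ] V ⊗[ℂ] H)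
    (YM : H →ₗ[ℂ] V →ₗ[ℂ] V ⊗[ℂ] LaurentSeries ℂ) : V →ₗ[ℂ] V →ₗ[ℂ] LaurentSeries V :=
  TensorProduct.lift
    (LinearMap.mk₂ ℂ (fun a h => extendField (Y a) ∘ₗ YM h)
      (fun a a' h => by
        ext1 v
        simp [extendField_add])
      (fun c a h => by
        ext1 v
        simp [extendField_smul])
      (fun a h h' => by ext1 v; simp)
      (fun c a h => by ext1 v; simp)) ∘ₗ ρ

/-- The bilinear map `(a ⊗ f, b ⊗ g) ↦ (a ⊗ b) ⊗ f g`. -/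
def tensorProductSeries :
    V ⊗[ℂ] LaurentSeries ℂ →ₗ[ℂ] V ⊗[ℂ] LaurentSeries ℂ →ₗ[ℂ]
      (V ⊗[ℂ] V) ⊗[ℂ] LaurentSeries ℂ :=
  TensorProduct.map₂ (TensorProduct.mk ℂ V V) mulSeries

/-- The operator `S(x)(v ⊗ u) = ∑ YM(u₍₂₎, -x) v₍₁₎ ⊗ YM'(v₍₂₎, x) u₍₁₎`, where
`ρ(u) = ∑ u₍₁₎ ⊗ u₍₂₎` and `ρ(v) = ∑ v₍₁₎ ⊗ v₍₂₎`. -/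
def braiding (ρ : V →ₗ[ℂ] V ⊗[ℂ] H) (YM YM' : H →ₗ[ℂ] V →ₗ[ℂ] V ⊗[ℂ] LaurentSeries ℂ) :
    V ⊗[ℂ] V →ₗ[ℂ] (V ⊗[ℂ] V) ⊗[ℂ] LaurentSeries ℂ :=
  TensorProduct.lift tensorProductSeries ∘ₗ
    TensorProduct.map
      (LinearMap.lTensor V negVar ∘ₗ TensorProduct.lift YM.flip)
      (TensorProduct.lift YM'.flip) ∘ₗ
    -- `(v₁ ⊗ v₂) ⊗ (u₁ ⊗ u₂) ↦ (v₁ ⊗ u₂) ⊗ (u₁ ⊗ v₂)`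
    (TensorProduct.congr (LinearEquiv.refl ℂ (V ⊗[ℂ] H)) (TensorProduct.comm ℂ H V)).toLinearMap ∘ₗ
    (TensorProduct.tensorTensorTensorComm ℂ V H H V).toLinearMap ∘ₗ
    TensorProduct.map ρ ((TensorProduct.comm ℂ V H).toLinearMap ∘ₗ ρ)

end Hopf

end VertexAlg

end

open scoped TensorProduct

noncomputable section

set_option linter.unusedSectionVars false

namespace VertexAlg

/-! Everything is expressed through one kind of operator. For a family Z of operators of `H` on `V`,
let L_ij(Z, x) be the operator on a tensor power of `V` that applies the coaction to the factor j
and lets the resulting element of `H` act through Z(·, x) on the factor i, factors being numbered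
from 0 (`legOp₂`, `legOp`, and `legExt` after extension of scalars). With Z for Y_M and Z' for its
inverse, S(x) = L_01(Z, -x) L_10(Z', x) (`braiding_eq`), and the deformed vertex operator map is
Y(x) L_10(Z, x) (`deformedVertex_apply`).

Cocommutativity makes the coaction commute with itself (`IsCoaction.commOp_self`), compatibility
makes it commute with Z and Z', and Z, Z' commute with themselves and each other. Hence all L_ij
commute (`commOp_legOp`), and the Yang-Baxter equation is a reordering of commuting factors.
Composing along the same i and j convolves the families (`extendScalars_actThrough_comp`), so
L_ij(Z, x) and L_ij(Z', x) are mutually inverse; this gives unitarity.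

The other axioms come from moving the L_ij past Y. The formula for Z(h, x₁) Y(u, x₂), the
associativity of the module and the homomorphism property of ρ give three rules:
`laurentMap_legOp₂_vertexTensorOne`, `laurentMap_legOp₂_oneTensorVertex` and
`laurentMap_legOp₂_vertexTensorOne'`. They reduce the hexagon to a reordering. They also show that
the deformed product is Y(x₁)(1 ⊗ Y(x₂)) after L_10(x₁ - x₂) L_20(x₁) L_21(x₂), while the deformed
iterate is Y(x₂)(Y(x₀) ⊗ 1) after L_20(x₂ + x₀) L_21(x₂) L_10(x₀).

The substitution x₁ = x₂ + x₀ carries the first triple of operators to the second, so associativity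
is inherited from Y (`Expands.mul_atFst`, `Expands.mul_atSnd`, `Expands.mul_atSub`). For braided
locality, S(x₁ - x₂) contributes L_01(Z, x₂ - x₁) L_10(Z', x₁ - x₂); the second factor cancels
L_10(Z, x₁ - x₂), and what remains is, up to the direction of expansion, the triple of the opposite
product. Locality of Y then suffices (`MutuallyLocal.mul_atSub`). The shift axiom follows from
linear coefficients: ρ, Z and Z' each have a simple commutation rule with the translation operators.
-/

theorem exists_coeff_eq_zero_of_lt {A : Type*} [AddCommGroup A] (a : LaurentSeries A) :
    ∃ N : ℤ, ∀ n < N, a.coeff n = 0 := by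
  by_cases h : a = 0
  · exact ⟨0, by simp [h]⟩
  · exact ⟨a.order, fun n hn => HahnSeries.coeff_eq_zero_of_lt_order hn⟩

/-! ### Bilinear products of Laurent series and scalar multiplication -/

section LaurentCalculus

variable {A B C D E F G : Type*} [AddCommGroup A] [Module ℂ A] [AddCommGroup B] [Module ℂ B]
  [AddCommGroup C] [Module ℂ C] [AddCommGroup D] [Module ℂ D] [AddCommGroup E] [Module ℂ E]
  [AddCommGroup F] [Module ℂ F] [AddCommGroup G] [Module ℂ G]

theorem laurentMul_apply (β : A →ₗ[ℂ] B →ₗ[ℂ] C) (a : LaurentSeries A) (b : LaurentSeries B) :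
    laurentMul β a b = laurentMulAux β a b := rfl

theorem laurentMul_congr {β β' : A →ₗ[ℂ] B →ₗ[ℂ] C} (h : ∀ a b, β a b = β' a b)
    (a : LaurentSeries A) (b : LaurentSeries B) : laurentMul β a b = laurentMul β' a b := by
  rw [LinearMap.ext₂ h]

/-- The coefficients of a product as sums over an interval containing all nonzero terms. -/
theorem laurentMul_coeff_Icc (β : A →ₗ[ℂ] B →ₗ[ℂ] C) (a : LaurentSeries A) (b : LaurentSeries B)
    {M N lo hi : ℤ} (n : ℤ) (ha : ∀ i < M, a.coeff i = 0) (hb : ∀ i < N, b.coeff i = 0)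
    (hlo : lo ≤ N) (hhi : n - M ≤ hi) :
    (laurentMul β a b).coeff n = ∑ c ∈ Finset.Icc lo hi, β (a.coeff (n - c)) (b.coeff c) := by
  rw [laurentMul_apply]
  change ∑ ij ∈ Finset.antidiagonal a.isPWO_support b.isPWO_support n,
    β (a.coeff ij.1) (b.coeff ij.2) = _
  refine Finset.sum_bij_ne_zero (fun ij _ _ => ij.2) ?_ ?_ ?_ ?_
  · intro ij h _
    obtain ⟨h1, h2, h3⟩ := Finset.mem_antidiagonal.1 h
    have h4 : M ≤ ij.1 := not_lt.1 fun h => h1 (ha _ h)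
    have h5 : N ≤ ij.2 := not_lt.1 fun h => h2 (hb _ h)
    exact Finset.mem_Icc.2 ⟨by lia, by lia⟩
  · rintro ⟨i, j⟩ h _ ⟨i', j'⟩ h' _ e
    have := (Finset.mem_antidiagonal.1 h).2.2
    have := (Finset.mem_antidiagonal.1 h').2.2
    ext <;> simp_all
    lia
  · intro c _ hc
    refine ⟨(n - c, c), Finset.mem_antidiagonal.2 ⟨fun h => hc ?_, fun h => hc ?_, by simp⟩, hc,
      rfl⟩
    · rw [h]; simp
    · rw [h]; simp
  · intro ij h _
    have := (Finset.mem_antidiagonal.1 h).2.2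
    rw [← this]
    simp

theorem laurentMul_flip (β : A →ₗ[ℂ] B →ₗ[ℂ] C) (a : LaurentSeries A) (b : LaurentSeries B) :
    laurentMul β a b = laurentMul β.flip b a := by
  obtain ⟨M, ha⟩ := exists_coeff_eq_zero_of_lt a
  obtain ⟨N, hb⟩ := exists_coeff_eq_zero_of_lt b
  ext n
  rw [laurentMul_coeff_Icc β a b n ha hb le_rfl le_rfl,
    laurentMul_coeff_Icc β.flip b a n hb ha le_rfl le_rfl]
  refine Finset.sum_bij (fun c _ => n - c) ?_ ?_ ?_ ?_
  · intro c hc; simp at *; lia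
  · intro c _ c' _ h; lia
  · intro c hc; exact ⟨n - c, by simp at *; lia, by lia⟩
  · intro c _; simp

theorem laurentMul_coeff_eq_zero (β : A →ₗ[ℂ] B →ₗ[ℂ] C) (a : LaurentSeries A)
    (b : LaurentSeries B) {M N n : ℤ} (ha : ∀ i < M, a.coeff i = 0) (hb : ∀ i < N, b.coeff i = 0)
    (hn : n < M + N) : (laurentMul β a b).coeff n = 0 := by
  rw [laurentMul_coeff_Icc β a b n ha hb le_rfl le_rfl]
  rw [Finset.Icc_eq_empty (by lia), Finset.sum_empty]

theorem laurentMul_assoc (β : A →ₗ[ℂ] B →ₗ[ℂ] D) (β' : D →ₗ[ℂ] C →ₗ[ℂ] G)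
    (γ : B →ₗ[ℂ] C →ₗ[ℂ] E) (γ' : A →ₗ[ℂ] E →ₗ[ℂ] G)
    (h : ∀ a b c, β' (β a b) c = γ' a (γ b c))
    (a : LaurentSeries A) (b : LaurentSeries B) (c : LaurentSeries C) :
    laurentMul β' (laurentMul β a b) c = laurentMul γ' a (laurentMul γ b c) := by
  obtain ⟨M, ha⟩ := exists_coeff_eq_zero_of_lt a
  obtain ⟨N, hb⟩ := exists_coeff_eq_zero_of_lt b
  obtain ⟨P, hc⟩ := exists_coeff_eq_zero_of_lt c
  ext n
  have hab : ∀ i < M + N, (laurentMul β a b).coeff i = 0 := fun i hi =>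
    laurentMul_coeff_eq_zero β a b ha hb hi
  have hbc : ∀ i < N + P, (laurentMul γ b c).coeff i = 0 := fun i hi =>
    laurentMul_coeff_eq_zero γ b c hb hc hi
  rw [laurentMul_coeff_Icc β' _ c n hab hc le_rfl le_rfl,
    laurentMul_coeff_Icc γ' a _ n ha hbc le_rfl le_rfl]
  -- On both sides j is the total exponent of `b` and `c`, and k the exponent of `c`. The range of j
  -- is enlarged so that it no longer depends on k, and the double sums can be exchanged.
  have h1 : ∀ k ∈ Finset.Icc P (n - (M + N)),
      β' ((laurentMul β a b).coeff (n - k)) (c.coeff k) =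
        ∑ j ∈ Finset.Icc (N + P) (n - M), β' (β (a.coeff (n - j)) (b.coeff (j - k))) (c.coeff k) :=
        by
    intro k hk
    rw [Finset.mem_Icc] at hk
    rw [laurentMul_coeff_Icc β a b (n - k) ha hb (lo := N + P - k) (hi := n - M - k) (by lia)
      (by lia), map_sum, LinearMap.sum_apply]
    refine Finset.sum_bij (fun j _ => j + k) ?_ ?_ ?_ ?_
    · intro j hj; simp at *; lia
    · intro j _ j' _ h; lia
    · intro j hj; exact ⟨j - k, by simp at *; lia, by lia⟩
    · intro j _; rw [show n - k - j = n - (j + k) by ring, show j + k - k = j by ring]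
  have h2 : ∀ j ∈ Finset.Icc (N + P) (n - M),
      γ' (a.coeff (n - j)) ((laurentMul γ b c).coeff j) =
        ∑ k ∈ Finset.Icc P (n - (M + N)),
          β' (β (a.coeff (n - j)) (b.coeff (j - k))) (c.coeff k) := by
    intro j hj
    rw [Finset.mem_Icc] at hj
    rw [laurentMul_coeff_Icc γ b c j hb hc (lo := P) (hi := n - (M + N)) (by lia) (by lia), map_sum]
    exact Finset.sum_congr rfl fun k _ => (h _ _ _).symm
  rw [Finset.sum_congr rfl h1, Finset.sum_congr rfl h2, Finset.sum_comm]

theorem laurentMap_laurentMul (φ : C →ₗ[ℂ] D) (β : A →ₗ[ℂ] B →ₗ[ℂ] C) (a : LaurentSeries A)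
    (b : LaurentSeries B) : laurentMap φ (laurentMul β a b) = laurentMul (β.compr₂ φ) a b := by
  ext n
  rw [laurentMap_coeff]
  exact map_sum φ _ _

theorem laurentMul_laurentMap_left (φ : D →ₗ[ℂ] A) (β : A →ₗ[ℂ] B →ₗ[ℂ] C) (a : LaurentSeries D)
    (b : LaurentSeries B) : laurentMul β (laurentMap φ a) b = laurentMul (β ∘ₗ φ) a b := by
  obtain ⟨M, ha⟩ := exists_coeff_eq_zero_of_lt a
  obtain ⟨N, hb⟩ := exists_coeff_eq_zero_of_lt b
  ext n
  rw [laurentMul_coeff_Icc (β ∘ₗ φ) a b n ha hb le_rfl le_rfl,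
    laurentMul_coeff_Icc β _ b n (M := M) (fun i hi => by simp [laurentMap_coeff, ha i hi]) hb
      le_rfl le_rfl]
  rfl

theorem laurentMul_laurentMap_right (φ : D →ₗ[ℂ] B) (β : A →ₗ[ℂ] B →ₗ[ℂ] C) (a : LaurentSeries A)
    (b : LaurentSeries D) : laurentMul β a (laurentMap φ b) = laurentMul (β.compl₂ φ) a b := by
  rw [laurentMul_flip, laurentMul_laurentMap_left, laurentMul_flip]
  rfl

theorem laurentMap_comp_apply (φ : B →ₗ[ℂ] C) (ψ : A →ₗ[ℂ] B) (a : LaurentSeries A) :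
    laurentMap φ (laurentMap ψ a) = laurentMap (φ ∘ₗ ψ) a := rfl

theorem laurentMap_id (a : LaurentSeries A) : laurentMap LinearMap.id a = a := rfl

theorem laurentMap_single (φ : A →ₗ[ℂ] B) (n : ℤ) (a : A) :
    laurentMap φ (HahnSeries.single n a) = HahnSeries.single n (φ a) := by
  ext m
  rw [laurentMap_coeff]
  by_cases h : m = n
  · simp [h]
  · simp [HahnSeries.coeff_single_of_ne h]

theorem laurentMap_injective {φ : A →ₗ[ℂ] B} (h : Function.Injective φ) :
    Function.Injective (laurentMap φ) := by
  intro a b hab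
  ext n
  apply h
  rw [← laurentMap_coeff, hab, laurentMap_coeff]

theorem laurentMul_single_right_coeff (β : A →ₗ[ℂ] B →ₗ[ℂ] C) (a : LaurentSeries A) (k : ℤ) (b : B)
    (n : ℤ) : (laurentMul β a (HahnSeries.single k b)).coeff n = β (a.coeff (n - k)) b := by
  obtain ⟨M, ha⟩ := exists_coeff_eq_zero_of_lt a
  rw [laurentMul_coeff_Icc β a _ n (N := k) (lo := k) (hi := max k (n - M)) ha
    (fun i hi => HahnSeries.coeff_single_of_ne (by lia)) le_rfl (le_max_right _ _),
    Finset.sum_eq_single k]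
  · simp
  · intro c _ hc; simp [HahnSeries.coeff_single_of_ne hc]
  · intro h; simp at h

theorem laurentMul_single_zero_right (β : A →ₗ[ℂ] B →ₗ[ℂ] C) (a : LaurentSeries A) (b : B) :
    laurentMul β a (HahnSeries.single 0 b) = laurentMap (β.flip b) a := by
  ext n
  rw [laurentMul_single_right_coeff, laurentMap_coeff]
  simp

theorem laurentMul_single_zero_left (β : A →ₗ[ℂ] B →ₗ[ℂ] C) (a : A) (b : LaurentSeries B) :
    laurentMul β (HahnSeries.single 0 a) b = laurentMap (β a) b := by
  rw [laurentMul_flip, laurentMul_single_zero_right]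
  rfl

theorem laurentMap_add (φ ψ : A →ₗ[ℂ] B) : laurentMap (φ + ψ) = laurentMap φ + laurentMap ψ := by
  ext a n; rfl

theorem laurentMap_smul (c : ℂ) (φ : A →ₗ[ℂ] B) : laurentMap (c • φ) = c • laurentMap φ := by
  ext a n; rfl

/-- `laurentMap` as a linear map in the map. -/
def laurentMapₗ : (A →ₗ[ℂ] B) →ₗ[ℂ] LaurentSeries A →ₗ[ℂ] LaurentSeries B where
  toFun := laurentMap
  map_add' := laurentMap_add
  map_smul' := laurentMap_smul

/-! ### Multiplication by scalar series -/

theorem mulScalar_mul (a : LaurentSeries A) (f g : LaurentSeries ℂ) :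
    mulScalar (mulScalar a f) g = mulScalar a (f * g) := by
  rw [← mulSeries_eq]
  exact laurentMul_assoc _ _ _ _ (fun a b c => by simp [smul_smul, mul_comm]) a f g

theorem mulScalar_single_zero (a : A) (f : LaurentSeries ℂ) :
    mulScalar (HahnSeries.single 0 a) f = vecMulSeries a f := rfl

theorem mulScalar_one (a : LaurentSeries A) : mulScalar a 1 = a := by
  ext n
  refine (laurentMul_single_right_coeff _ a 0 1 n).trans ?_
  simp

theorem vecMulSeries_coeff (a : A) (f : LaurentSeries ℂ) (n : ℤ) :
    (vecMulSeries a f).coeff n = f.coeff n • a := by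
  change (laurentMul _ (HahnSeries.single 0 a) f).coeff n = _
  rw [laurentMul_single_zero_left, laurentMap_coeff]
  simp

theorem mulSeries₂_eq (f g : LaurentSeries (LaurentSeries ℂ)) : mulSeries₂ f g = f * g := by
  ext1
  funext n
  rw [HahnSeries.coeff_mul]
  refine Finset.sum_congr rfl fun ij _ => ?_
  exact mulSeries_eq _ _

theorem mulScalar₂_mul (a : LaurentSeries (LaurentSeries A))
    (f g : LaurentSeries (LaurentSeries ℂ)) :
    mulScalar₂ (mulScalar₂ a f) g = mulScalar₂ a (f * g) := by
  rw [← mulSeries₂_eq]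
  exact laurentMul_assoc _ _ mulSeries _ (fun a b c => by rw [mulScalar_mul, mulSeries_eq]) a f g

theorem mulScalar₂_one (a : LaurentSeries (LaurentSeries A)) : mulScalar₂ a 1 = a := by
  have := laurentMul_single_zero_right (mulScalar (A := A)) a 1
  refine this.trans ?_
  have h : (mulScalar (A := A)).flip 1 = LinearMap.id := by
    ext1 a; exact mulScalar_one a
  rw [h]; rfl

/-- A linear map `A → B((x₁))` applied to `h(x₂) a(x₂)`. -/
theorem laurentMap_mulScalar_atSnd (φ : A →ₗ[ℂ] LaurentSeries B) (a : LaurentSeries A)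
    (f : LaurentSeries ℂ) :
    laurentMap φ (mulScalar a f) = mulScalar₂ (laurentMap φ a) (atSnd f) := by
  unfold mulScalar mulScalar₂ atSnd
  rw [laurentMap_laurentMul, laurentMul_laurentMap_left, laurentMul_laurentMap_right]
  refine laurentMul_congr (fun a b => ?_) a f
  ext n
  have h := laurentMul_single_right_coeff ((LinearMap.lsmul ℂ B).flip) (φ a) 0 b n
  rw [sub_zero] at h
  refine Eq.trans ?_ h.symm
  rw [LinearMap.compr₂_apply, LinearMap.flip_apply, LinearMap.lsmul_apply, map_smul]
  rfl

theorem mulScalar₂_atFst (a : LaurentSeries (LaurentSeries A)) (f : LaurentSeries ℂ) :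
    mulScalar₂ a (atFst f) = laurentMap ((mulScalar (A := A)).flip f) a :=
  laurentMul_single_zero_right mulScalar a f

theorem toLaurent_tmul (a : A) (f : LaurentSeries ℂ) : toLaurent (a ⊗ₜ[ℂ] f) = vecMulSeries a f :=
    rfl

theorem toLaurent_coeff (t : A ⊗[ℂ] LaurentSeries ℂ) (n : ℤ) :
    (toLaurent t).coeff n =
      TensorProduct.rid ℂ A (LinearMap.lTensor A (HahnSeries.coeff.linearMap (R := ℂ) n) t) := by
  induction t with
  | zero => simp
  | add x y hx hy => simp [hx, hy]
  | tmul a f =>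
    rw [toLaurent_tmul, vecMulSeries_coeff]
    simp

/-- A tensor in `A ⊗ X` is zero if all its contractions with a separating family of functionals
vanish. -/
theorem tensor_ext_of_separating {X : Type*} [AddCommGroup X] [Module ℂ X] {ι : Type*}
    (ξ : ι → X →ₗ[ℂ] ℂ) (hξ : ∀ x, (∀ i, ξ i x = 0) → x = 0) {s t : A ⊗[ℂ] X}
    (h : ∀ i, LinearMap.lTensor A (ξ i) s = LinearMap.lTensor A (ξ i) t) : s = t := by
  classical
  -- A basis of `A` turns `A ⊗ X` into finitely supported families in `X`, on which the contraction
  -- with `ξ i` acts coordinate by coordinate.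
  let b := Module.Basis.ofVectorSpace ℂ A
  let e := TensorProduct.equivFinsuppOfBasisLeft (M := A) (N := X) b
  apply e.injective
  ext j
  rw [← sub_eq_zero]
  apply hξ
  intro i
  have key : ∀ u : A ⊗[ℂ] X, ξ i (e u j) =
      (TensorProduct.equivFinsuppOfBasisLeft (M := A) (N := ℂ) b (LinearMap.lTensor A (ξ i) u)) j :=
      by
    intro u
    induction u with
    | zero => simp
    | add x y hx hy => simp [hx, hy]
    | tmul a f => simp [e]
  rw [map_sub, key, key, h, sub_self]

/-- The coefficient functionals separate ℂ((x)). The module axioms are stated in V((x)); this brings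
them back to V ⊗ ℂ((x)), where the leg operators live. -/
theorem toLaurent_injective : Function.Injective (toLaurent (A := A)) := by
  intro s t h
  refine tensor_ext_of_separating (fun n : ℤ => HahnSeries.coeff.linearMap (R := ℂ) n)
    (fun x hx => by ext n; exact hx n) fun n => ?_
  apply (TensorProduct.rid ℂ A).injective
  rw [← toLaurent_coeff, h, toLaurent_coeff]

end LaurentCalculus


/-! ### Substitutions in scalar series: multiplicativity and derivatives -/

section Scalars

theorem mul_coeff_Icc (f g : LaurentSeries ℂ) {M N lo hi : ℤ} (n : ℤ)
    (hf : ∀ i < M, f.coeff i = 0) (hg : ∀ i < N, g.coeff i = 0) (hlo : lo ≤ N) (hhi : n - M ≤ hi) :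
    (f * g).coeff n = ∑ c ∈ Finset.Icc lo hi, f.coeff (n - c) * g.coeff c := by
  rw [← mulSeries_eq]
  refine (laurentMul_coeff_Icc _ f g n hf hg hlo hhi).trans (Finset.sum_congr rfl fun c _ => ?_)
  simp [mul_comm]

theorem mul_coeff_Icc₂ (f g : LaurentSeries (LaurentSeries ℂ)) {M N lo hi : ℤ} (n : ℤ)
    (hf : ∀ i < M, f.coeff i = 0) (hg : ∀ i < N, g.coeff i = 0) (hlo : lo ≤ N) (hhi : n - M ≤ hi) :
    (f * g).coeff n = ∑ c ∈ Finset.Icc lo hi, f.coeff (n - c) * g.coeff c := by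
  rw [← mulSeries₂_eq]
  refine (laurentMul_coeff_Icc _ f g n hf hg hlo hhi).trans (Finset.sum_congr rfl fun c _ => ?_)
  exact mulSeries_eq _ _

theorem vandermonde (a b : ℤ) (i : ℕ) :
    Ring.choose (a + b) i = ∑ j ∈ Finset.range (i + 1), Ring.choose a (i - j) * Ring.choose b j :=
    by
  rw [add_comm a b, Ring.add_choose_eq i (Commute.all b a),
    Finset.Nat.sum_antidiagonal_eq_sum_range_succ
      (fun x y => Ring.choose b x * Ring.choose a y)]
  exact Finset.sum_congr rfl fun j _ => mul_comm _ _

/-- The Leibniz rule for divided power derivatives. -/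
theorem hasseDeriv_mul (f g : LaurentSeries ℂ) (i : ℕ) :
    LaurentSeries.hasseDeriv ℂ i (f * g) = ∑ j ∈ Finset.range (i + 1),
      LaurentSeries.hasseDeriv ℂ (i - j) f * LaurentSeries.hasseDeriv ℂ j g := by
  obtain ⟨M, hf⟩ := exists_coeff_eq_zero_of_lt f
  obtain ⟨N, hg⟩ := exists_coeff_eq_zero_of_lt g
  ext p
  rw [LaurentSeries.hasseDeriv_coeff, mul_coeff_Icc f g (p + i) hf hg le_rfl le_rfl,
    HahnSeries.coeff_sum, Finset.smul_sum]
  have key : ∀ j ∈ Finset.range (i + 1),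
      (LaurentSeries.hasseDeriv ℂ (i - j) f * LaurentSeries.hasseDeriv ℂ j g).coeff p =
        ∑ c ∈ Finset.Icc N (p + i - M), (Ring.choose (p + i - c) (i - j) * Ring.choose c j) •
          (f.coeff (p + i - c) * g.coeff c) := by
    intro j hj
    have hj' : j ≤ i := by simpa [Nat.lt_succ_iff] using hj
    have e : ((i - j : ℕ) : ℤ) = i - j := by push_cast [hj']; ring
    rw [mul_coeff_Icc _ _ p (M := M - (i - j : ℕ)) (N := N - j) (lo := N - j) (hi := p + i - M - j)
      (fun n hn => by rw [LaurentSeries.hasseDeriv_coeff, hf _ (by lia), smul_zero])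
      (fun n hn => by rw [LaurentSeries.hasseDeriv_coeff, hg _ (by lia), smul_zero])
      le_rfl (by lia)]
    refine Finset.sum_bij (fun c _ => c + j) ?_ ?_ ?_ ?_
    · intro c hc; simp at *; lia
    · intro c _ c' _ h; lia
    · intro c hc; exact ⟨c - j, by simp at *; lia, by lia⟩
    · intro c _
      rw [LaurentSeries.hasseDeriv_coeff, LaurentSeries.hasseDeriv_coeff, e,
        show p - c + (i - j) = p + i - (c + j) by ring, smul_mul_smul_comm]
  rw [Finset.sum_congr rfl key, Finset.sum_comm]
  refine Finset.sum_congr rfl fun c _ => ?_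
  rw [← Finset.sum_smul, ← vandermonde]
  congr 2
  ring

theorem taylor_coeff_of_nonneg (c : ℂ) (f : LaurentSeries ℂ) (i : ℕ) :
    (taylor c f).coeff i = c ^ i • LaurentSeries.hasseDeriv ℂ i f := by
  simp [taylor]

theorem taylor_coeff_of_neg (c : ℂ) (f : LaurentSeries ℂ) {i : ℤ} (h : i < 0) :
    (taylor c f).coeff i = 0 := by
  simp [taylor, not_le.2 h]

theorem laurent_smul_mul {f g : LaurentSeries ℂ} (c : ℂ) : (c • f) * g = c • (f * g) := by
  rw [← mulSeries_eq, ← mulSeries_eq, map_smul, LinearMap.smul_apply]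

theorem laurent_mul_smul {f g : LaurentSeries ℂ} (c : ℂ) : f * (c • g) = c • (f * g) := by
  rw [← mulSeries_eq, ← mulSeries_eq, map_smul]

/-- This is the Leibniz rule for divided power derivatives, with c ^ n split as c ^ (n - j) c ^ j.
It is what allows `atAdd` and `atSub` to serve as changes of scalars. -/
theorem taylor_mul (c : ℂ) (f g : LaurentSeries ℂ) :
    taylor c (f * g) = taylor c f * taylor c g := by
  ext1
  funext n
  by_cases h : 0 ≤ n
  · lift n to ℕ using h
    rw [mul_coeff_Icc₂ _ _ (n : ℤ) (M := 0) (N := 0) (lo := 0) (hi := n)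
      (fun i hi => taylor_coeff_of_neg c f hi) (fun i hi => taylor_coeff_of_neg c g hi) le_rfl
      (by lia), taylor_coeff_of_nonneg, hasseDeriv_mul, Finset.smul_sum]
    refine Finset.sum_bij (fun j _ => (j : ℤ)) ?_ ?_ ?_ ?_
    · intro j hj; simp at *; lia
    · intro j _ j' _ h; exact_mod_cast h
    · intro j hj
      simp only [Finset.mem_Icc] at hj
      exact ⟨j.toNat, by simp; lia, by lia⟩
    · intro j hj
      have hj' : j ≤ n := by simpa [Nat.lt_succ_iff] using hj
      rw [show (n : ℤ) - j = ((n - j : ℕ) : ℤ) by push_cast [hj']; ring, taylor_coeff_of_nonneg,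
        taylor_coeff_of_nonneg, laurent_smul_mul, laurent_mul_smul, smul_smul, ← pow_add,
        Nat.sub_add_cancel hj']
  · rw [not_le] at h
    rw [taylor_coeff_of_neg _ _ h, mul_coeff_Icc₂ _ _ n (M := 0) (N := 0)
      (fun i hi => taylor_coeff_of_neg c f hi) (fun i hi => taylor_coeff_of_neg c g hi) le_rfl
      le_rfl,
      Finset.Icc_eq_empty (by lia), Finset.sum_empty]

theorem one_coeff (n : ℤ) : (1 : LaurentSeries ℂ).coeff n = if n = 0 then 1 else 0 := by
  by_cases h : n = 0 <;> simp [h, HahnSeries.coeff_one]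

theorem taylor_one (c : ℂ) : taylor c 1 = 1 := by
  ext1
  funext n
  by_cases h : 0 ≤ n
  · lift n to ℕ using h
    rw [taylor_coeff_of_nonneg]
    change _ = (HahnSeries.single (0 : ℤ) (1 : LaurentSeries ℂ)).coeff n
    change _ • LaurentSeries.hasseDeriv ℂ n (HahnSeries.single (0 : ℤ) (1 : ℂ)) = _
    rw [LaurentSeries.hasseDeriv_single]
    rcases n with _ | n
    · simp
    · rw [HahnSeries.coeff_single_of_ne (by lia), Ring.choose_zero_succ]
      simp
  · rw [taylor_coeff_of_neg _ _ (not_le.1 h)]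
    exact (HahnSeries.coeff_single_of_ne (by lia)).symm

theorem atFst_mul (f g : LaurentSeries ℂ) : atFst (f * g) = atFst f * atFst g :=
  (HahnSeries.single_mul_single (a := (0 : ℤ)) (b := 0) (r := f) (s := g)).symm

theorem atSnd_coeff (f : LaurentSeries ℂ) (n : ℤ) :
    (atSnd f).coeff n = HahnSeries.single 0 (f.coeff n) := rfl

theorem atSnd_mul (f g : LaurentSeries ℂ) : atSnd (f * g) = atSnd f * atSnd g := by
  rw [← mulSeries_eq, ← mulSeries₂_eq]
  unfold mulSeries mulSeries₂ mulScalar mulScalar₂ atSnd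
  rw [laurentMap_laurentMul, laurentMul_laurentMap_left, laurentMul_laurentMap_right]
  refine laurentMul_congr (fun a b => ?_) f g
  refine Eq.trans ?_ (mulSeries_eq _ _).symm
  refine Eq.trans ?_ (HahnSeries.single_mul_single (a := (0 : ℤ)) (b := 0) (r := a) (s := b)).symm
  exact congrArg (HahnSeries.single 0) (mul_comm b a)

theorem negVar_coeff (f : LaurentSeries ℂ) (n : ℤ) :
    (negVar f).coeff n = (-1 : ℂ) ^ n * f.coeff n := rfl

theorem negVar_mul (f g : LaurentSeries ℂ) : negVar (f * g) = negVar f * negVar g := by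
  obtain ⟨M, hf⟩ := exists_coeff_eq_zero_of_lt f
  obtain ⟨N, hg⟩ := exists_coeff_eq_zero_of_lt g
  ext n
  rw [negVar_coeff, mul_coeff_Icc f g n hf hg le_rfl le_rfl,
    mul_coeff_Icc (negVar f) (negVar g) n (M := M) (N := N)
      (fun i hi => by rw [negVar_coeff, hf i hi, mul_zero])
      (fun i hi => by rw [negVar_coeff, hg i hi, mul_zero]) le_rfl le_rfl, Finset.mul_sum]
  refine Finset.sum_congr rfl fun c _ => ?_
  rw [negVar_coeff, negVar_coeff, show (-1 : ℂ) ^ n = (-1) ^ (n - c) * (-1) ^ c by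
    rw [← zpow_add₀ (by norm_num)]; congr 1; ring]
  ring

theorem negVar_one : negVar 1 = 1 := by
  ext n
  rw [negVar_coeff, one_coeff]
  by_cases h : n = 0 <;> simp [h]

theorem negVar_negVar (f : LaurentSeries ℂ) : negVar (negVar f) = f := by
  ext n
  rw [negVar_coeff, negVar_coeff, ← mul_assoc, ← mul_zpow]
  simp

theorem laurentMap_negVar_mul (F G : LaurentSeries (LaurentSeries ℂ)) :
    laurentMap negVar (F * G) = laurentMap negVar F * laurentMap negVar G := by
  rw [← mulSeries₂_eq, ← mulSeries₂_eq]
  unfold mulSeries₂ mulScalar₂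
  rw [laurentMap_laurentMul, laurentMul_laurentMap_left, laurentMul_laurentMap_right]
  refine laurentMul_congr (fun a b => ?_) F G
  refine (congrArg negVar (mulSeries_eq a b)).trans ?_
  exact (negVar_mul a b).trans (mulSeries_eq _ _).symm

theorem hasseDeriv_negVar (i : ℕ) (f : LaurentSeries ℂ) :
    LaurentSeries.hasseDeriv ℂ i (negVar f) =
      (-1 : ℂ) ^ i • negVar (LaurentSeries.hasseDeriv ℂ i f) := by
  ext n
  rw [LaurentSeries.hasseDeriv_coeff, negVar_coeff, HahnSeries.coeff_smul, negVar_coeff,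
    LaurentSeries.hasseDeriv_coeff, zpow_add₀ (by norm_num), zpow_natCast]
  simp only [zsmul_eq_mul, smul_eq_mul]
  ring

theorem derivative_negVar (f : LaurentSeries ℂ) :
    LaurentSeries.derivative ℂ (negVar f) = - negVar (LaurentSeries.derivative ℂ f) := by
  rw [LaurentSeries.derivative_apply, LaurentSeries.derivative_apply, hasseDeriv_negVar,
    pow_one]
  ext n
  rw [HahnSeries.coeff_smul, HahnSeries.coeff_neg, neg_one_smul]

theorem derivative_mul (f g : LaurentSeries ℂ) :
    LaurentSeries.derivative ℂ (f * g) =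
      LaurentSeries.derivative ℂ f * g + f * LaurentSeries.derivative ℂ g := by
  simp only [LaurentSeries.derivative_apply]
  rw [hasseDeriv_mul]
  simp [Finset.sum_range_succ]

/-- Negating x₁ turns x₁ - x₂ into -(x₁ + x₂). In the hexagon this is how the argument -(x + z) of a
leg arises from x - z. -/
theorem laurentMap_negVar_atSub (f : LaurentSeries ℂ) :
    laurentMap negVar (atSub f) = atAdd (negVar f) := by
  ext1
  funext n
  rw [laurentMap_coeff]
  by_cases h : 0 ≤ n
  · lift n to ℕ using h
    rw [atSub, atAdd, taylor_coeff_of_nonneg, taylor_coeff_of_nonneg, hasseDeriv_negVar]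
    simp
  · rw [atSub, atAdd, taylor_coeff_of_neg _ _ (not_le.1 h), taylor_coeff_of_neg _ _ (not_le.1 h),
      map_zero]

theorem laurentMap_negVar_atFst (f : LaurentSeries ℂ) :
    laurentMap negVar (atFst f) = atFst (negVar f) := laurentMap_single _ 0 f

/-- The series `x`. -/
abbrev var : LaurentSeries ℂ := HahnSeries.single 1 1

theorem atSub_var : atSub var = atFst var - atSnd var := by
  ext1
  funext n
  rw [HahnSeries.coeff_sub]
  by_cases h : 0 ≤ n
  · lift n to ℕ using h
    rw [atSub, taylor_coeff_of_nonneg, LaurentSeries.hasseDeriv_single]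
    change _ = (HahnSeries.single (0 : ℤ) var).coeff (n : ℤ) -
      HahnSeries.single 0 ((HahnSeries.single (1 : ℤ) (1 : ℂ)).coeff (n : ℤ))
    rcases n with _ | _ | n
    · simp
    · simp
    · rw [HahnSeries.coeff_single_of_ne (by lia), HahnSeries.coeff_single_of_ne (by lia)]
      have : Ring.choose (1 : ℤ) (n + 1 + 1) = 0 := by
        have := Ring.choose_natCast (R := ℤ) 1 (n + 1 + 1)
        rw [Nat.cast_one] at this
        rw [this, Nat.choose_eq_zero_of_lt (by lia)]; rfl
      rw [this]
      simp
  · rw [atSub, taylor_coeff_of_neg _ _ (not_le.1 h)]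
    change _ = (HahnSeries.single (0 : ℤ) var).coeff n -
      HahnSeries.single 0 ((HahnSeries.single (1 : ℤ) (1 : ℂ)).coeff n)
    rw [HahnSeries.coeff_single_of_ne (by lia), HahnSeries.coeff_single_of_ne (by lia)]
    simp

/-- A Laurent series times a power of the variable is a power series. -/
theorem exists_var_pow_mul (f : LaurentSeries ℂ) :
    ∃ N : ℕ, ∀ n < 0, (f * var ^ N).coeff n = 0 := by
  obtain ⟨M, hf⟩ := exists_coeff_eq_zero_of_lt f
  refine ⟨(-M).toNat, fun n hn => ?_⟩
  rw [HahnSeries.single_pow]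
  rw [← mulSeries_eq]
  refine (laurentMul_single_right_coeff _ f _ _ n).trans ?_
  rw [hf _ (by simp; lia)]
  simp

theorem mul_var_pow_coeff (f : LaurentSeries ℂ) (N : ℕ) (n : ℤ) :
    (f * var ^ N).coeff n = f.coeff (n - N) := by
  rw [HahnSeries.single_pow, ← mulSeries_eq]
  refine (laurentMul_single_right_coeff _ f _ _ n).trans ?_
  simp

end Scalars


/-! ### Multiplication by x₁ - x₂ and the substitution x₁ = x₂ + x₀ -/

section Formal

variable {A : Type*} [AddCommGroup A] [Module ℂ A]

theorem mulSub_add (F G : ℤ → ℤ → A) : mulSub (F + G) = mulSub F + mulSub G := by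
  funext m n
  simp only [mulSub, Pi.add_apply]
  abel

theorem mulSub_smul (c : ℂ) (F : ℤ → ℤ → A) : mulSub (c • F) = c • mulSub F := by
  funext m n
  simp only [mulSub, Pi.smul_apply, smul_sub]

theorem mulSubPow_succ (k : ℕ) (F : ℤ → ℤ → A) :
    mulSubPow (k + 1) F = mulSub (mulSubPow k F) := Function.iterate_succ_apply' _ _ _

theorem mulSubPow_add_exp (k l : ℕ) (F : ℤ → ℤ → A) :
    mulSubPow (k + l) F = mulSubPow k (mulSubPow l F) := Function.iterate_add_apply _ _ _ _

theorem mulSubPow_add (k : ℕ) (F G : ℤ → ℤ → A) :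
    mulSubPow k (F + G) = mulSubPow k F + mulSubPow k G := by
  induction k with
  | zero => rfl
  | succ k ih => rw [mulSubPow_succ, ih, mulSub_add, ← mulSubPow_succ, ← mulSubPow_succ]

theorem mulSubPow_smul (k : ℕ) (c : ℂ) (F : ℤ → ℤ → A) :
    mulSubPow k (c • F) = c • mulSubPow k F := by
  induction k with
  | zero => rfl
  | succ k ih => rw [mulSubPow_succ, ih, mulSub_smul, ← mulSubPow_succ]

/-- `F(x₂, x₁)`. -/
def swapVars (F : ℤ → ℤ → A) : ℤ → ℤ → A := fun m n => F n m

theorem mulSub_swapVars (F : ℤ → ℤ → A) :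
    mulSub (swapVars F) = (-1 : ℂ) • swapVars (mulSub F) := by
  funext m n
  simp [mulSub, swapVars]

theorem mulSubPow_swapVars (k : ℕ) (F : ℤ → ℤ → A) :
    mulSubPow k (swapVars F) = (-1 : ℂ) ^ k • swapVars (mulSubPow k F) := by
  induction k with
  | zero => simp [mulSubPow]
  | succ k ih =>
    rw [mulSubPow_succ, ih, mulSub_smul, mulSub_swapVars, smul_smul, mulSubPow_succ, pow_succ]

theorem coeff₂Swap_eq (F : LaurentSeries (LaurentSeries A)) : coeff₂Swap F = swapVars (coeff₂ F) :=
    rfl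

theorem mulScalar_coeff_Icc (a : LaurentSeries A) (g : LaurentSeries ℂ) {M N lo hi : ℤ} (n : ℤ)
    (ha : ∀ i < M, a.coeff i = 0) (hg : ∀ i < N, g.coeff i = 0) (hlo : lo ≤ N) (hhi : n - M ≤ hi) :
    (mulScalar a g).coeff n = ∑ c ∈ Finset.Icc lo hi, g.coeff c • a.coeff (n - c) :=
  laurentMul_coeff_Icc _ a g n ha hg hlo hhi

theorem mulScalar₂_atSnd_coeff_Icc (F : LaurentSeries (LaurentSeries A)) (g : LaurentSeries ℂ)
    {M N lo hi : ℤ} (n : ℤ) (ha : ∀ i < M, F.coeff i = 0) (hg : ∀ i < N, g.coeff i = 0)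
    (hlo : lo ≤ N) (hhi : n - M ≤ hi) :
    (mulScalar₂ F (atSnd g)).coeff n = ∑ c ∈ Finset.Icc lo hi, g.coeff c • F.coeff (n - c) := by
  refine (laurentMul_coeff_Icc _ F (atSnd g) n ha
    (fun i hi => by rw [atSnd_coeff, hg i hi]; simp) hlo hhi).trans ?_
  refine Finset.sum_congr rfl fun c _ => ?_
  ext m
  refine (laurentMul_single_right_coeff _ (F.coeff (n - c)) 0 (g.coeff c) m).trans ?_
  simp

/-- Multiplication by x₁ - x₂, defined on bare families of coefficients, is realised inside
A((x₁))((x₂)), where it can be commuted with other scalar factors. -/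
theorem coeff₂_mul_atSub_var (F : LaurentSeries (LaurentSeries A)) :
    coeff₂ (mulScalar₂ F (atSub var)) = mulSub (coeff₂ F) := by
  funext m n
  have h : mulScalar₂ F (atFst var - atSnd var) =
      mulScalar₂ F (atFst var) - mulScalar₂ F (atSnd var) :=
    LinearMap.map_sub (mulScalar₂ F) (atFst var) (atSnd var)
  rw [atSub_var, h]
  change ((mulScalar₂ F (atFst var)).coeff n - (mulScalar₂ F (atSnd var)).coeff n).coeff m = _
  rw [mulScalar₂_atFst, HahnSeries.coeff_sub]
  congr 1
  · refine (laurentMul_single_right_coeff _ (F.coeff n) 1 1 m).trans ?_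
    simp [coeff₂]
  · obtain ⟨M, hM⟩ := exists_coeff_eq_zero_of_lt F
    rw [mulScalar₂_atSnd_coeff_Icc F var n hM (N := 1) (lo := 1) (hi := max 1 (n - M))
      (fun i hi => HahnSeries.coeff_single_of_ne (by lia)) le_rfl (le_max_right _ _),
      Finset.sum_eq_single 1]
    · simp [coeff₂]
    · intro c _ hc
      rw [HahnSeries.coeff_single_of_ne hc, zero_smul]
    · intro h; simp at h

theorem atSub_pow (f : LaurentSeries ℂ) (k : ℕ) : atSub (f ^ k) = atSub f ^ k := by
  induction k with
  | zero => exact taylor_one _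
  | succ k ih => rw [pow_succ, pow_succ, ← ih]; exact taylor_mul _ _ _

theorem coeff₂_mul_atSub_var_pow (F : LaurentSeries (LaurentSeries A)) (k : ℕ) :
    coeff₂ (mulScalar₂ F (atSub var ^ k)) = mulSubPow k (coeff₂ F) := by
  induction k with
  | zero => rw [pow_zero, mulScalar₂_one]; rfl
  | succ k ih => rw [pow_succ, ← mulScalar₂_mul, coeff₂_mul_atSub_var, ih, mulSubPow_succ]

/-- The support of `F` lies in `m ≥ M`, `n ≥ N`. -/
def BoundedBelow (M N : ℤ) (F : ℤ → ℤ → A) : Prop := ∀ m n : ℤ, m < M ∨ n < N → F m n = 0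

theorem BoundedBelow.mono {M N M' N' : ℤ} {F : ℤ → ℤ → A} (h : BoundedBelow M N F) (hM : M' ≤ M)
    (hN : N' ≤ N) : BoundedBelow M' N' F := fun m n hmn => h m n (by lia)

theorem BoundedBelow.add {M N : ℤ} {F G : ℤ → ℤ → A} (h : BoundedBelow M N F)
    (h' : BoundedBelow M N G) : BoundedBelow M N (F + G) := fun m n hmn => by
  rw [Pi.add_apply, Pi.add_apply, h m n hmn, h' m n hmn, add_zero]

theorem BoundedBelow.mulSub {M N : ℤ} {F : ℤ → ℤ → A} (h : BoundedBelow M N F) :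
    BoundedBelow M N (mulSub F) := fun m n hmn => by
  rw [VertexAlg.mulSub, h _ _ (by lia), h _ _ (by lia), sub_zero]

theorem isJointLaurent_iff {F : ℤ → ℤ → A} : IsJointLaurent F ↔ ∃ N, BoundedBelow N N F := Iff.rfl

theorem BoundedBelow.isJointLaurent {M N : ℤ} {F : ℤ → ℤ → A} (h : BoundedBelow M N F) :
    IsJointLaurent F := ⟨min M N, h.mono (min_le_left _ _) (min_le_right _ _)⟩

theorem IsJointLaurent.add {F G : ℤ → ℤ → A} (hF : IsJointLaurent F) (hG : IsJointLaurent G) :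
    IsJointLaurent (F + G) := by
  obtain ⟨M, hM⟩ := isJointLaurent_iff.1 hF
  obtain ⟨N, hN⟩ := isJointLaurent_iff.1 hG
  exact ((hM.mono (min_le_left M N) (min_le_left M N)).add
    (hN.mono (min_le_right M N) (min_le_right M N))).isJointLaurent

theorem IsJointLaurent.smul {F : ℤ → ℤ → A} (hF : IsJointLaurent F) (c : ℂ) :
    IsJointLaurent (c • F) := by
  obtain ⟨M, hM⟩ := hF
  exact ⟨M, fun m n h => by simp [hM m n h]⟩

theorem IsJointLaurent.mulSub {F : ℤ → ℤ → A} (hF : IsJointLaurent F) :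
    IsJointLaurent (mulSub F) := by
  obtain ⟨M, hM⟩ := isJointLaurent_iff.1 hF
  exact hM.mulSub.isJointLaurent

theorem substAdd_neg (F : ℤ → ℤ → A) {i : ℤ} (hi : i < 0) (p : ℤ) : substAdd F i p = 0 :=
  if_neg (not_le.2 hi)

/-- Only m ≥ M and p - m + i ≥ N contribute. The freedom in `lo` and `hi` lets several series be
summed over one common range. -/
theorem substAdd_Icc {M N lo hi : ℤ} {F : ℤ → ℤ → A} (hF : BoundedBelow M N F) (i : ℕ) (p : ℤ)
    (hlo : lo ≤ M) (hhi : p + i - N ≤ hi) :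
    substAdd F i p = ∑ m ∈ Finset.Icc lo hi, Ring.choose m i • F m (p - m + i) := by
  rw [substAdd, if_pos (by lia), Int.toNat_natCast]
  refine finsum_eq_sum_of_support_subset _ fun m hm => ?_
  rw [Finset.coe_Icc, Set.mem_Icc]
  by_contra h
  refine hm ?_
  change _ • F m (p - m + i) = 0
  rw [hF _ _ (by lia), smul_zero]

theorem substAdd_eq_zero {M N : ℤ} {F : ℤ → ℤ → A} (hF : BoundedBelow M N F) {i p : ℤ}
    (h : p + i < M + N) : substAdd F i p = 0 := by
  by_cases hi : 0 ≤ i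
  · lift i to ℕ using hi
    rw [substAdd_Icc hF i p le_rfl le_rfl, Finset.Icc_eq_empty (by lia), Finset.sum_empty]
  · exact substAdd_neg F (not_le.1 hi) p

theorem substAdd_add {F G : ℤ → ℤ → A} (hF : IsJointLaurent F) (hG : IsJointLaurent G) :
    substAdd (F + G) = substAdd F + substAdd G := by
  obtain ⟨M', hM'⟩ := isJointLaurent_iff.1 hF
  obtain ⟨N', hN'⟩ := isJointLaurent_iff.1 hG
  have hM := hM'.mono (min_le_left M' N') (min_le_left M' N')
  have hN := hN'.mono (min_le_right M' N') (min_le_right M' N')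
  funext i p
  rw [Pi.add_apply, Pi.add_apply]
  by_cases hi : 0 ≤ i
  · lift i to ℕ using hi
    rw [substAdd_Icc hM i p le_rfl le_rfl, substAdd_Icc hN i p le_rfl le_rfl,
      substAdd_Icc (hM.add hN) i p le_rfl le_rfl, ← Finset.sum_add_distrib]
    simp
  · simp [substAdd_neg _ (not_le.1 hi)]

theorem substAdd_smul (c : ℂ) {F : ℤ → ℤ → A} (hF : IsJointLaurent F) :
    substAdd (c • F) = c • substAdd F := by
  obtain ⟨M, hM⟩ := isJointLaurent_iff.1 hF
  have hM' : BoundedBelow M M (c • F) := fun m n h => by simp [hM m n h]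
  funext i p
  rw [Pi.smul_apply, Pi.smul_apply]
  by_cases hi : 0 ≤ i
  · lift i to ℕ using hi
    rw [substAdd_Icc hM i p le_rfl le_rfl, substAdd_Icc hM' i p le_rfl le_rfl, Finset.smul_sum]
    exact Finset.sum_congr rfl fun m _ => smul_comm _ _ _
  · simp [substAdd_neg _ (not_le.1 hi)]

/-- Multiplication by `x₁ - x₂` becomes multiplication by `x₀`. -/
theorem substAdd_mulSub {F : ℤ → ℤ → A} (hF : IsJointLaurent F) (i p : ℤ) :
    substAdd (mulSub F) i p = substAdd F (i - 1) p := by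
  obtain ⟨M, hM⟩ := isJointLaurent_iff.1 hF
  by_cases hi : 0 ≤ i
  · lift i to ℕ using hi
    rw [substAdd_Icc hM.mulSub i p (lo := M) (hi := p + i - M + 1) le_rfl (by lia)]
    simp only [mulSub, smul_sub, Finset.sum_sub_distrib]
    have e1 : ∑ m ∈ Finset.Icc M (p + i - M + 1), Ring.choose m i • F (m - 1) (p - m + i) =
        ∑ m ∈ Finset.Icc M (p + i - M), Ring.choose (m + 1) i • F m (p - m + i - 1) := by
      rw [← Finset.sum_subset (s₁ := Finset.Icc (M + 1) (p + i - M + 1))]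
      · refine Finset.sum_bij (fun m _ => m - 1) ?_ ?_ ?_ ?_
        · intro m hm; simp at *; lia
        · intro m _ m' _ h; lia
        · intro m hm; exact ⟨m + 1, by simp at *; lia, by lia⟩
        · intro m _
          rw [show m - 1 + 1 = m by ring, show p - (m - 1) + i - 1 = p - m + i by ring]
      · exact Finset.Icc_subset_Icc (by lia) le_rfl
      · intro m hm hm'
        rw [Finset.mem_Icc] at hm hm'
        rw [hM _ _ (by lia), smul_zero]
    have e2 : ∑ m ∈ Finset.Icc M (p + i - M + 1), Ring.choose m i • F m (p - m + i - 1) =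
        ∑ m ∈ Finset.Icc M (p + i - M), Ring.choose m i • F m (p - m + i - 1) := by
      refine (Finset.sum_subset (Finset.Icc_subset_Icc le_rfl (by lia)) ?_).symm
      intro m hm hm'
      rw [Finset.mem_Icc] at hm hm'
      rw [hM _ _ (by lia), smul_zero]
    rw [e1, e2, ← Finset.sum_sub_distrib]
    -- For i = 0 both binomial coefficients equal 1 and the difference vanishes; otherwise Pascal's
    -- rule leaves the coefficient of index i - 1.
    rcases i with _ | i
    · rw [substAdd_neg _ (by simp)]
      simp
    · rw [show ((i + 1 : ℕ) : ℤ) - 1 = i by push_cast; ring,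
        substAdd_Icc hM i p (hi := p + (i + 1 : ℕ) - M) le_rfl (by push_cast; lia)]
      refine Finset.sum_congr rfl fun m _ => ?_
      rw [← sub_smul, Ring.choose_succ_succ, add_sub_cancel_right]
      congr 2
      push_cast; ring
  · rw [substAdd_neg _ (not_le.1 hi), substAdd_neg _ (by lia)]

/-- The effect of `x₁ ^ c ↦ (x₂ + x₀) ^ c`. -/
theorem substAdd_shift {M N : ℤ} {F : ℤ → ℤ → A} (hF : BoundedBelow M N F) (c : ℤ) (i : ℕ) (p : ℤ) :
    substAdd (fun m n => F (m - c) n) i p =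
      ∑ j ∈ Finset.range (i + 1), Ring.choose c j • substAdd F ((i - j : ℕ) : ℤ) (p - c + j) := by
  have hF' : BoundedBelow (M + c) N (fun m n => F (m - c) n) := fun m n h => hF _ _ (by lia)
  rw [substAdd_Icc hF' i p le_rfl le_rfl]
  have e : ∀ j ∈ Finset.range (i + 1), Ring.choose c j • substAdd F ((i - j : ℕ) : ℤ) (p - c + j) =
      ∑ m ∈ Finset.Icc (M + c) (p + i - N),
        (Ring.choose (m - c) (i - j) * Ring.choose c j) • F (m - c) (p - m + i) := by
    intro j hj
    have hj' : j ≤ i := by simpa [Nat.lt_succ_iff] using hj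
    rw [substAdd_Icc hF (i - j) (p - c + j) (lo := M) (hi := p + i - N - c) le_rfl
      (by push_cast [hj']; lia), Finset.smul_sum]
    refine Finset.sum_bij (fun m _ => m + c) ?_ ?_ ?_ ?_
    · intro m hm; simp at *; lia
    · intro m _ m' _ h; lia
    · intro m hm; exact ⟨m - c, by simp at *; lia, by lia⟩
    · intro m _
      rw [add_sub_cancel_right, smul_smul, mul_comm]
      congr 2
      push_cast [hj']; ring
  rw [Finset.sum_congr rfl e, Finset.sum_comm]
  refine Finset.sum_congr rfl fun m _ => ?_
  -- The expansion of (x₂ + x₀) ^ m as the product of (x₂ + x₀) ^ (m - c) and (x₂ + x₀) ^ c.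
  rw [← Finset.sum_smul, ← vandermonde, sub_add_cancel]

end Formal


/-! ### Expansions under x₁ = x₂ + x₀ and their stability under scalar factors -/

section Expansion

variable {A : Type*} [AddCommGroup A] [Module ℂ A]

theorem mulSubPow_zero_fun (k : ℕ) : mulSubPow k (0 : ℤ → ℤ → A) = 0 := by
  have := mulSubPow_smul k 0 (0 : ℤ → ℤ → A)
  simpa using this

theorem coeff₂_add (F G : LaurentSeries (LaurentSeries A)) :
    coeff₂ (F + G) = coeff₂ F + coeff₂ G := by
  funext m n; simp [coeff₂]

theorem coeff₂_smul (c : ℂ) (F : LaurentSeries (LaurentSeries A)) :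
    coeff₂ (c • F) = c • coeff₂ F := by
  funext m n; simp [coeff₂]

/-- `(x₁ - x₂)^k F(x₁, x₂)` lies in `A((x₁, x₂))` and becomes `x₀^k G(x₀, x₂)` under
`x₁ = x₂ + x₀`.  In `G`, the inner variable is `x₂` and the outer variable is `x₀`. -/
def Expands (k : ℕ) (F G : LaurentSeries (LaurentSeries A)) : Prop :=
  IsJointLaurent (mulSubPow k (coeff₂ F)) ∧
    substAdd (mulSubPow k (coeff₂ F)) = fun i p => (G.coeff (i - k)).coeff p

namespace Expands

variable {k : ℕ} {F G F' G' : LaurentSeries (LaurentSeries A)}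

theorem add (h : Expands k F G) (h' : Expands k F' G') : Expands k (F + F') (G + G') := by
  refine ⟨?_, ?_⟩
  · rw [coeff₂_add, mulSubPow_add]
    exact h.1.add h'.1
  · rw [coeff₂_add, mulSubPow_add, substAdd_add h.1 h'.1, h.2, h'.2]
    funext i p
    simp

theorem zero (k : ℕ) : Expands k (0 : LaurentSeries (LaurentSeries A)) 0 := by
  have e : coeff₂ (0 : LaurentSeries (LaurentSeries A)) = 0 := by funext m n; simp [coeff₂]
  refine ⟨?_, ?_⟩
  · rw [e, mulSubPow_zero_fun]
    exact ⟨0, fun _ _ _ => rfl⟩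
  · rw [e, mulSubPow_zero_fun]
    funext i p
    simp [substAdd]

theorem succ (h : Expands k F G) : Expands (k + 1) F G := by
  refine ⟨?_, ?_⟩
  · rw [mulSubPow_succ]
    exact h.1.mulSub
  · rw [mulSubPow_succ]
    funext i p
    rw [substAdd_mulSub h.1, h.2]
    change (G.coeff (i - 1 - k)).coeff p = (G.coeff (i - (k + 1 : ℕ))).coeff p
    congr 2
    push_cast; ring

theorem mono (h : Expands k F G) {l : ℕ} (hl : k ≤ l) : Expands l F G := by
  induction hl with
  | refl => exact h
  | step _ ih => exact ih.succ

/-- After both orders are raised to their maximum l, the series x₀ ^ l G and x₀ ^ l G' come from the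
same substitution, and x₀ ^ l cancels. The two orders may differ, which is what makes the lemma
useful for modules. -/
theorem unique {k' : ℕ} (h : Expands k F G) (h' : Expands k' F G') : G = G' := by
  have h1 := (h.mono (le_max_left k k')).2
  have h2 := (h'.mono (le_max_right k k')).2
  ext i p
  have := congrFun (congrFun (h1.symm.trans h2) (i + (max k k' : ℕ))) p
  simpa using this

/-- The substitution yields only nonnegative powers of x₀, so G has a pole of order at most k in x₀.
-/
theorem coeff_eq_zero (h : Expands k F G) {i : ℤ} (hi : i < -k) : G.coeff i = 0 := by
  ext p
  have := congrFun (congrFun h.2 (i + k)) p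
  rw [substAdd_neg _ (by lia)] at this
  simpa using this.symm

end Expands

/-- The base case from which the expansion of any finite sum of terms w f(x₁) g(x₂) is built, with
order 0. -/
theorem Expands.const (w : A) :
    Expands 0 (HahnSeries.single 0 (HahnSeries.single 0 w))
    (HahnSeries.single 0 (HahnSeries.single 0 w)) := by
  have e : ∀ m n : ℤ, mulSubPow 0 (coeff₂ (HahnSeries.single 0 (HahnSeries.single 0 w))) m n =
      if m = 0 ∧ n = 0 then w else 0 := by
    intro m n
    change ((HahnSeries.single (0 : ℤ) (HahnSeries.single (0 : ℤ) w)).coeff n).coeff m = _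
    by_cases hn : n = 0
    · by_cases hm : m = 0
      · simp [hn, hm]
      · simp [hn, hm, HahnSeries.coeff_single_of_ne hm]
    · simp [hn, HahnSeries.coeff_single_of_ne hn]
  have hb : BoundedBelow 0 0 (mulSubPow 0 (coeff₂ (HahnSeries.single 0 (HahnSeries.single 0 w)))) :=
    by
    intro m n h
    rw [e, if_neg (by lia)]
  refine ⟨hb.isJointLaurent, ?_⟩
  funext i p
  by_cases hi : 0 ≤ i
  · lift i to ℕ using hi
    rw [substAdd_Icc hb i p (lo := 0) (hi := max 0 (p + i)) le_rfl (by simp),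
      Finset.sum_eq_single 0]
    · rw [e]
      rcases i with _ | i
      · by_cases hp : p = 0
        · simp [hp]
        · simp [hp, HahnSeries.coeff_single_of_ne hp]
      · rw [Ring.choose_zero_succ, zero_smul, HahnSeries.coeff_single_of_ne (by push_cast; lia)]
        simp
    · intro m _ hm
      rw [e, if_neg (by lia), smul_zero]
    · intro h; simp at h
  · rw [substAdd_neg _ (not_le.1 hi), HahnSeries.coeff_single_of_ne (by push_cast; lia)]
    simp

theorem doubleLaurent_mul_comm (Q R : LaurentSeries (LaurentSeries ℂ)) : Q * R = R * Q :=
  mul_comm Q R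

/-- The power of x₁ - x₂ is brought next to F, so that the further factor multiplies a series
already bounded below in both variables. -/
theorem mulSubPow_mulScalar₂ (k : ℕ) (F : LaurentSeries (LaurentSeries A))
    (Q : LaurentSeries (LaurentSeries ℂ)) :
    mulSubPow k (coeff₂ (mulScalar₂ F Q)) =
      coeff₂ (mulScalar₂ (mulScalar₂ F (atSub var ^ k)) Q) := by
  rw [← coeff₂_mul_atSub_var_pow, mulScalar₂_mul, mulScalar₂_mul, doubleLaurent_mul_comm]

theorem coeff_eq_zero_of_boundedBelow {M N : ℤ} {F : LaurentSeries (LaurentSeries A)}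
    (h : BoundedBelow M N (coeff₂ F)) {n : ℤ} (hn : n < N) : F.coeff n = 0 := by
  ext m; exact h m n (Or.inr hn)

theorem coeff₂_mul_atFst {M N : ℤ} {F : LaurentSeries (LaurentSeries A)}
    (hF : BoundedBelow M N (coeff₂ F)) {g : LaurentSeries ℂ} {P lo hi : ℤ}
    (hg : ∀ i < P, g.coeff i = 0) (m n : ℤ) (hlo : lo ≤ P) (hhi : m - M ≤ hi) :
    coeff₂ (mulScalar₂ F (atFst g)) m n =
      ∑ c ∈ Finset.Icc lo hi, g.coeff c • coeff₂ F (m - c) n := by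
  rw [mulScalar₂_atFst]
  exact mulScalar_coeff_Icc (F.coeff n) g m (fun i hi => hF i n (Or.inl hi)) hg hlo hhi

theorem coeff₂_mul_atSnd {M N : ℤ} {F : LaurentSeries (LaurentSeries A)}
    (hF : BoundedBelow M N (coeff₂ F)) {g : LaurentSeries ℂ} {P lo hi : ℤ}
    (hg : ∀ i < P, g.coeff i = 0) (m n : ℤ) (hlo : lo ≤ P) (hhi : n - N ≤ hi) :
    coeff₂ (mulScalar₂ F (atSnd g)) m n =
      ∑ c ∈ Finset.Icc lo hi, g.coeff c • coeff₂ F m (n - c) := by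
  change ((mulScalar₂ F (atSnd g)).coeff n).coeff m = _
  rw [mulScalar₂_atSnd_coeff_Icc F g n (fun i hi => coeff_eq_zero_of_boundedBelow hF hi) hg hlo hhi,
    HahnSeries.coeff_sum]
  rfl

/-- A factor g(x₁) becomes g(x₂ + x₀). Each monomial of exponent c of g contributes the binomial
expansion of (x₂ + x₀) ^ c (`substAdd_shift`), and collecting these over c gives the divided
derivatives of g. The order k is unchanged. -/
theorem Expands.mul_atFst {k : ℕ} {F G : LaurentSeries (LaurentSeries A)} (h : Expands k F G)
    (g : LaurentSeries ℂ) :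
    Expands k (mulScalar₂ F (atFst g)) (mulScalar₂ G (atAdd g)) := by
  obtain ⟨P, hg⟩ := exists_coeff_eq_zero_of_lt g
  have h1 := h.1
  have h2 := h.2
  rw [← coeff₂_mul_atSub_var_pow] at h1 h2
  obtain ⟨B, hB⟩ := isJointLaurent_iff.1 h1
  unfold Expands
  rw [mulSubPow_mulScalar₂]
  set E := mulScalar₂ F (atSub var ^ k)
  have hb : BoundedBelow (B + P) B (coeff₂ (mulScalar₂ E (atFst g))) := by
    intro m n hmn
    rw [coeff₂_mul_atFst hB hg m n le_rfl le_rfl]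
    refine Finset.sum_eq_zero fun c hc => ?_
    rw [Finset.mem_Icc] at hc
    rw [hB _ _ (by lia), smul_zero]
  refine ⟨hb.isJointLaurent, ?_⟩
  have hG0 : ∀ i < -(k : ℤ), G.coeff i = 0 := fun i hi => h.coeff_eq_zero hi
  have hGs : ∀ (j : ℤ) (p : ℤ), (G.coeff (j - k)).coeff p = substAdd (coeff₂ E) j p := fun j p => by
    rw [h2]
  funext i p
  by_cases hi : 0 ≤ i
  · lift i to ℕ using hi
    have hlhs : substAdd (coeff₂ (mulScalar₂ E (atFst g))) i p =
        ∑ c ∈ Finset.Icc P (p + i - 2 * B),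
          g.coeff c • substAdd (fun m n => coeff₂ E (m - c) n) i p := by
      rw [substAdd_Icc hb i p le_rfl le_rfl]
      have e1 : ∀ c ∈ Finset.Icc P (p + i - 2 * B),
          g.coeff c • substAdd (fun m n => coeff₂ E (m - c) n) i p =
          ∑ m ∈ Finset.Icc (B + P) (p + i - B),
            g.coeff c • (Ring.choose m i • coeff₂ E (m - c) (p - m + i)) := by
        intro c hc
        rw [Finset.mem_Icc] at hc
        have hs : BoundedBelow (B + P) B (fun m n => coeff₂ E (m - c) n) :=
          fun m n hmn => hB _ _ (by lia)
        rw [substAdd_Icc hs i p le_rfl le_rfl, Finset.smul_sum]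
      rw [Finset.sum_congr rfl e1, Finset.sum_comm]
      refine Finset.sum_congr rfl fun m hm => ?_
      rw [Finset.mem_Icc] at hm
      rw [coeff₂_mul_atFst hB hg m _ (hi := p + i - 2 * B) le_rfl (by lia), Finset.smul_sum]
      exact Finset.sum_congr rfl fun c _ => smul_comm _ _ _
    have hrhs : ((mulScalar₂ G (atAdd g)).coeff (i - k)).coeff p =
        ∑ j ∈ Finset.range (i + 1), ∑ c ∈ Finset.Icc P (p + i - 2 * B),
          g.coeff c • (Ring.choose c j • substAdd (coeff₂ E) ((i - j : ℕ) : ℤ) (p - c + j)) := by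
      have := laurentMul_coeff_Icc (mulScalar (A := A)) G (atAdd g) (M := -k) (N := 0) (lo := 0)
        (hi := i) (i - k : ℤ) hG0 (fun j hj => taylor_coeff_of_neg _ _ hj) le_rfl (by lia)
      have h3 : (mulScalar₂ G (atAdd g)).coeff (i - k : ℤ) = _ := this
      rw [h3, HahnSeries.coeff_sum]
      refine (Finset.sum_bij (fun (j : ℕ) _ => (j : ℤ)) ?_ ?_ ?_ ?_).symm
      · intro j hj; simp at *; lia
      · intro j _ j' _ h; exact_mod_cast h
      · intro j hj
        simp only [Finset.mem_Icc] at hj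
        exact ⟨j.toNat, by simp; lia, by lia⟩
      · intro j hj
        have hj' : j ≤ i := by simpa [Nat.lt_succ_iff] using hj
        have e : ((i - j : ℕ) : ℤ) = i - j := by push_cast [hj']; ring
        rw [show (i : ℤ) - k - j = ((i - j : ℕ) : ℤ) - k by rw [e]; ring, atAdd,
          taylor_coeff_of_nonneg, one_pow, one_smul]
        -- The substituted series at order i - j has no coefficient at q with q + (i - j) < 2 B
        -- (`substAdd_eq_zero`), whence the bound; the jth derivative lowers the exponents of g by
        -- j.
        refine (Eq.trans (mulScalar_coeff_Icc _ _ (M := 2 * B - (i - j)) (N := P - j)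
          (lo := P - j) (hi := p + i - 2 * B - j) p (fun q hq => ?_) (fun q hq => ?_) le_rfl
          (by lia)) ?_).symm
        · rw [hGs]
          exact substAdd_eq_zero hB (by rw [e]; lia)
        · rw [LaurentSeries.hasseDeriv_coeff, hg _ (by lia), smul_zero]
        · refine Finset.sum_bij (fun c _ => c + j) ?_ ?_ ?_ ?_
          · intro c hc; simp at *; lia
          · intro c _ c' _ h; lia
          · intro c hc; exact ⟨c - j, by simp at *; lia, by lia⟩
          · intro c _
            rw [LaurentSeries.hasseDeriv_coeff, hGs, smul_assoc, smul_comm (g.coeff _),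
              show p - (c + j) + j = p - c by ring]
    rw [hlhs, hrhs, Finset.sum_comm]
    refine Finset.sum_congr rfl fun c _ => ?_
    rw [substAdd_shift hB, Finset.smul_sum]
  · rw [substAdd_neg _ (not_le.1 hi)]
    have := laurentMul_coeff_eq_zero (mulScalar (A := A)) G (atAdd g) (M := -k) (N := 0)
      (n := i - k) hG0 (fun j hj => taylor_coeff_of_neg _ _ hj) (by lia)
    have h3 : (mulScalar₂ G (atAdd g)).coeff (i - k : ℤ) = 0 := this
    rw [h3]; rfl

/-- The substitution leaves g(x₂) alone. The change from `atSnd` to `atFst` only reflects that x₂ is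
the outer variable of F and the inner variable of G. -/
theorem Expands.mul_atSnd {k : ℕ} {F G : LaurentSeries (LaurentSeries A)} (h : Expands k F G)
    (g : LaurentSeries ℂ) :
    Expands k (mulScalar₂ F (atSnd g)) (mulScalar₂ G (atFst g)) := by
  obtain ⟨P, hg⟩ := exists_coeff_eq_zero_of_lt g
  have h1 := h.1
  have h2 := h.2
  rw [← coeff₂_mul_atSub_var_pow] at h1 h2
  obtain ⟨B, hB⟩ := isJointLaurent_iff.1 h1
  unfold Expands
  rw [mulSubPow_mulScalar₂]
  set E := mulScalar₂ F (atSub var ^ k)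
  have hb : BoundedBelow B (B + P) (coeff₂ (mulScalar₂ E (atSnd g))) := by
    intro m n hmn
    rw [coeff₂_mul_atSnd hB hg m n le_rfl le_rfl]
    refine Finset.sum_eq_zero fun c hc => ?_
    rw [Finset.mem_Icc] at hc
    rw [hB _ _ (by lia), smul_zero]
  refine ⟨hb.isJointLaurent, ?_⟩
  have hGs : ∀ (j : ℤ) (p : ℤ), (G.coeff (j - k)).coeff p = substAdd (coeff₂ E) j p := fun j p => by
    rw [h2]
  funext i p
  rw [mulScalar₂_atFst]
  change _ = (mulScalar (G.coeff (i - k)) g).coeff p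
  rw [mulScalar_coeff_Icc (G.coeff (i - k)) g (M := 2 * B - i) (lo := P) (hi := p + i - 2 * B) p
    (fun q hq => by rw [hGs]; exact substAdd_eq_zero hB (by lia)) hg le_rfl (by lia)]
  by_cases hi : 0 ≤ i
  · lift i to ℕ using hi
    rw [substAdd_Icc hb i p (hi := p + i - B - P) le_rfl (by lia)]
    have e1 : ∀ c ∈ Finset.Icc P (p + i - 2 * B), g.coeff c • (G.coeff (i - k)).coeff (p - c) =
        ∑ m ∈ Finset.Icc B (p + i - B - P),
          g.coeff c • (Ring.choose m i • coeff₂ E m (p - m + i - c)) := by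
      intro c hc
      rw [Finset.mem_Icc] at hc
      rw [hGs, substAdd_Icc hB i (p - c) (hi := p + i - B - P) le_rfl (by lia), Finset.smul_sum]
      refine Finset.sum_congr rfl fun m _ => ?_
      rw [show p - c - m + i = p - m + i - c by ring]
    rw [Finset.sum_congr rfl e1, Finset.sum_comm]
    refine Finset.sum_congr rfl fun m hm => ?_
    rw [Finset.mem_Icc] at hm
    rw [coeff₂_mul_atSnd hB hg m _ (hi := p + i - 2 * B) le_rfl (by lia), Finset.smul_sum]
    exact Finset.sum_congr rfl fun c _ => smul_comm _ _ _
  · rw [substAdd_neg _ (not_le.1 hi)]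
    refine (Finset.sum_eq_zero fun c _ => ?_).symm
    rw [h.coeff_eq_zero (by lia)]
    simp

/-- The coefficients of `p(x₁ - x₂) F(x₁, x₂)` for a power series `p`. -/
theorem coeff₂_mul_atSub {B : ℤ} {F : LaurentSeries (LaurentSeries A)}
    (hF : BoundedBelow B B (coeff₂ F)) {f : LaurentSeries ℂ} (hf : ∀ i < 0, f.coeff i = 0) (m n : ℤ) :
    coeff₂ (mulScalar₂ F (atSub f)) m n =
      ∑ b ∈ Finset.range (n - B + 1).toNat, ∑ a ∈ Finset.range (m - B + 1).toNat,
        ((-1 : ℂ) ^ b * ((a + b).choose b * f.coeff (a + b : ℕ))) • coeff₂ F (m - a) (n - b) := by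
  change ((laurentMul mulScalar F (atSub f)).coeff n).coeff m = _
  rw [laurentMul_coeff_Icc mulScalar F (atSub f) n
    (fun i hi => coeff_eq_zero_of_boundedBelow hF hi) (fun j hj => taylor_coeff_of_neg _ _ hj)
    le_rfl le_rfl, HahnSeries.coeff_sum]
  refine (Finset.sum_bij (fun (b : ℕ) _ => (b : ℤ)) ?_ ?_ ?_ ?_).symm
  · intro j hj; simp at *; lia
  · intro j _ j' _ h; exact_mod_cast h
  · intro j hj
    simp only [Finset.mem_Icc] at hj
    exact ⟨j.toNat, by simp; lia, by lia⟩
  intro b _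
  rw [atSub, taylor_coeff_of_nonneg, map_smul, HahnSeries.coeff_smul]
  rw [mulScalar_coeff_Icc (F.coeff (n - b)) (LaurentSeries.hasseDeriv ℂ b f) (M := B) (N := 0)
    (lo := 0) (hi := m - B) m (fun i hi => hF i _ (Or.inl hi)) ?_ le_rfl le_rfl, Finset.smul_sum]
  · refine Finset.sum_bij (fun (a : ℕ) _ => (a : ℤ)) ?_ ?_ ?_ ?_
    · intro j hj; simp at *; lia
    · intro j _ j' _ h; exact_mod_cast h
    · intro j hj
      simp only [Finset.mem_Icc] at hj
      exact ⟨j.toNat, by simp; lia, by lia⟩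
    · intro a _
      rw [LaurentSeries.hasseDeriv_coeff, ← Nat.cast_add, Ring.choose_natCast, smul_smul]
      congr 2
      simp
  · intro i hi
    rw [LaurentSeries.hasseDeriv_coeff]
    by_cases h : i + b < 0
    · rw [hf _ h, smul_zero]
    · obtain ⟨c, hc⟩ := Int.eq_ofNat_of_zero_le (not_lt.1 h)
      rw [hc, Ring.choose_natCast, Nat.choose_eq_zero_of_lt (by lia)]
      simp

theorem boundedBelow_mul_atSub {B : ℤ} {F : LaurentSeries (LaurentSeries A)}
    (hF : BoundedBelow B B (coeff₂ F)) {f : LaurentSeries ℂ} (hf : ∀ i < 0, f.coeff i = 0) :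
    BoundedBelow B B (coeff₂ (mulScalar₂ F (atSub f))) := by
  intro m n hmn
  rw [coeff₂_mul_atSub hF hf]
  rcases hmn with h | h
  · refine Finset.sum_eq_zero fun b _ => ?_
    rw [show (m - B + 1).toNat = 0 by lia]; rfl
  · rw [show (n - B + 1).toNat = 0 by lia]; rfl

/-- A power series is its constant term plus a multiple of `x`. -/
theorem exists_eq_const_add {f : LaurentSeries ℂ} (hf : ∀ i < 0, f.coeff i = 0) :
    ∃ g : LaurentSeries ℂ, (∀ i < 0, g.coeff i = 0) ∧ (∀ i : ℕ, g.coeff i = f.coeff (i + 1)) ∧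
      f = f.coeff 0 • 1 + g * var := by
  let g : LaurentSeries ℂ := HahnSeries.ofSuppBddBelow
    (fun i => if 0 ≤ i then f.coeff (i + 1) else 0)
    ⟨0, fun i hi => by
      by_contra h
      exact hi (if_neg h)⟩
  have hg : ∀ i, g.coeff i = if 0 ≤ i then f.coeff (i + 1) else 0 := fun i => rfl
  refine ⟨g, fun i hi => by rw [hg, if_neg (not_le.2 hi)], fun i => by rw [hg, if_pos (by lia)], ?_⟩
  ext n
  have := mul_var_pow_coeff g 1 n
  rw [pow_one] at this
  rw [HahnSeries.coeff_add, HahnSeries.coeff_smul, this, one_coeff, hg]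
  by_cases h : n = 0
  · simp [h]
  · by_cases h' : 0 ≤ n - (1 : ℕ)
    · rw [if_pos h', if_neg h]
      simp
    · rw [if_neg h', if_neg h, hf n (by lia)]
      simp

/-- Induction on i through f = f(0) + x g: the constant factors out, and x gives the factor x₁ - x₂,
which becomes x₀ and lowers the order by one. The series f is quantified after i so that the
induction hypothesis applies to g. -/
theorem substAdd_mul_atSub {E : LaurentSeries (LaurentSeries A)} {B : ℤ}
    (hE : BoundedBelow B B (coeff₂ E)) (i : ℕ) (p : ℤ) : ∀ {f : LaurentSeries ℂ},
    (∀ i < 0, f.coeff i = 0) → substAdd (coeff₂ (mulScalar₂ E (atSub f))) i p =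
      ∑ c ∈ Finset.range (i + 1), f.coeff c • substAdd (coeff₂ E) ((i - c : ℕ) : ℤ) p := by
  induction i with
  | zero =>
    intro f hf
    obtain ⟨g, hg, -, e⟩ := exists_eq_const_add hf
    have hj := (boundedBelow_mul_atSub hE hg).isJointLaurent
    conv_lhs => rw [e, map_add, map_add, map_smul, map_smul, atSub, taylor_mul, taylor_one,
      mulScalar₂_one, ← mulScalar₂_mul, coeff₂_add, coeff₂_smul]
    rw [substAdd_add (hE.isJointLaurent.smul _) (by rw [← atSub, coeff₂_mul_atSub_var]; exact
      hj.mulSub),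
      substAdd_smul _ hE.isJointLaurent, ← atSub, coeff₂_mul_atSub_var]
    simp only [Pi.add_apply, Pi.smul_apply]
    rw [substAdd_mulSub hj, substAdd_neg _ (i := ((0 : ℕ) : ℤ) - 1) (by simp)]
    simp
  | succ i ih =>
    intro f hf
    obtain ⟨g, hg, hgf, e⟩ := exists_eq_const_add hf
    have hj := (boundedBelow_mul_atSub hE hg).isJointLaurent
    conv_lhs => rw [e, map_add, map_add, map_smul, map_smul, atSub, taylor_mul, taylor_one,
      mulScalar₂_one, ← mulScalar₂_mul, coeff₂_add, coeff₂_smul]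
    rw [substAdd_add (hE.isJointLaurent.smul _) (by rw [← atSub, coeff₂_mul_atSub_var]; exact
      hj.mulSub),
      substAdd_smul _ hE.isJointLaurent, ← atSub, coeff₂_mul_atSub_var]
    simp only [Pi.add_apply, Pi.smul_apply]
    rw [substAdd_mulSub hj, show ((i + 1 : ℕ) : ℤ) - 1 = i by push_cast; ring, ih hg,
      Finset.sum_range_succ' _ (i + 1), add_comm]
    congr 1
    refine Finset.sum_congr rfl fun c _ => ?_
    rw [hgf, Nat.add_sub_add_right]
    push_cast; rfl

/-- A factor f(x₁ - x₂) becomes f(x₀). A pole of f of order at most N is cleared by N further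
factors x₁ - x₂. The increase N depends on f alone, which later keeps orders uniform in the vector
acted upon. -/
theorem Expands.mul_atSub {k : ℕ} {F G : LaurentSeries (LaurentSeries A)} (h : Expands k F G)
    {f : LaurentSeries ℂ} {N : ℕ} (hf : ∀ n < 0, (f * var ^ N).coeff n = 0) :
    Expands (k + N) (mulScalar₂ F (atSub f)) (mulScalar₂ G (atSnd f)) := by
  have h1 := h.1
  have h2 := h.2
  rw [← coeff₂_mul_atSub_var_pow] at h1 h2
  obtain ⟨B, hB⟩ := isJointLaurent_iff.1 h1
  unfold Expands
  have e : mulSubPow (k + N) (coeff₂ (mulScalar₂ F (atSub f))) =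
      coeff₂ (mulScalar₂ (mulScalar₂ F (atSub var ^ k)) (atSub (f * var ^ N))) := by
    have : atSub (f * var ^ N) = atSub f * atSub var ^ N := by
      rw [← atSub_pow]; exact taylor_mul _ _ _
    rw [← coeff₂_mul_atSub_var_pow, mulScalar₂_mul, mulScalar₂_mul, this, pow_add]
    congr 2
    ring
  rw [e]
  set E := mulScalar₂ F (atSub var ^ k)
  refine ⟨(boundedBelow_mul_atSub hB hf).isJointLaurent, ?_⟩
  have hGs : ∀ (j : ℤ) (p : ℤ), (G.coeff (j - k)).coeff p = substAdd (coeff₂ E) j p := fun j p => by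
    rw [h2]
  have hf' : ∀ n : ℤ, f.coeff (n - N) = (f * var ^ N).coeff n := fun n =>
    (mul_var_pow_coeff f N n).symm
  have hf0 : ∀ n < -(N : ℤ), f.coeff n = 0 := fun n hn => by
    have := hf' (n + N)
    rw [add_sub_cancel_right] at this
    rw [this, hf _ (by lia)]
  have hG0 : ∀ i < -(k : ℤ), G.coeff i = 0 := fun i hi => h.coeff_eq_zero hi
  funext i p
  rw [mulScalar₂_atSnd_coeff_Icc G f (lo := -N) (hi := i - N) (i - (k + N : ℕ)) hG0 hf0 le_rfl
    (by push_cast; lia), HahnSeries.coeff_sum]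
  by_cases hi : 0 ≤ i
  · lift i to ℕ using hi
    rw [substAdd_mul_atSub hB i p hf]
    refine Finset.sum_bij (fun (c : ℕ) _ => (c : ℤ) - N) ?_ ?_ ?_ ?_
    · intro j hj; simp at *; lia
    · intro j _ j' _ h; lia
    · intro j hj
      simp only [Finset.mem_Icc] at hj
      exact ⟨(j + N).toNat, by simp; lia, by lia⟩
    · intro c hc
      have hc' : c ≤ i := by simpa [Nat.lt_succ_iff] using hc
      rw [HahnSeries.coeff_smul, hf', ← hGs]
      congr 3
      push_cast [hc']; ring
  · rw [substAdd_neg _ (not_le.1 hi), Finset.Icc_eq_empty (by lia), Finset.sum_empty]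

end Expansion

/-! ### Equality of two expansions up to a power of x₁ - x₂ -/

section Locality

variable {A : Type*} [AddCommGroup A] [Module ℂ A]

/-- `(x₁ - x₂)^k F(x₁, x₂) = (x₁ - x₂)^k G(x₁, x₂)`, where `F` is an element of `A((x₁))((x₂))` and
`G` one of `A((x₂))((x₁))`. -/
def MutuallyLocal (k : ℕ) (F G : LaurentSeries (LaurentSeries A)) : Prop :=
  mulSubPow k (coeff₂ F) = mulSubPow k (coeff₂Swap G)

namespace MutuallyLocal

variable {k : ℕ} {F G F' G' : LaurentSeries (LaurentSeries A)}

theorem add (h : MutuallyLocal k F G) (h' : MutuallyLocal k F' G') :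
    MutuallyLocal k (F + F') (G + G') := by
  unfold MutuallyLocal at *
  rw [coeff₂_add, mulSubPow_add, h, h', ← mulSubPow_add]
  rfl

theorem zero (k : ℕ) : MutuallyLocal k (0 : LaurentSeries (LaurentSeries A)) 0 := by
  unfold MutuallyLocal
  congr 1

theorem mono (h : MutuallyLocal k F G) {l : ℕ} (hl : k ≤ l) : MutuallyLocal l F G := by
  unfold MutuallyLocal at *
  rw [← Nat.sub_add_cancel hl, mulSubPow_add_exp, h, ← mulSubPow_add_exp]

theorem swap (h : MutuallyLocal k F G) : MutuallyLocal k G F := by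
  unfold MutuallyLocal at *
  have e : coeff₂ G = swapVars (coeff₂Swap G) := rfl
  rw [e, mulSubPow_swapVars, ← h, ← mulSubPow_swapVars]
  rfl

/-- Both sides multiplied by `(x₁ - x₂)^k` as elements of iterated Laurent series. -/
theorem iff_coeff : MutuallyLocal k F G ↔
    coeff₂ (mulScalar₂ F (atSub var ^ k)) =
      swapVars (coeff₂ (mulScalar₂ G ((-1 : ℂ) ^ k • atSub var ^ k))) := by
  unfold MutuallyLocal
  rw [← coeff₂_mul_atSub_var_pow, coeff₂Swap_eq, mulSubPow_swapVars, ← coeff₂_mul_atSub_var_pow,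
    map_smul, coeff₂_smul]
  rfl

/-- An element of A((x₁))((x₂)) bounds the powers of x₂ from below, one of A((x₂))((x₁)) those of
x₁; equal coefficients inherit both bounds. -/
theorem boundedBelow (h : coeff₂ F = swapVars (coeff₂ G)) : ∃ B, BoundedBelow B B (coeff₂ F) := by
  obtain ⟨M, hM⟩ := exists_coeff_eq_zero_of_lt F
  obtain ⟨N, hN⟩ := exists_coeff_eq_zero_of_lt G
  refine ⟨min M N, fun m n hmn => ?_⟩
  rcases hmn with h1 | h1
  · rw [h]
    change (G.coeff m).coeff n = 0
    rw [hN _ (by lia)]; rfl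
  · change (F.coeff n).coeff m = 0
    rw [hM _ (by lia)]; rfl

theorem mulScalar₂_smul_comm (G : LaurentSeries (LaurentSeries A)) (c : ℂ)
    (Q R : LaurentSeries (LaurentSeries ℂ)) :
    mulScalar₂ (mulScalar₂ G R) (c • Q) = mulScalar₂ (mulScalar₂ G (c • Q)) R := by
  rw [mulScalar₂_mul, mulScalar₂_mul, doubleLaurent_mul_comm]

theorem mul_atFst (h : MutuallyLocal k F G) (g : LaurentSeries ℂ) :
    MutuallyLocal k (mulScalar₂ F (atFst g)) (mulScalar₂ G (atSnd g)) := by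
  obtain ⟨P, hg⟩ := exists_coeff_eq_zero_of_lt g
  rw [iff_coeff] at *
  rw [mulScalar₂_mul, doubleLaurent_mul_comm, ← mulScalar₂_mul, mulScalar₂_smul_comm]
  obtain ⟨B, hB⟩ := boundedBelow h
  have hB' : BoundedBelow B B (coeff₂ (mulScalar₂ G ((-1 : ℂ) ^ k • atSub var ^ k))) := by
    intro m n hmn
    have := congrFun (congrFun h n) m
    exact this.symm.trans (hB n m (by lia))
  funext m n
  rw [coeff₂_mul_atFst hB hg m n le_rfl le_rfl]
  change _ = coeff₂ (mulScalar₂ (mulScalar₂ G ((-1 : ℂ) ^ k • atSub var ^ k)) (atSnd g)) n m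
  rw [coeff₂_mul_atSnd hB' hg n m le_rfl le_rfl]
  refine Finset.sum_congr rfl fun c _ => ?_
  rw [h]; rfl

theorem mul_atSnd (h : MutuallyLocal k F G) (g : LaurentSeries ℂ) :
    MutuallyLocal k (mulScalar₂ F (atSnd g)) (mulScalar₂ G (atFst g)) :=
  (h.swap.mul_atFst g).swap

/-- f(x₁ - x₂) and (negVar f)(x₂ - x₁) are the same function expanded in opposite directions; once
the pole is cleared the two expansions agree. -/
theorem mul_atSub (h : MutuallyLocal k F G) {f : LaurentSeries ℂ} {N : ℕ}
    (hf : ∀ n < 0, (f * var ^ N).coeff n = 0) :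
    MutuallyLocal (k + N) (mulScalar₂ F (atSub f)) (mulScalar₂ G (atSub (negVar f))) := by
  rw [iff_coeff] at *
  have e1 : mulScalar₂ (mulScalar₂ F (atSub f)) (atSub var ^ (k + N)) =
      mulScalar₂ (mulScalar₂ F (atSub var ^ k)) (atSub (f * var ^ N)) := by
    have : atSub (f * var ^ N) = atSub f * atSub var ^ N := by
      rw [← atSub_pow]; exact taylor_mul _ _ _
    rw [mulScalar₂_mul, mulScalar₂_mul, this, pow_add]
    congr 1
    ring
  have hvar : negVar (var ^ N) = (-1 : ℂ) ^ N • var ^ N := by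
    ext n
    rw [negVar_coeff, HahnSeries.coeff_smul, HahnSeries.single_pow]
    by_cases hn : n = N • 1
    · rw [hn]; simp
    · rw [HahnSeries.coeff_single_of_ne hn]; simp
  have e2 : mulScalar₂ (mulScalar₂ G (atSub (negVar f))) ((-1 : ℂ) ^ (k + N) • atSub var ^ (k + N))
    =
      mulScalar₂ (mulScalar₂ G ((-1 : ℂ) ^ k • atSub var ^ k)) (atSub (negVar (f * var ^ N))) := by
    have : atSub (negVar (f * var ^ N)) = (-1 : ℂ) ^ N • (atSub (negVar f) * atSub var ^ N) := by
      rw [negVar_mul, hvar, laurent_mul_smul, map_smul, ← atSub_pow]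
      congr 1; exact taylor_mul _ _ _
    rw [this, map_smul, map_smul, map_smul, map_smul, LinearMap.smul_apply, smul_smul,
      mulScalar₂_mul,
      mulScalar₂_mul, pow_add, pow_add, mul_comm ((-1 : ℂ) ^ k)]
    congr 2
    ring
  rw [e1, e2]
  obtain ⟨B, hB⟩ := boundedBelow h
  have hB' : BoundedBelow B B (coeff₂ (mulScalar₂ G ((-1 : ℂ) ^ k • atSub var ^ k))) := by
    intro m n hmn
    have := congrFun (congrFun h n) m
    exact this.symm.trans (hB n m (by lia))
  funext m n
  change _ = coeff₂ (mulScalar₂ (mulScalar₂ G ((-1 : ℂ) ^ k • atSub var ^ k))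
    (atSub (negVar (f * var ^ N)))) n m
  rw [coeff₂_mul_atSub hB hf, coeff₂_mul_atSub hB' (fun i hi => by rw
    [negVar_coeff, hf i hi, mul_zero]),
    Finset.sum_comm]
  refine Finset.sum_congr rfl fun a _ => Finset.sum_congr rfl fun b _ => ?_
  -- The binomial coefficient is symmetric in a and b, and (-1) ^ b equals (-1) ^ a times the sign
  -- (-1) ^ (a + b) coming from `negVar`.
  rw [h, negVar_coeff, add_comm b a, Nat.choose_symm_add]
  congr 1
  rw [zpow_natCast, pow_add]
  have h2 : ((-1 : ℂ) ^ a) * (-1) ^ a = 1 := by rw [← mul_pow]; simp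
  linear_combination (-((-1 : ℂ) ^ b * (((a + b).choose b : ℂ) * (f * var ^ N).coeff
    ((a + b : ℕ) : ℤ)))) * h2

end MutuallyLocal

end Locality


/-! ### Operators with coefficients and their commutation on tensor factors -/

section Operators

variable {M N X X' X'' H K : Type*} [AddCommGroup M] [Module ℂ M] [AddCommGroup N] [Module ℂ N]
  [AddCommGroup X] [Module ℂ X] [AddCommGroup X'] [Module ℂ X'] [AddCommGroup X''] [Module ℂ X'']
  [AddCommGroup H] [Module ℂ H] [AddCommGroup K] [Module ℂ K]

theorem exists_sum_tmul (t : M ⊗[ℂ] X) :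
    ∃ S : Finset (M × X), t = ∑ p ∈ S, p.1 ⊗ₜ[ℂ] p.2 := TensorProduct.exists_finset t

theorem rightComm_rTensor_rTensor (g : M →ₗ[ℂ] N) (t : (M ⊗[ℂ] X) ⊗[ℂ] X') :
    TensorProduct.rightComm ℂ N X X' (LinearMap.rTensor X' (LinearMap.rTensor X g) t) =
      LinearMap.rTensor X (LinearMap.rTensor X' g) (TensorProduct.rightComm ℂ M X X' t) := by
  have : (TensorProduct.rightComm ℂ N X X').toLinearMap ∘ₗ
      LinearMap.rTensor X' (LinearMap.rTensor X g) =
      LinearMap.rTensor X (LinearMap.rTensor X' g) ∘ₗ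
        (TensorProduct.rightComm ℂ M X X').toLinearMap := by
    ext a b c; simp
  exact LinearMap.congr_fun this t

theorem rightComm_rightComm (t : (M ⊗[ℂ] X) ⊗[ℂ] X') :
    TensorProduct.rightComm ℂ M X' X (TensorProduct.rightComm ℂ M X X' t) = t := by
  have : (TensorProduct.rightComm ℂ M X' X).toLinearMap ∘ₗ
      (TensorProduct.rightComm ℂ M X X').toLinearMap = LinearMap.id := by
    ext a b c; simp
  exact LinearMap.congr_fun this t

/-- Two linear maps `M → M ⊗ X`, `M → M ⊗ X'`, seen as operators on `M` with coefficients in `X` and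
`X'`, commute. -/
def CommOp (φ : M →ₗ[ℂ] M ⊗[ℂ] X) (ψ : M →ₗ[ℂ] M ⊗[ℂ] X') : Prop :=
  ∀ m, LinearMap.rTensor X' φ (ψ m) = TensorProduct.rightComm ℂ M X' X (LinearMap.rTensor X ψ (φ m))

theorem CommOp.symm {φ : M →ₗ[ℂ] M ⊗[ℂ] X} {ψ : M →ₗ[ℂ] M ⊗[ℂ] X'} (h : CommOp φ ψ) :
    CommOp ψ φ := fun m => by rw [h m, rightComm_rightComm]

theorem CommOp.lTensor_left {φ : M →ₗ[ℂ] M ⊗[ℂ] X} {ψ : M →ₗ[ℂ] M ⊗[ℂ] X'} (h : CommOp φ ψ)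
    (α : X →ₗ[ℂ] X'') : CommOp (LinearMap.lTensor M α ∘ₗ φ) ψ := by
  intro m
  have e1 : LinearMap.rTensor X' (LinearMap.lTensor M α ∘ₗ φ) (ψ m) =
      LinearMap.rTensor X' (LinearMap.lTensor M α) (LinearMap.rTensor X' φ (ψ m)) := by
    rw [LinearMap.rTensor_comp]; rfl
  have e2 : ∀ t : (M ⊗[ℂ] X') ⊗[ℂ] X,
      LinearMap.rTensor X' (LinearMap.lTensor M α) (TensorProduct.rightComm ℂ M X' X t) =
      TensorProduct.rightComm ℂ M X' X'' (LinearMap.lTensor (M ⊗[ℂ] X') α t) := by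
    intro t
    have : LinearMap.rTensor X' (LinearMap.lTensor M α) ∘ₗ
        (TensorProduct.rightComm ℂ M X' X).toLinearMap =
        (TensorProduct.rightComm ℂ M X' X'').toLinearMap ∘ₗ LinearMap.lTensor (M ⊗[ℂ] X') α := by
      ext a b c; simp
    exact LinearMap.congr_fun this t
  rw [e1, h m, e2]
  congr 1
  rw [LinearMap.comp_apply]
  exact LinearMap.congr_fun ((LinearMap.lTensor_comp_rTensor ..).trans
    (LinearMap.rTensor_comp_lTensor ..).symm) (φ m)

theorem CommOp.lTensor {φ : M →ₗ[ℂ] M ⊗[ℂ] X} {ψ : M →ₗ[ℂ] M ⊗[ℂ] X'} (h : CommOp φ ψ)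
    {Z Z' : Type*} [AddCommGroup Z] [Module ℂ Z] [AddCommGroup Z'] [Module ℂ Z']
    (α : X →ₗ[ℂ] Z) (β : X' →ₗ[ℂ] Z') :
    CommOp (LinearMap.lTensor M α ∘ₗ φ) (LinearMap.lTensor M β ∘ₗ ψ) :=
  ((h.lTensor_left α).symm.lTensor_left β).symm

/-- An operator on `M` acts on the first factor of `M ⊗ N`. -/
def opL (N : Type*) [AddCommGroup N] [Module ℂ N] :
    (M →ₗ[ℂ] M ⊗[ℂ] X) →ₗ[ℂ] M ⊗[ℂ] N →ₗ[ℂ] (M ⊗[ℂ] N) ⊗[ℂ] X where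
  toFun φ := (TensorProduct.rightComm ℂ M X N).toLinearMap ∘ₗ LinearMap.rTensor N φ
  map_add' φ ψ := by rw [LinearMap.rTensor_add, LinearMap.comp_add]
  map_smul' c φ := by rw [LinearMap.rTensor_smul, LinearMap.comp_smul]; rfl

/-- An operator on `N` acts on the second factor of `M ⊗ N`. -/
def opR (M : Type*) [AddCommGroup M] [Module ℂ M] :
    (N →ₗ[ℂ] N ⊗[ℂ] X) →ₗ[ℂ] M ⊗[ℂ] N →ₗ[ℂ] (M ⊗[ℂ] N) ⊗[ℂ] X where
  toFun φ := (TensorProduct.assoc ℂ M N X).symm.toLinearMap ∘ₗ LinearMap.lTensor M φ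
  map_add' φ ψ := by rw [LinearMap.lTensor_add, LinearMap.comp_add]
  map_smul' c φ := by rw [LinearMap.lTensor_smul, LinearMap.comp_smul]; rfl

theorem opL_tmul (φ : M →ₗ[ℂ] M ⊗[ℂ] X) (m : M) (n : N) :
    opL N φ (m ⊗ₜ n) = LinearMap.rTensor X ((TensorProduct.mk ℂ M N).flip n) (φ m) := by
  change TensorProduct.rightComm ℂ M X N (φ m ⊗ₜ n) = _
  induction φ m with
  | zero => simp
  | add x y hx hy => rw [TensorProduct.add_tmul, map_add, map_add, hx, hy]
  | tmul a x => simp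

theorem opR_tmul (φ : N →ₗ[ℂ] N ⊗[ℂ] X) (m : M) (n : N) :
    opR M φ (m ⊗ₜ n) = LinearMap.rTensor X (TensorProduct.mk ℂ M N m) (φ n) := by
  change (TensorProduct.assoc ℂ M N X).symm (m ⊗ₜ φ n) = _
  induction φ n with
  | zero => simp
  | add x y hx hy => rw [TensorProduct.tmul_add, map_add, map_add, hx, hy]
  | tmul a x => simp

theorem rTensor_comp_apply' {P Q R : Type*} [AddCommGroup P] [Module ℂ P] [AddCommGroup Q]
    [Module ℂ Q] [AddCommGroup R] [Module ℂ R] (g : Q →ₗ[ℂ] R) (f : P →ₗ[ℂ] Q) (t : P ⊗[ℂ] X) :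
    LinearMap.rTensor X g (LinearMap.rTensor X f t) = LinearMap.rTensor X (g ∘ₗ f) t := by
  rw [LinearMap.rTensor_comp]; rfl

theorem CommOp.opL {φ : M →ₗ[ℂ] M ⊗[ℂ] X} {ψ : M →ₗ[ℂ] M ⊗[ℂ] X'} (h : CommOp φ ψ) :
    CommOp (opL N φ) (opL N ψ) := by
  intro t
  induction t with
  | zero => simp
  | add x y hx hy => simp only [map_add, hx, hy]
  | tmul m n =>
    have e1 : VertexAlg.opL N φ ∘ₗ (TensorProduct.mk ℂ M N).flip n =
        LinearMap.rTensor X ((TensorProduct.mk ℂ M N).flip n) ∘ₗ φ := by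
      ext m; exact opL_tmul φ m n
    have e2 : VertexAlg.opL N ψ ∘ₗ (TensorProduct.mk ℂ M N).flip n =
        LinearMap.rTensor X' ((TensorProduct.mk ℂ M N).flip n) ∘ₗ ψ := by
      ext m; exact opL_tmul ψ m n
    rw [opL_tmul, opL_tmul, rTensor_comp_apply', rTensor_comp_apply', e1, e2, ← rTensor_comp_apply',
      ← rTensor_comp_apply', rightComm_rTensor_rTensor, h m]

theorem CommOp.opR {φ : N →ₗ[ℂ] N ⊗[ℂ] X} {ψ : N →ₗ[ℂ] N ⊗[ℂ] X'} (h : CommOp φ ψ) :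
    CommOp (opR M φ) (opR M ψ) := by
  intro t
  induction t with
  | zero => simp
  | add x y hx hy => simp only [map_add, hx, hy]
  | tmul m n =>
    have e1 : VertexAlg.opR M φ ∘ₗ (TensorProduct.mk ℂ M N) m =
        LinearMap.rTensor X ((TensorProduct.mk ℂ M N) m) ∘ₗ φ := by
      ext n; exact opR_tmul φ m n
    have e2 : VertexAlg.opR M ψ ∘ₗ (TensorProduct.mk ℂ M N) m =
        LinearMap.rTensor X' ((TensorProduct.mk ℂ M N) m) ∘ₗ ψ := by
      ext n; exact opR_tmul ψ m n
    rw [opR_tmul, opR_tmul, rTensor_comp_apply', rTensor_comp_apply', e1, e2, ← rTensor_comp_apply',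
      ← rTensor_comp_apply', rightComm_rTensor_rTensor, h n]

theorem commOp_opL_opR (φ : M →ₗ[ℂ] M ⊗[ℂ] X) (ψ : N →ₗ[ℂ] N ⊗[ℂ] X') :
    CommOp (opL N φ) (opR M ψ) := by
  intro t
  induction t with
  | zero => simp
  | add x y hx hy => simp only [map_add, hx, hy]
  | tmul m n =>
    obtain ⟨S, hS⟩ := exists_sum_tmul (φ m)
    obtain ⟨S', hS'⟩ := exists_sum_tmul (ψ n)
    rw [opL_tmul, opR_tmul, hS, hS']
    simp only [map_sum, LinearMap.rTensor_tmul, LinearMap.flip_apply, TensorProduct.mk_apply,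
      opL_tmul, opR_tmul, hS, hS', TensorProduct.sum_tmul, TensorProduct.rightComm_tmul]
    exact Finset.sum_comm

/-- The operator `m ↦ ∑ A(m₍₂₎) m₍₁₎`, where `r m = ∑ m₍₁₎ ⊗ m₍₂₎`. -/
def actThrough (A : H →ₗ[ℂ] M →ₗ[ℂ] M ⊗[ℂ] X) (r : M →ₗ[ℂ] M ⊗[ℂ] H) : M →ₗ[ℂ] M ⊗[ℂ] X :=
  TensorProduct.lift A.flip ∘ₗ r

/-- `ψ` is moved past the coaction by `hr` and then past each A(h) by `hA`. -/
theorem CommOp.actThrough {A : H →ₗ[ℂ] M →ₗ[ℂ] M ⊗[ℂ] X} {r : M →ₗ[ℂ] M ⊗[ℂ] H}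
    {ψ : M →ₗ[ℂ] M ⊗[ℂ] X'} (hA : ∀ h, CommOp (A h) ψ) (hr : CommOp r ψ) :
    CommOp (actThrough A r) ψ := by
  intro m
  have e : ∀ t : M ⊗[ℂ] H, LinearMap.rTensor X' (TensorProduct.lift A.flip)
      (TensorProduct.rightComm ℂ M X' H (LinearMap.rTensor H ψ t)) =
      TensorProduct.rightComm ℂ M X' X (LinearMap.rTensor X ψ (TensorProduct.lift A.flip t)) := by
    intro t
    induction t with
    | zero => simp
    | add x y hx hy => simp only [map_add, hx, hy]
    | tmul n h =>
      rw [TensorProduct.lift.tmul, LinearMap.flip_apply, ← hA h n, LinearMap.rTensor_tmul]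
      induction ψ n with
      | zero => simp
      | add x y hx hy => simp only [TensorProduct.add_tmul, map_add, hx, hy]
      | tmul a x => simp
  rw [VertexAlg.actThrough, ← rTensor_comp_apply', hr m, e]
  rfl

theorem CommOp.actThrough₂ {H' : Type*} [AddCommGroup H'] [Module ℂ H']
    {A : H →ₗ[ℂ] M →ₗ[ℂ] M ⊗[ℂ] X} {r : M →ₗ[ℂ] M ⊗[ℂ] H}
    {A' : H' →ₗ[ℂ] M →ₗ[ℂ] M ⊗[ℂ] X'} {r' : M →ₗ[ℂ] M ⊗[ℂ] H'}
    (hAA : ∀ h k, CommOp (A h) (A' k)) (hrA : ∀ k, CommOp r (A' k)) (hAr : ∀ h, CommOp (A h) r')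
    (hrr : CommOp r r') : CommOp (VertexAlg.actThrough A r) (VertexAlg.actThrough A' r') :=
  CommOp.actThrough
    (fun h => (CommOp.actThrough (fun k => (hAA h k).symm) (hAr h).symm).symm)
    (CommOp.actThrough (fun k => (hrA k).symm) hrr.symm).symm

end Operators

/-! ### Extension of scalars to a commutative ring of series -/

section Scalars

variable {M N P H K K' : Type*} [AddCommGroup M] [Module ℂ M] [AddCommGroup N] [Module ℂ N]
  [AddCommGroup P] [Module ℂ P] [AddCommGroup H] [Module ℂ H]
  [AddCommGroup K] [Module ℂ K] [AddCommGroup K'] [Module ℂ K']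

/-- The bilinear map `μ` is a commutative associative multiplication with unit `e`. -/
structure IsCommMul (μ : K →ₗ[ℂ] K →ₗ[ℂ] K) (e : K) : Prop where
  comm : ∀ f g, μ f g = μ g f
  assoc : ∀ f g h, μ (μ f g) h = μ f (μ g h)
  one_mul : ∀ f, μ e f = f

theorem IsCommMul.mul_one {μ : K →ₗ[ℂ] K →ₗ[ℂ] K} {e : K} (h : IsCommMul μ e) (f : K) :
    μ f e = f := by rw [h.comm, h.one_mul]

theorem isCommMul_mulSeries : IsCommMul mulSeries (1 : LaurentSeries ℂ) where
  comm f g := by rw [mulSeries_eq, mulSeries_eq, mul_comm]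
  assoc f g h := by simp only [mulSeries_eq, mul_assoc]
  one_mul f := by rw [mulSeries_eq, one_mul]

theorem isCommMul_mulSeries₂ : IsCommMul mulSeries₂ (1 : LaurentSeries (LaurentSeries ℂ)) where
  comm f g := by rw [mulSeries₂_eq, mulSeries₂_eq, doubleLaurent_mul_comm]
  assoc f g h := by
    simp only [mulSeries₂_eq]
    exact mul_assoc f g h
  one_mul f := by rw [mulSeries₂_eq]; exact one_mul f

theorem extendScalars_tmul (μ : K →ₗ[ℂ] K →ₗ[ℂ] K) (T : M →ₗ[ℂ] N ⊗[ℂ] K) (m : M) (f : K) :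
    extendScalars μ T (m ⊗ₜ f) = LinearMap.lTensor N (μ.flip f) (T m) := by
  change LinearMap.lTensor N (TensorProduct.lift μ) (TensorProduct.assoc ℂ N K K (T m ⊗ₜ f)) = _
  induction T m with
  | zero => simp
  | add x y hx hy => simp only [TensorProduct.add_tmul, map_add, hx, hy]
  | tmul a x => simp

theorem extendScalars_add (μ : K →ₗ[ℂ] K →ₗ[ℂ] K) (T T' : M →ₗ[ℂ] N ⊗[ℂ] K) :
    extendScalars μ (T + T') = extendScalars μ T + extendScalars μ T' := by
  simp [extendScalars, LinearMap.rTensor_add, LinearMap.comp_add]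

theorem extendScalars_smul (μ : K →ₗ[ℂ] K →ₗ[ℂ] K) (c : ℂ) (T : M →ₗ[ℂ] N ⊗[ℂ] K) :
    extendScalars μ (c • T) = c • extendScalars μ T := by
  simp [extendScalars, LinearMap.rTensor_smul, LinearMap.comp_smul]

section

variable {μ : K →ₗ[ℂ] K →ₗ[ℂ] K} {e : K} (hμ : IsCommMul μ e)
include hμ

theorem extendScalars_one (T : M →ₗ[ℂ] N ⊗[ℂ] K) (m : M) : extendScalars μ T (m ⊗ₜ e) = T m := by
  rw [extendScalars_tmul, show μ.flip e = LinearMap.id from LinearMap.ext fun f => hμ.mul_one f,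
    LinearMap.lTensor_id, LinearMap.id_apply]

theorem lTensor_mul_mul (f g : K) (t : N ⊗[ℂ] K) :
    LinearMap.lTensor N (μ.flip f) (LinearMap.lTensor N (μ.flip g) t) =
      LinearMap.lTensor N (μ.flip (μ g f)) t := by
  have : μ.flip f ∘ₗ μ.flip g = μ.flip (μ g f) := by
    ext h; simp [hμ.assoc]
  rw [← this, LinearMap.lTensor_comp]; rfl

theorem extendScalars_lTensor_mul (T : M →ₗ[ℂ] N ⊗[ℂ] K) (f : K) (t : M ⊗[ℂ] K) :
    extendScalars μ T (LinearMap.lTensor M (μ.flip f) t) =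
      LinearMap.lTensor N (μ.flip f) (extendScalars μ T t) := by
  induction t with
  | zero => simp
  | add x y hx hy => simp only [map_add, hx, hy]
  | tmul m g =>
    rw [LinearMap.lTensor_tmul, extendScalars_tmul, extendScalars_tmul, lTensor_mul_mul hμ]
    rfl

theorem extendScalars_comp (T : N →ₗ[ℂ] P ⊗[ℂ] K) (T' : M →ₗ[ℂ] N ⊗[ℂ] K) (t : M ⊗[ℂ] K) :
    extendScalars μ (extendScalars μ T ∘ₗ T') t = extendScalars μ T (extendScalars μ T' t) := by
  induction t with
  | zero => simp
  | add x y hx hy => simp only [map_add, hx, hy]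
  | tmul m g =>
    rw [extendScalars_tmul, extendScalars_tmul, extendScalars_lTensor_mul hμ]
    rfl

/-- `CommOp` keeps the two coefficients in separate copies of K. Multiplying them together forgets
their order, because `μ` is commutative. -/
theorem CommOp.extendScalars_apply {φ ψ : M →ₗ[ℂ] M ⊗[ℂ] K} (h : CommOp φ ψ) (m : M) :
    extendScalars μ φ (ψ m) = extendScalars μ ψ (φ m) := by
  have key : ∀ t : (M ⊗[ℂ] K) ⊗[ℂ] K,
      LinearMap.lTensor M (TensorProduct.lift μ) (TensorProduct.assoc ℂ M K K
        (TensorProduct.rightComm ℂ M K K t)) =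
      LinearMap.lTensor M (TensorProduct.lift μ) (TensorProduct.assoc ℂ M K K t) := by
    intro t
    have : LinearMap.lTensor M (TensorProduct.lift μ) ∘ₗ
        (TensorProduct.assoc ℂ M K K).toLinearMap ∘ₗ
        (TensorProduct.rightComm ℂ M K K).toLinearMap =
      LinearMap.lTensor M (TensorProduct.lift μ) ∘ₗ (TensorProduct.assoc ℂ M K K).toLinearMap := by
      ext a b c; simp [hμ.comm]
    exact LinearMap.congr_fun this t
  change LinearMap.lTensor M (TensorProduct.lift μ) (TensorProduct.assoc ℂ M K K
    (LinearMap.rTensor K φ (ψ m))) = LinearMap.lTensor M (TensorProduct.lift μ)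
    (TensorProduct.assoc ℂ M K K (LinearMap.rTensor K ψ (φ m)))
  rw [h m, key]

theorem CommOp.extendScalars {φ ψ : M →ₗ[ℂ] M ⊗[ℂ] K} (h : CommOp φ ψ) (t : M ⊗[ℂ] K) :
    extendScalars μ φ (extendScalars μ ψ t) = extendScalars μ ψ (extendScalars μ φ t) := by
  induction t with
  | zero => simp
  | add x y hx hy => simp only [map_add, hx, hy]
  | tmul m f =>
    rw [extendScalars_tmul, extendScalars_tmul, extendScalars_lTensor_mul hμ,
      extendScalars_lTensor_mul hμ, h.extendScalars_apply hμ]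

theorem extendScalars_opL_opL (φ ψ : M →ₗ[ℂ] M ⊗[ℂ] K) :
    VertexAlg.extendScalars μ (opL N φ) ∘ₗ opL N ψ =
      opL N (VertexAlg.extendScalars μ φ ∘ₗ ψ) := by
  ext m n
  change VertexAlg.extendScalars μ (opL N φ) (opL N ψ (m ⊗ₜ n)) = opL N _ (m ⊗ₜ n)
  rw [opL_tmul, opL_tmul, LinearMap.comp_apply]
  induction ψ m with
  | zero => simp
  | add x y hx hy => simp only [map_add, hx, hy]
  | tmul a f =>
    rw [LinearMap.rTensor_tmul, LinearMap.flip_apply, TensorProduct.mk_apply, extendScalars_tmul,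
      extendScalars_tmul, opL_tmul]
    exact LinearMap.congr_fun ((LinearMap.lTensor_comp_rTensor ..).trans
      (LinearMap.rTensor_comp_lTensor ..).symm) (φ a)

theorem extendScalars_opR_opR (φ ψ : N →ₗ[ℂ] N ⊗[ℂ] K) :
    VertexAlg.extendScalars μ (opR M φ) ∘ₗ opR M ψ =
      opR M (VertexAlg.extendScalars μ φ ∘ₗ ψ) := by
  ext m n
  change VertexAlg.extendScalars μ (opR M φ) (opR M ψ (m ⊗ₜ n)) = opR M _ (m ⊗ₜ n)
  rw [opR_tmul, opR_tmul, LinearMap.comp_apply]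
  induction ψ n with
  | zero => simp
  | add x y hx hy => simp only [map_add, hx, hy]
  | tmul a f =>
    rw [LinearMap.rTensor_tmul, TensorProduct.mk_apply, extendScalars_tmul,
      extendScalars_tmul, opR_tmul]
    exact LinearMap.congr_fun ((LinearMap.lTensor_comp_rTensor ..).trans
      (LinearMap.rTensor_comp_lTensor ..).symm) (φ a)

end

/-- Change of scalars along a multiplicative map. -/
theorem lTensor_extendScalars {μ : K →ₗ[ℂ] K →ₗ[ℂ] K} {μ' : K' →ₗ[ℂ] K' →ₗ[ℂ] K'}
    (α : K →ₗ[ℂ] K') (hα : ∀ f g, α (μ f g) = μ' (α f) (α g)) (T : M →ₗ[ℂ] N ⊗[ℂ] K)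
    (t : M ⊗[ℂ] K) : LinearMap.lTensor N α (extendScalars μ T t) =
      extendScalars μ' (LinearMap.lTensor N α ∘ₗ T) (LinearMap.lTensor M α t) := by
  induction t with
  | zero => simp
  | add x y hx hy => simp only [map_add, hx, hy]
  | tmul m f =>
    rw [LinearMap.lTensor_tmul, extendScalars_tmul, extendScalars_tmul, LinearMap.comp_apply]
    have : α ∘ₗ μ.flip f = μ'.flip (α f) ∘ₗ α := by
      ext g; simp [hα]
    rw [← LinearMap.comp_apply, ← LinearMap.lTensor_comp, this, LinearMap.lTensor_comp]
    rfl

theorem opL_lTensor (α : K →ₗ[ℂ] K') (φ : M →ₗ[ℂ] M ⊗[ℂ] K) :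
    opL N (LinearMap.lTensor M α ∘ₗ φ) = LinearMap.lTensor (M ⊗[ℂ] N) α ∘ₗ opL N φ := by
  ext m n
  change opL N _ (m ⊗ₜ n) = LinearMap.lTensor (M ⊗[ℂ] N) α (opL N φ (m ⊗ₜ n))
  rw [opL_tmul, opL_tmul, LinearMap.comp_apply]
  exact LinearMap.congr_fun ((LinearMap.rTensor_comp_lTensor ..).trans
      (LinearMap.lTensor_comp_rTensor ..).symm) (φ m)

theorem opR_lTensor (α : K →ₗ[ℂ] K') (φ : N →ₗ[ℂ] N ⊗[ℂ] K) :
    opR M (LinearMap.lTensor N α ∘ₗ φ) = LinearMap.lTensor (M ⊗[ℂ] N) α ∘ₗ opR M φ := by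
  ext m n
  change opR M _ (m ⊗ₜ n) = LinearMap.lTensor (M ⊗[ℂ] N) α (opR M φ (m ⊗ₜ n))
  rw [opR_tmul, opR_tmul, LinearMap.comp_apply]
  exact LinearMap.congr_fun ((LinearMap.rTensor_comp_lTensor ..).trans
      (LinearMap.lTensor_comp_rTensor ..).symm) (φ n)

end Scalars

/-! ### Coactions, and the composition of actions along one coaction -/

section Comodule

variable {M N H K : Type*} [AddCommGroup M] [Module ℂ M] [AddCommGroup N] [Module ℂ N]
  [AddCommGroup H] [Module ℂ H] [Coalgebra ℂ H] [AddCommGroup K] [Module ℂ K]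

/-- `r` is a right coaction of the coalgebra `H` on `M`. -/
structure IsCoaction (r : M →ₗ[ℂ] M ⊗[ℂ] H) : Prop where
  coassoc : ∀ m, LinearMap.rTensor H r (r m) =
    (TensorProduct.assoc ℂ M H H).symm (LinearMap.lTensor M Coalgebra.comul (r m))
  counit : ∀ m, TensorProduct.rid ℂ M (LinearMap.lTensor M (Coalgebra.counit (R := ℂ)) (r m)) = m

theorem IsCoaction.opL {r : M →ₗ[ℂ] M ⊗[ℂ] H} (h : IsCoaction r) : IsCoaction (opL N r) where
  coassoc t := by
    induction t with
    | zero => simp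
    | add x y hx hy => simp only [map_add, hx, hy]
    | tmul m n =>
      have e1 : VertexAlg.opL N r ∘ₗ (TensorProduct.mk ℂ M N).flip n =
          LinearMap.rTensor H ((TensorProduct.mk ℂ M N).flip n) ∘ₗ r := by
        ext m; exact opL_tmul r m n
      rw [opL_tmul, rTensor_comp_apply', e1, ← rTensor_comp_apply', h.coassoc]
      induction r m with
      | zero => simp
      | add x y hx hy => simp only [map_add, hx, hy]
      | tmul a k =>
        simp only [LinearMap.lTensor_tmul, LinearMap.rTensor_tmul, LinearMap.flip_apply,
          TensorProduct.mk_apply]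
        induction Coalgebra.comul (R := ℂ) k with
        | zero => simp
        | add x y hx hy => simp only [TensorProduct.tmul_add, map_add, hx, hy]
        | tmul x y => simp
  counit t := by
    induction t with
    | zero => simp
    | add x y hx hy => simp only [map_add, hx, hy]
    | tmul m n =>
      rw [opL_tmul]
      conv_rhs => rw [← h.counit m]
      induction r m with
      | zero => simp
      | add x y hx hy => simp only [map_add, hx, hy, TensorProduct.add_tmul]
      | tmul a k => simp [TensorProduct.smul_tmul']

theorem IsCoaction.opR {r : N →ₗ[ℂ] N ⊗[ℂ] H} (h : IsCoaction r) : IsCoaction (opR M r) where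
  coassoc t := by
    induction t with
    | zero => simp
    | add x y hx hy => simp only [map_add, hx, hy]
    | tmul m n =>
      have e1 : VertexAlg.opR M r ∘ₗ (TensorProduct.mk ℂ M N) m =
          LinearMap.rTensor H ((TensorProduct.mk ℂ M N) m) ∘ₗ r := by
        ext n; exact opR_tmul r m n
      rw [opR_tmul, rTensor_comp_apply', e1, ← rTensor_comp_apply', h.coassoc]
      induction r n with
      | zero => simp
      | add x y hx hy => simp only [map_add, hx, hy]
      | tmul a k =>
        simp only [LinearMap.lTensor_tmul, LinearMap.rTensor_tmul,
          TensorProduct.mk_apply]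
        induction Coalgebra.comul (R := ℂ) k with
        | zero => simp
        | add x y hx hy => simp only [TensorProduct.tmul_add, map_add, hx, hy]
        | tmul x y => simp
  counit t := by
    induction t with
    | zero => simp
    | add x y hx hy => simp only [map_add, hx, hy]
    | tmul m n =>
      rw [opR_tmul]
      conv_rhs => rw [← h.counit n]
      induction r n with
      | zero => simp
      | add x y hx hy => simp only [map_add, hx, hy, TensorProduct.tmul_add]
      | tmul a k => simp [TensorProduct.smul_tmul']

variable {μ : K →ₗ[ℂ] K →ₗ[ℂ] K} {e : K}

/-- The bilinear map `(h, k) ↦ A(h) A'(k)` with values in operators with coefficients in `K`. -/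
def opMul (μ : K →ₗ[ℂ] K →ₗ[ℂ] K) (A A' : H →ₗ[ℂ] M →ₗ[ℂ] M ⊗[ℂ] K) :
    H →ₗ[ℂ] H →ₗ[ℂ] M →ₗ[ℂ] M ⊗[ℂ] K :=
  LinearMap.mk₂ ℂ (fun h k => extendScalars μ (A h) ∘ₗ A' k)
    (fun h h' k => by rw [map_add, extendScalars_add, LinearMap.add_comp])
    (fun c h k => by rw [map_smul, extendScalars_smul, LinearMap.smul_comp])
    (fun h k k' => by rw [map_add, LinearMap.comp_add])
    (fun c h k => by rw [map_smul, LinearMap.comp_smul])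

/-- The composite of two operators `actThrough` along the same coaction. -/
theorem extendScalars_actThrough_comp {A A' : H →ₗ[ℂ] M →ₗ[ℂ] M ⊗[ℂ] K}
    {r : M →ₗ[ℂ] M ⊗[ℂ] H} (hr : IsCoaction r) (hrA : ∀ k, CommOp r (A' k)) (m : M) :
    extendScalars μ (actThrough A r) (actThrough A' r m) =
      actThrough (TensorProduct.lift (opMul μ A A') ∘ₗ Coalgebra.comul) r m := by
  have e1 : ∀ t : M ⊗[ℂ] K, extendScalars μ (actThrough A r) t =
      LinearMap.lTensor M (TensorProduct.lift μ) (TensorProduct.assoc ℂ M K K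
        (LinearMap.rTensor K (TensorProduct.lift A.flip) (LinearMap.rTensor K r t))) := by
    intro t
    rw [rTensor_comp_apply']; rfl
  -- Moving `r` past A'(h) by `hrA` produces an iterated coaction whose first `H`-component is fed
  -- to `A` and whose second to `A'`. Coassociativity then makes this pair a coproduct.
  have e2 : ∀ t : M ⊗[ℂ] H, extendScalars μ (actThrough A r) (TensorProduct.lift A'.flip t) =
      TensorProduct.lift (TensorProduct.lift (opMul μ A A')).flip
        (TensorProduct.assoc ℂ M H H (LinearMap.rTensor H r t)) := by
    intro t
    induction t with
    | zero => simp
    | add x y hx hy => simp only [map_add, hx, hy]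
    | tmul n h =>
      rw [TensorProduct.lift.tmul, LinearMap.flip_apply, e1, hrA h n, LinearMap.rTensor_tmul]
      induction r n with
      | zero => simp
      | add x y hx hy => simp only [map_add, hx, hy, TensorProduct.add_tmul]
      | tmul n' k =>
        rw [LinearMap.rTensor_tmul, TensorProduct.assoc_tmul, TensorProduct.lift.tmul,
          LinearMap.flip_apply, TensorProduct.lift.tmul]
        change _ = extendScalars μ (A k) (A' h n')
        induction A' h n' with
        | zero => simp
        | add x y hx hy => simp only [map_add, hx, hy, TensorProduct.add_tmul]
        | tmul a f => rfl
  have e3 : actThrough A' r m = TensorProduct.lift A'.flip (r m) := rfl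
  rw [e3, e2, hr.coassoc, LinearEquiv.apply_symm_apply]
  change _ = TensorProduct.lift (TensorProduct.lift (opMul μ A A') ∘ₗ Coalgebra.comul).flip (r m)
  induction r m with
  | zero => simp
  | add x y hx hy => simp only [map_add, hx, hy]
  | tmul n h => rfl

theorem actThrough_counit {A : H →ₗ[ℂ] M →ₗ[ℂ] M ⊗[ℂ] K}
    (hA : ∀ h m, A h m = Coalgebra.counit (R := ℂ) h • m ⊗ₜ[ℂ] e)
    {r : M →ₗ[ℂ] M ⊗[ℂ] H} (hr : IsCoaction r) (m : M) : actThrough A r m = m ⊗ₜ e := by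
  conv_rhs => rw [← hr.counit m]
  change TensorProduct.lift A.flip (r m) = _
  induction r m with
  | zero => simp
  | add x y hx hy => simp only [map_add, hx, hy, TensorProduct.add_tmul]
  | tmul n h => simp [hA, TensorProduct.smul_tmul']

end Comodule


/-! ### Transport of operators along isomorphisms -/

section Conjugation

variable {M N P X H K : Type*} [AddCommGroup M] [Module ℂ M] [AddCommGroup N] [Module ℂ N]
  [AddCommGroup P] [Module ℂ P]
  [AddCommGroup X] [Module ℂ X] [AddCommGroup H] [Module ℂ H] [AddCommGroup K] [Module ℂ K]

/-- Transport of an operator along an isomorphism. -/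
def conjOp (e : M ≃ₗ[ℂ] N) : (M →ₗ[ℂ] M ⊗[ℂ] X) →ₗ[ℂ] N →ₗ[ℂ] N ⊗[ℂ] X where
  toFun φ := LinearMap.rTensor X e.toLinearMap ∘ₗ φ ∘ₗ e.symm.toLinearMap
  map_add' φ ψ := by rw [LinearMap.add_comp, LinearMap.comp_add]
  map_smul' c φ := by rw [LinearMap.smul_comp, LinearMap.comp_smul]; rfl

theorem conjOp_apply (e : M ≃ₗ[ℂ] N) (φ : M →ₗ[ℂ] M ⊗[ℂ] X) (n : N) :
    conjOp e φ n = LinearMap.rTensor X e.toLinearMap (φ (e.symm n)) := rfl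

theorem conjOp_actThrough (e : M ≃ₗ[ℂ] N) (A : H →ₗ[ℂ] M →ₗ[ℂ] M ⊗[ℂ] X) (r : M →ₗ[ℂ] M ⊗[ℂ] H) :
    conjOp e (actThrough A r) = actThrough (conjOp e ∘ₗ A) (conjOp e r) := by
  ext n
  rw [conjOp_apply]
  change LinearMap.rTensor X e.toLinearMap (TensorProduct.lift A.flip (r (e.symm n))) =
    TensorProduct.lift (conjOp e ∘ₗ A).flip (LinearMap.rTensor H e.toLinearMap (r (e.symm n)))
  induction r (e.symm n) with
  | zero => simp
  | add x y hx hy => simp only [map_add, hx, hy]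
  | tmul m h => simp [conjOp_apply]

theorem extendScalars_comp_rTensor (μ : K →ₗ[ℂ] K →ₗ[ℂ] K) (T : N →ₗ[ℂ] P ⊗[ℂ] K) (g : M →ₗ[ℂ] N)
    (t : M ⊗[ℂ] K) : extendScalars μ (T ∘ₗ g) t = extendScalars μ T (LinearMap.rTensor K g t) := by
  induction t with
  | zero => simp
  | add x y hx hy => simp only [map_add, hx, hy]
  | tmul m f => rw [LinearMap.rTensor_tmul, extendScalars_tmul, extendScalars_tmul]; rfl

theorem rTensor_extendScalars (μ : K →ₗ[ℂ] K →ₗ[ℂ] K) (T : M →ₗ[ℂ] N ⊗[ℂ] K) (g : N →ₗ[ℂ] P)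
    (t : M ⊗[ℂ] K) : LinearMap.rTensor K g (extendScalars μ T t) =
      extendScalars μ (LinearMap.rTensor K g ∘ₗ T) t := by
  induction t with
  | zero => simp
  | add x y hx hy => simp only [map_add, hx, hy]
  | tmul m f =>
    rw [extendScalars_tmul, extendScalars_tmul]
    exact LinearMap.congr_fun ((LinearMap.rTensor_comp_lTensor ..).trans
      (LinearMap.lTensor_comp_rTensor ..).symm) (T m)

theorem conjOp_extendScalars (μ : K →ₗ[ℂ] K →ₗ[ℂ] K) (e : M ≃ₗ[ℂ] N) (φ ψ : M →ₗ[ℂ] M ⊗[ℂ] K) :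
    conjOp e (extendScalars μ φ ∘ₗ ψ) = extendScalars μ (conjOp e φ) ∘ₗ conjOp e ψ := by
  ext n
  rw [conjOp_apply, LinearMap.comp_apply, LinearMap.comp_apply, rTensor_extendScalars, conjOp_apply,
    ← extendScalars_comp_rTensor]
  have h : LinearMap.rTensor K e.toLinearMap ∘ₗ φ = conjOp e φ ∘ₗ e.toLinearMap := by
    ext m
    simp [conjOp_apply]
  rw [h]

theorem opL_actThrough (A : H →ₗ[ℂ] M →ₗ[ℂ] M ⊗[ℂ] X) (r : M →ₗ[ℂ] M ⊗[ℂ] H) :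
    opL N (actThrough A r) = actThrough (opL N ∘ₗ A) (opL N r) := by
  ext m n
  change opL N (actThrough A r) (m ⊗ₜ n) = TensorProduct.lift (opL N ∘ₗ A).flip (opL N r (m ⊗ₜ n))
  rw [opL_tmul, opL_tmul]
  change LinearMap.rTensor X _ (TensorProduct.lift A.flip (r m)) = _
  induction r m with
  | zero => simp
  | add x y hx hy => simp only [map_add, hx, hy]
  | tmul m h => simp [opL_tmul]

theorem opR_actThrough (A : H →ₗ[ℂ] N →ₗ[ℂ] N ⊗[ℂ] X) (r : N →ₗ[ℂ] N ⊗[ℂ] H) :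
    opR M (actThrough A r) = actThrough (opR M ∘ₗ A) (opR M r) := by
  ext m n
  change opR M (actThrough A r) (m ⊗ₜ n) = TensorProduct.lift (opR M ∘ₗ A).flip (opR M r (m ⊗ₜ n))
  rw [opR_tmul, opR_tmul]
  change LinearMap.rTensor X _ (TensorProduct.lift A.flip (r n)) = _
  induction r n with
  | zero => simp
  | add x y hx hy => simp only [map_add, hx, hy]
  | tmul m h => simp [opR_tmul]

end Conjugation

/-! ### Leg operators on two and three tensor factors -/

section Legs

variable {V X X' H K : Type*} [AddCommGroup V] [Module ℂ V]
  [AddCommGroup X] [Module ℂ X] [AddCommGroup X'] [Module ℂ X'] [AddCommGroup H] [Module ℂ H]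
  [AddCommGroup K] [Module ℂ K]

/-- An operator on `V` acting on one of the factors of `V ⊗ V`. -/
def opAt₂ : Fin 2 → (V →ₗ[ℂ] V ⊗[ℂ] X) →ₗ[ℂ] V ⊗[ℂ] V →ₗ[ℂ] (V ⊗[ℂ] V) ⊗[ℂ] X
  | 0 => opL V
  | 1 => opR V

/-- An operator on `V` acting on one of the factors of `V ⊗ V ⊗ V`. -/
def opAt : Fin 3 → (V →ₗ[ℂ] V ⊗[ℂ] X) →ₗ[ℂ]
    (V ⊗[ℂ] V) ⊗[ℂ] V →ₗ[ℂ] ((V ⊗[ℂ] V) ⊗[ℂ] V) ⊗[ℂ] X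
  | 0 => opL V ∘ₗ opL V
  | 1 => opL V ∘ₗ opR V
  | 2 => opR (V ⊗[ℂ] V)

theorem CommOp.opAt₂ {φ : V →ₗ[ℂ] V ⊗[ℂ] X} {ψ : V →ₗ[ℂ] V ⊗[ℂ] X'} (h : CommOp φ ψ) (i j : Fin 2) :
    CommOp (opAt₂ i φ) (opAt₂ j ψ) :=
  match i, j with
  | 0, 0 => h.opL
  | 0, 1 => commOp_opL_opR _ _
  | 1, 0 => (commOp_opL_opR _ _).symm
  | 1, 1 => h.opR

theorem CommOp.opAt {φ : V →ₗ[ℂ] V ⊗[ℂ] X} {ψ : V →ₗ[ℂ] V ⊗[ℂ] X'} (h : CommOp φ ψ) (i j : Fin 3) :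
    CommOp (opAt i φ) (opAt j ψ) :=
  match i, j with
  | 0, 0 => (h.opAt₂ 0 0).opL
  | 0, 1 => (h.opAt₂ 0 1).opL
  | 1, 0 => (h.opAt₂ 1 0).opL
  | 1, 1 => (h.opAt₂ 1 1).opL
  | 0, 2 => commOp_opL_opR _ _
  | 1, 2 => commOp_opL_opR _ _
  | 2, 0 => (commOp_opL_opR _ _).symm
  | 2, 1 => (commOp_opL_opR _ _).symm
  | 2, 2 => h.opR

variable (ρ : V →ₗ[ℂ] V ⊗[ℂ] H) (Z Z' : H →ₗ[ℂ] V →ₗ[ℂ] V ⊗[ℂ] X)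

/-- The operators `Z(h)` with their coefficients mapped by `α`. -/
def mapCoeff (α : X →ₗ[ℂ] K) : H →ₗ[ℂ] V →ₗ[ℂ] V ⊗[ℂ] K :=
  LinearMap.compRight ℂ (LinearMap.lTensor V α) ∘ₗ Z

theorem mapCoeff_apply (α : X →ₗ[ℂ] K) (h : H) :
    mapCoeff Z α h = LinearMap.lTensor V α ∘ₗ Z h := rfl

/-- On `V ⊗ V`: the coaction on the factor `j`, followed by the action through `Z` on the
factor `i`. -/
def legOp₂ (α : X →ₗ[ℂ] K) (i j : Fin 2) : V ⊗[ℂ] V →ₗ[ℂ] (V ⊗[ℂ] V) ⊗[ℂ] K :=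
  actThrough (opAt₂ i ∘ₗ mapCoeff Z α) (opAt₂ j ρ)

/-- On `V ⊗ V ⊗ V`: the coaction on the factor `j`, followed by the action through `Z` on the
factor `i`. -/
def legOp (α : X →ₗ[ℂ] K) (i j : Fin 3) : (V ⊗[ℂ] V) ⊗[ℂ] V →ₗ[ℂ] ((V ⊗[ℂ] V) ⊗[ℂ] V) ⊗[ℂ] K :=
  actThrough (opAt i ∘ₗ mapCoeff Z α) (opAt j ρ)

variable {ρ Z Z'}

/-- Coactions and actions commute pairwise on `V` itself, and operators on different factors always
commute. Hence no condition on i, j, k, l is needed, even when factors coincide. -/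
theorem commOp_legOp {K' : Type*} [AddCommGroup K'] [Module ℂ K'] (hρ : CommOp ρ ρ)
    (hZ : ∀ h, CommOp ρ (Z h)) (hZ' : ∀ h, CommOp ρ (Z' h)) (hZZ : ∀ h k, CommOp (Z h) (Z' k))
    (α : X →ₗ[ℂ] K) (β : X →ₗ[ℂ] K') (i j k l : Fin 3) :
    CommOp (legOp ρ Z α i j) (legOp ρ Z' β k l) :=
  CommOp.actThrough₂ (fun h h' => ((hZZ h h').lTensor α β).opAt i k)
    (fun h => ((hZ' h).symm.lTensor_left β).symm.opAt j k)
    (fun h => ((hZ h).symm.lTensor_left α).opAt i l) (hρ.opAt j l)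

theorem opL_legOp₂ (α : X →ₗ[ℂ] K) : opL V (legOp₂ ρ Z α 0 1) = legOp ρ Z α 0 1 :=
  opL_actThrough _ _

theorem opL_legOp₂' (α : X →ₗ[ℂ] K) : opL V (legOp₂ ρ Z α 1 0) = legOp ρ Z α 1 0 :=
  opL_actThrough _ _

theorem conjOp_comm_opL (φ : V →ₗ[ℂ] V ⊗[ℂ] X) :
    conjOp (TensorProduct.comm ℂ V V) (opL V φ) = opR V φ := by
  ext a b
  simp only [TensorProduct.AlgebraTensorModule.curry_apply, LinearMap.restrictScalars_self,
    TensorProduct.curry_apply]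
  rw [conjOp_apply, TensorProduct.comm_symm_tmul, opL_tmul, opR_tmul, rTensor_comp_apply']
  rfl

theorem conjOp_comm_opR (φ : V →ₗ[ℂ] V ⊗[ℂ] X) :
    conjOp (TensorProduct.comm ℂ V V) (opR V φ) = opL V φ := by
  ext a b
  simp only [TensorProduct.AlgebraTensorModule.curry_apply, LinearMap.restrictScalars_self,
    TensorProduct.curry_apply]
  rw [conjOp_apply, TensorProduct.comm_symm_tmul, opL_tmul, opR_tmul, rTensor_comp_apply']
  rfl

theorem conjOp_rightComm_opL_opL (φ : V →ₗ[ℂ] V ⊗[ℂ] X) :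
    conjOp (TensorProduct.rightComm ℂ V V V) (opL V (opL V φ)) = opL V (opL V φ) := by
  ext a b c
  simp only [TensorProduct.AlgebraTensorModule.curry_apply, LinearMap.restrictScalars_self,
    TensorProduct.curry_apply]
  rw [conjOp_apply, show (TensorProduct.rightComm ℂ V V V).symm ((a ⊗ₜ b) ⊗ₜ c) =
    (a ⊗ₜ c) ⊗ₜ b from rfl, opL_tmul, opL_tmul, opL_tmul, opL_tmul,
    rTensor_comp_apply', rTensor_comp_apply', rTensor_comp_apply']
  rfl

theorem conjOp_rightComm_opL_opR (φ : V →ₗ[ℂ] V ⊗[ℂ] X) :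
    conjOp (TensorProduct.rightComm ℂ V V V) (opL V (opR V φ)) = opR (V ⊗[ℂ] V) φ := by
  ext a b c
  simp only [TensorProduct.AlgebraTensorModule.curry_apply, LinearMap.restrictScalars_self,
    TensorProduct.curry_apply]
  rw [conjOp_apply, show (TensorProduct.rightComm ℂ V V V).symm ((a ⊗ₜ b) ⊗ₜ c) =
    (a ⊗ₜ c) ⊗ₜ b from rfl, opL_tmul, opR_tmul, opR_tmul,
    rTensor_comp_apply', rTensor_comp_apply']
  rfl

theorem conjOp_assoc_opR_opL (φ : V →ₗ[ℂ] V ⊗[ℂ] X) :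
    conjOp (TensorProduct.assoc ℂ V V V).symm (opR V (opL V φ)) = opL V (opR V φ) := by
  ext a b c
  simp only [TensorProduct.AlgebraTensorModule.curry_apply, LinearMap.restrictScalars_self,
    TensorProduct.curry_apply]
  rw [conjOp_apply, LinearEquiv.symm_symm, TensorProduct.assoc_tmul, opR_tmul, opL_tmul, opL_tmul,
    opR_tmul, rTensor_comp_apply', rTensor_comp_apply', rTensor_comp_apply']
  rfl

theorem conjOp_assoc_opR_opR (φ : V →ₗ[ℂ] V ⊗[ℂ] X) :
    conjOp (TensorProduct.assoc ℂ V V V).symm (opR V (opR V φ)) = opR (V ⊗[ℂ] V) φ := by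
  ext a b c
  simp only [TensorProduct.AlgebraTensorModule.curry_apply, LinearMap.restrictScalars_self,
    TensorProduct.curry_apply]
  rw [conjOp_apply, LinearEquiv.symm_symm, TensorProduct.assoc_tmul, opR_tmul, opR_tmul,
    opR_tmul, rTensor_comp_apply', rTensor_comp_apply']
  rfl

theorem actThrough_congr {M : Type*} [AddCommGroup M] [Module ℂ M]
    {A A' : H →ₗ[ℂ] M →ₗ[ℂ] M ⊗[ℂ] K} {r r' : M →ₗ[ℂ] M ⊗[ℂ] H} (hA : ∀ h, A h = A' h)
    (hr : r = r') : actThrough A r = actThrough A' r' := by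
  rw [LinearMap.ext hA, hr]

theorem conjOp_comm_legOp₂ (α : X →ₗ[ℂ] K) :
    conjOp (TensorProduct.comm ℂ V V) (legOp₂ ρ Z α 0 1) = legOp₂ ρ Z α 1 0 :=
  (conjOp_actThrough _ _ _).trans
    (actThrough_congr (fun _ => conjOp_comm_opL _) (conjOp_comm_opR _))

theorem conjOp_comm_legOp₂' (α : X →ₗ[ℂ] K) :
    conjOp (TensorProduct.comm ℂ V V) (legOp₂ ρ Z α 1 0) = legOp₂ ρ Z α 0 1 :=
  (conjOp_actThrough _ _ _).trans
    (actThrough_congr (fun _ => conjOp_comm_opR _) (conjOp_comm_opL _))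

theorem conjOp_rightComm_legOp (α : X →ₗ[ℂ] K) :
    conjOp (TensorProduct.rightComm ℂ V V V) (legOp ρ Z α 0 1) = legOp ρ Z α 0 2 :=
  (conjOp_actThrough _ _ _).trans
    (actThrough_congr (fun _ => conjOp_rightComm_opL_opL _) (conjOp_rightComm_opL_opR _))

theorem conjOp_rightComm_legOp' (α : X →ₗ[ℂ] K) :
    conjOp (TensorProduct.rightComm ℂ V V V) (legOp ρ Z α 1 0) = legOp ρ Z α 2 0 :=
  (conjOp_actThrough _ _ _).trans
    (actThrough_congr (fun _ => conjOp_rightComm_opL_opR _) (conjOp_rightComm_opL_opL _))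

theorem conjOp_assoc_legOp₂ (α : X →ₗ[ℂ] K) :
    conjOp (TensorProduct.assoc ℂ V V V).symm (opR V (legOp₂ ρ Z α 0 1)) = legOp ρ Z α 1 2 := by
  rw [legOp₂, opR_actThrough, conjOp_actThrough]
  exact actThrough_congr (fun _ => conjOp_assoc_opR_opL _) (conjOp_assoc_opR_opR _)

theorem conjOp_assoc_legOp₂' (α : X →ₗ[ℂ] K) :
    conjOp (TensorProduct.assoc ℂ V V V).symm (opR V (legOp₂ ρ Z α 1 0)) = legOp ρ Z α 2 1 := by
  rw [legOp₂, opR_actThrough, conjOp_actThrough]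
  exact actThrough_congr (fun _ => conjOp_assoc_opR_opR _) (conjOp_assoc_opR_opL _)

theorem lTensor_legOp₂ {K' : Type*} [AddCommGroup K'] [Module ℂ K'] (α : X →ₗ[ℂ] K)
    (β : K →ₗ[ℂ] K') (i j : Fin 2) :
    LinearMap.lTensor (V ⊗[ℂ] V) β ∘ₗ legOp₂ ρ Z α i j = legOp₂ ρ Z (β ∘ₗ α) i j := by
  have e : ∀ h, LinearMap.lTensor (V ⊗[ℂ] V) β ∘ₗ opAt₂ i (mapCoeff Z α h) =
      opAt₂ i (mapCoeff Z (β ∘ₗ α) h) := by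
    intro h
    rw [mapCoeff_apply, mapCoeff_apply, LinearMap.lTensor_comp, LinearMap.comp_assoc]
    match i with
    | 0 => exact (opL_lTensor _ _).symm
    | 1 => exact (opR_lTensor _ _).symm
  ext1
  refine LinearMap.ext fun a => LinearMap.ext fun b => ?_
  change LinearMap.lTensor (V ⊗[ℂ] V) β (TensorProduct.lift _ (opAt₂ j ρ (a ⊗ₜ b))) =
    TensorProduct.lift _ (opAt₂ j ρ (a ⊗ₜ b))
  induction opAt₂ j ρ (a ⊗ₜ b) with
  | zero => simp
  | add x y hx hy => simp only [map_add, hx, hy]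
  | tmul m h => exact LinearMap.congr_fun (e h) m

end Legs

/-! ### The braiding as a product of two legs: Yang-Baxter equation and unitarity -/

section Braiding

variable {V H K : Type*} [AddCommGroup V] [Module ℂ V] [AddCommGroup H] [Module ℂ H]
  [AddCommGroup K] [Module ℂ K]
  {ρ : V →ₗ[ℂ] V ⊗[ℂ] H} {Z Z' : H →ₗ[ℂ] V →ₗ[ℂ] V ⊗[ℂ] LaurentSeries ℂ}

/-- In the definition of the braiding both coactions are made first; on the right the coaction of u
is made after Z' has acted on u. The commutation `hZ'` says that this makes no difference. -/
theorem braiding_eq (hZ' : ∀ h, CommOp ρ (Z' h)) :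
    braiding ρ Z Z' = extendScalars mulSeries (legOp₂ ρ Z negVar 0 1) ∘ₗ
      legOp₂ ρ Z' LinearMap.id 1 0 := by
  ext1
  refine LinearMap.ext fun v => LinearMap.ext fun u => ?_
  obtain ⟨S, hS⟩ := exists_sum_tmul (ρ v)
  obtain ⟨S', hS'⟩ := exists_sum_tmul (ρ u)
  have e1 : braiding ρ Z Z' (v ⊗ₜ u) = ∑ p ∈ S, ∑ q ∈ S',
      tensorProductSeries (LinearMap.lTensor V negVar (Z q.2 p.1)) (Z' p.2 q.1) := by
    simp only [braiding, LinearMap.comp_apply, TensorProduct.map_tmul, hS, hS', map_sum,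
      LinearEquiv.coe_coe, TensorProduct.sum_tmul, TensorProduct.tmul_sum,
      TensorProduct.comm_tmul, TensorProduct.tensorTensorTensorComm_tmul,
      TensorProduct.congr_tmul, LinearEquiv.refl_apply, TensorProduct.lift.tmul,
      LinearMap.flip_apply]
    rw [Finset.sum_comm]
  have e2 : legOp₂ ρ Z' LinearMap.id 1 0 (v ⊗ₜ u) =
      ∑ p ∈ S, LinearMap.rTensor (LaurentSeries ℂ) (TensorProduct.mk ℂ V V p.1) (Z' p.2 u) := by
    change TensorProduct.lift _ (opL V ρ (v ⊗ₜ u)) = _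
    rw [opL_tmul, hS]
    simp only [map_sum, LinearMap.rTensor_tmul, TensorProduct.lift.tmul, LinearMap.flip_apply]
    refine Finset.sum_congr rfl fun p _ => ?_
    refine (opR_tmul _ _ _).trans ?_
    rw [mapCoeff_apply, LinearMap.lTensor_id]
    rfl
  change braiding ρ Z Z' (v ⊗ₜ u) = extendScalars mulSeries (legOp₂ ρ Z negVar 0 1)
    (legOp₂ ρ Z' LinearMap.id 1 0 (v ⊗ₜ u))
  rw [e1, e2, map_sum]
  refine Finset.sum_congr rfl fun p _ => ?_
  have e3 : (opAt₂ 1 ρ) ∘ₗ TensorProduct.mk ℂ V V p.1 =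
      LinearMap.rTensor H (TensorProduct.mk ℂ V V p.1) ∘ₗ ρ := by
    ext u; exact opR_tmul _ _ _
  rw [← extendScalars_comp_rTensor, legOp₂, actThrough, LinearMap.comp_assoc, e3,
    ← LinearMap.comp_assoc, extendScalars_comp_rTensor, hZ' p.2 u, hS']
  simp only [map_sum, LinearMap.rTensor_tmul]
  refine Finset.sum_congr rfl fun q _ => ?_
  induction Z' p.2 q.1 with
  | zero => simp
  | add x y hx hy => simp only [map_add, hx, hy, TensorProduct.add_tmul]
  | tmul b g =>
    rw [TensorProduct.rightComm_tmul, extendScalars_tmul, LinearMap.comp_apply,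
      LinearMap.rTensor_tmul, TensorProduct.lift.tmul]
    have e4 : ((opAt₂ 0 ∘ₗ mapCoeff Z negVar).flip (TensorProduct.mk ℂ V V p.1 b)) q.2 =
        LinearMap.rTensor (LaurentSeries ℂ) ((TensorProduct.mk ℂ V V).flip b)
          (LinearMap.lTensor V negVar (Z q.2 p.1)) := opL_tmul _ _ _
    rw [e4]
    induction Z q.2 p.1 with
    | zero => simp
    | add x y hx hy => simp only [map_add, LinearMap.add_apply, hx, hy]
    | tmul a f => simp [tensorProductSeries]

variable {μ : K →ₗ[ℂ] K →ₗ[ℂ] K} {e : K}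

theorem lTensor_braiding (hZ' : ∀ h, CommOp ρ (Z' h)) (φ : LaurentSeries ℂ →ₗ[ℂ] K)
    (hφ : ∀ f g, φ (mulSeries f g) = μ (φ f) (φ g)) :
    LinearMap.lTensor (V ⊗[ℂ] V) φ ∘ₗ braiding ρ Z Z' =
      extendScalars μ (legOp₂ ρ Z (φ ∘ₗ negVar) 0 1) ∘ₗ legOp₂ ρ Z' φ 1 0 := by
  rw [braiding_eq hZ']
  ext1
  refine LinearMap.ext fun v => LinearMap.ext fun u => ?_
  change LinearMap.lTensor _ φ (extendScalars mulSeries (legOp₂ ρ Z negVar 0 1)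
    (legOp₂ ρ Z' LinearMap.id 1 0 (v ⊗ₜ u))) = extendScalars μ (legOp₂ ρ Z (φ ∘ₗ negVar) 0 1)
      (legOp₂ ρ Z' φ 1 0 (v ⊗ₜ u))
  rw [lTensor_extendScalars φ hφ, lTensor_legOp₂, ← LinearMap.comp_apply (LinearMap.lTensor _ φ),
    lTensor_legOp₂]
  rfl

theorem S12_braiding (hμ : IsCommMul μ e) (hZ' : ∀ h, CommOp ρ (Z' h)) (φ : LaurentSeries ℂ →ₗ[ℂ] K)
    (hφ : ∀ f g, φ (mulSeries f g) = μ (φ f) (φ g)) :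
    S12 (braiding ρ Z Z') φ =
      extendScalars μ (legOp ρ Z (φ ∘ₗ negVar) 0 1) ∘ₗ legOp ρ Z' φ 1 0 := by
  change opL V (LinearMap.lTensor (V ⊗[ℂ] V) φ ∘ₗ braiding ρ Z Z') = _
  rw [lTensor_braiding hZ' φ hφ, ← extendScalars_opL_opL hμ, opL_legOp₂, opL_legOp₂']

/-- `S13` is the conjugate of `S12` by the exchange of the last two factors, which merely renumbers
the legs. -/
theorem S13_braiding (hμ : IsCommMul μ e) (hZ' : ∀ h, CommOp ρ (Z' h)) (φ : LaurentSeries ℂ →ₗ[ℂ] K)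
    (hφ : ∀ f g, φ (mulSeries f g) = μ (φ f) (φ g)) :
    S13 (braiding ρ Z Z') φ =
      extendScalars μ (legOp ρ Z (φ ∘ₗ negVar) 0 2) ∘ₗ legOp ρ Z' φ 2 0 := by
  have : S13 (braiding ρ Z Z') φ =
      conjOp (TensorProduct.rightComm ℂ V V V) (S12 (braiding ρ Z Z') φ) := rfl
  rw [this, S12_braiding hμ hZ' φ hφ, conjOp_extendScalars, conjOp_rightComm_legOp,
    conjOp_rightComm_legOp']

theorem S23_braiding (hμ : IsCommMul μ e) (hZ' : ∀ h, CommOp ρ (Z' h)) (φ : LaurentSeries ℂ →ₗ[ℂ] K)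
    (hφ : ∀ f g, φ (mulSeries f g) = μ (φ f) (φ g)) :
    S23 (braiding ρ Z Z') φ =
      extendScalars μ (legOp ρ Z (φ ∘ₗ negVar) 1 2) ∘ₗ legOp ρ Z' φ 2 1 := by
  have : S23 (braiding ρ Z Z') φ = conjOp (TensorProduct.assoc ℂ V V V).symm
      (opR V (LinearMap.lTensor (V ⊗[ℂ] V) φ ∘ₗ braiding ρ Z Z')) := rfl
  rw [this, lTensor_braiding hZ' φ hφ, ← extendScalars_opR_opR hμ, conjOp_extendScalars,
    conjOp_assoc_legOp₂, conjOp_assoc_legOp₂']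

theorem atFst_mulSeries (f g : LaurentSeries ℂ) :
    atFst (mulSeries f g) = mulSeries₂ (atFst f) (atFst g) := by
  rw [mulSeries_eq, mulSeries₂_eq, atFst_mul]

theorem atSnd_mulSeries (f g : LaurentSeries ℂ) :
    atSnd (mulSeries f g) = mulSeries₂ (atSnd f) (atSnd g) := by
  rw [mulSeries_eq, mulSeries₂_eq, atSnd_mul]

theorem atAdd_mulSeries (f g : LaurentSeries ℂ) :
    atAdd (mulSeries f g) = mulSeries₂ (atAdd f) (atAdd g) := by
  rw [mulSeries_eq, mulSeries₂_eq]; exact taylor_mul _ _ _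

theorem atSub_mulSeries (f g : LaurentSeries ℂ) :
    atSub (mulSeries f g) = mulSeries₂ (atSub f) (atSub g) := by
  rw [mulSeries_eq, mulSeries₂_eq]; exact taylor_mul _ _ _

theorem negVar_mulSeries (f g : LaurentSeries ℂ) :
    negVar (mulSeries f g) = mulSeries (negVar f) (negVar g) := by
  rw [mulSeries_eq, mulSeries_eq, negVar_mul]

theorem extendScalars_comp_reverse {M : Type*} [AddCommGroup M] [Module ℂ M]
    (hμ : IsCommMul μ e) {A B C : M →ₗ[ℂ] M ⊗[ℂ] K}
    (hAB : ∀ s, extendScalars μ A (extendScalars μ B s) = extendScalars μ B (extendScalars μ A s))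
    (hAC : ∀ s, extendScalars μ A (extendScalars μ C s) = extendScalars μ C (extendScalars μ A s))
    (hBC : ∀ s, extendScalars μ B (extendScalars μ C s) = extendScalars μ C (extendScalars μ B s)) :
    extendScalars μ A ∘ₗ extendScalars μ B ∘ₗ C = extendScalars μ C ∘ₗ extendScalars μ B ∘ₗ A := by
  ext1 t
  simp only [LinearMap.comp_apply]
  -- A unit coefficient is inserted so that the innermost maps also appear as scalar extensions, to
  -- which the commutation hypotheses apply.
  rw [← extendScalars_one hμ C, ← extendScalars_one hμ A, hBC, hAC, hAB]

/-- The pairwise commutation relations between a coaction and two families of operators. -/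
structure Compatible (ρ : V →ₗ[ℂ] V ⊗[ℂ] H) (Z Z' : H →ₗ[ℂ] V →ₗ[ℂ] V ⊗[ℂ] LaurentSeries ℂ) :
    Prop where
  coaction : CommOp ρ ρ
  left : ∀ h, CommOp ρ (Z h)
  right : ∀ h, CommOp ρ (Z' h)
  left_left : ∀ h k, CommOp (Z h) (Z k)
  left_right : ∀ h k, CommOp (Z h) (Z' k)
  right_right : ∀ h k, CommOp (Z' h) (Z' k)

namespace Compatible

variable (hc : Compatible ρ Z Z')
include hc

theorem legOp_left_left {K K' : Type*} [AddCommGroup K] [Module ℂ K] [AddCommGroup K']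
    [Module ℂ K'] (α : LaurentSeries ℂ →ₗ[ℂ] K) (β : LaurentSeries ℂ →ₗ[ℂ] K') (i j k l : Fin 3) :
    CommOp (legOp ρ Z α i j) (legOp ρ Z β k l) :=
  commOp_legOp hc.coaction hc.left hc.left hc.left_left α β i j k l

theorem legOp_left_right {K K' : Type*} [AddCommGroup K] [Module ℂ K] [AddCommGroup K']
    [Module ℂ K'] (α : LaurentSeries ℂ →ₗ[ℂ] K) (β : LaurentSeries ℂ →ₗ[ℂ] K') (i j k l : Fin 3) :
    CommOp (legOp ρ Z α i j) (legOp ρ Z' β k l) :=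
  commOp_legOp hc.coaction hc.left hc.right hc.left_right α β i j k l

theorem legOp_right_right {K K' : Type*} [AddCommGroup K] [Module ℂ K] [AddCommGroup K']
    [Module ℂ K'] (α : LaurentSeries ℂ →ₗ[ℂ] K) (β : LaurentSeries ℂ →ₗ[ℂ] K') (i j k l : Fin 3) :
    CommOp (legOp ρ Z' α i j) (legOp ρ Z' β k l) :=
  commOp_legOp hc.coaction hc.right hc.right hc.right_right α β i j k l

theorem yangBaxter : IsRationalYangBaxter (braiding ρ Z Z') := by
  have hμ := isCommMul_mulSeries₂
  let E := fun T : (V ⊗[ℂ] V) ⊗[ℂ] V →ₗ[ℂ]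
    ((V ⊗[ℂ] V) ⊗[ℂ] V) ⊗[ℂ] LaurentSeries (LaurentSeries ℂ) => extendScalars mulSeries₂ T
  -- Each operator consists of one Z-leg and one Z'-leg, so four exchanges of legs interchange two
  -- such operators.
  have comm : ∀ (α β : LaurentSeries ℂ →ₗ[ℂ] LaurentSeries (LaurentSeries ℂ)) (i j k l : Fin 3) (s),
      E (E (legOp (K := LaurentSeries (LaurentSeries ℂ)) ρ Z (α ∘ₗ negVar) i j) ∘ₗ legOp
      (K := LaurentSeries (LaurentSeries ℂ)) ρ Z' α j i)
        (E (E (legOp (K := LaurentSeries (LaurentSeries ℂ)) ρ Z (β ∘ₗ negVar) k l) ∘ₗ legOp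
        (K := LaurentSeries (LaurentSeries ℂ)) ρ Z' β l k) s) =
      E (E (legOp (K := LaurentSeries (LaurentSeries ℂ)) ρ Z (β ∘ₗ negVar) k l) ∘ₗ legOp
      (K := LaurentSeries (LaurentSeries ℂ)) ρ Z' β l k)
        (E (E (legOp (K := LaurentSeries (LaurentSeries ℂ)) ρ Z (α ∘ₗ negVar) i j) ∘ₗ legOp
        (K := LaurentSeries (LaurentSeries ℂ)) ρ Z' α j i) s) := by
    intro α β i j k l s
    simp only [E, extendScalars_comp hμ]
    rw [(hc.legOp_left_right (β ∘ₗ negVar) α k l j i).symm.extendScalars hμ,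
      (hc.legOp_left_left (α ∘ₗ negVar) (β ∘ₗ negVar) i j k l).extendScalars hμ,
      (hc.legOp_right_right α β j i l k).extendScalars hμ,
      (hc.legOp_left_right (α ∘ₗ negVar) β i j l k).extendScalars hμ]
  unfold IsRationalYangBaxter
  rw [S12_braiding hμ hc.right atFst atFst_mulSeries, S13_braiding hμ hc.right atAdd
    atAdd_mulSeries,
    S23_braiding hμ hc.right atSnd atSnd_mulSeries]
  exact extendScalars_comp_reverse hμ (comm atFst atAdd 0 1 0 2) (comm atFst atSnd 0 1 1 2)
    (comm atAdd atSnd 0 2 1 2)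

end Compatible

variable [Coalgebra ℂ H]

theorem mapCoeff_convolution_aux (φ : LaurentSeries ℂ →ₗ[ℂ] K)
    (hφ : ∀ f g, φ (mulSeries f g) = μ (φ f) (φ g))
    (hinv : convolution Z Z' = counitAction) (hφ1 : φ 1 = e) (h : H) (v : V) :
    TensorProduct.lift (opMul μ (mapCoeff Z φ) (mapCoeff Z' φ)) (Coalgebra.comul (R := ℂ) h) v =
      (Coalgebra.counit (R := ℂ) h) • v ⊗ₜ e := by
  have e1 : convolution Z Z' h v = Coalgebra.counit (R := ℂ) h • v ⊗ₜ 1 := by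
    rw [hinv]; rfl
  have e2 : ∀ c : H ⊗[ℂ] H,
      TensorProduct.lift (opMul μ (mapCoeff Z φ) (mapCoeff Z' φ)) c v =
        LinearMap.lTensor V φ (TensorProduct.lift (opMul mulSeries Z Z') c v) := by
    intro c
    induction c with
    | zero => simp
    | add x y hx hy => simp only [map_add, LinearMap.add_apply, hx, hy]
    | tmul h k => exact (lTensor_extendScalars φ hφ (Z h) (Z' k v)).symm
  rw [e2]
  change LinearMap.lTensor V φ (convolution Z Z' h v) = _
  rw [e1]
  simp [hφ1]

/-- Two legs with the same i and j compose to a single leg through the convolution product. Here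
that product is the counit action, which the counit axiom of the coaction reduces to the identity.
-/
theorem legOp₂_inverse (hr : IsCoaction ρ) (hμ : IsCommMul μ e) (φ : LaurentSeries ℂ →ₗ[ℂ] K)
    (hφ : ∀ f g, φ (mulSeries f g) = μ (φ f) (φ g)) (hφ1 : φ 1 = e)
    (hZ' : ∀ h, CommOp ρ (Z' h)) (hinv : convolution Z Z' = counitAction) (i j : Fin 2)
    (t : V ⊗[ℂ] V) :
    extendScalars μ (legOp₂ ρ Z φ i j) (legOp₂ ρ Z' φ i j t) = t ⊗ₜ e := by
  have hrj : IsCoaction (opAt₂ j ρ) := match j with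
    | 0 => hr.opL
    | 1 => hr.opR
  refine (extendScalars_actThrough_comp hrj
    (fun k => ((hZ' k).symm.lTensor_left φ).symm.opAt₂ j i) t).trans ?_
  refine actThrough_counit (fun h m => ?_) hrj t
  have e1 : ∀ c : H ⊗[ℂ] H,
      TensorProduct.lift (opMul μ (opAt₂ i ∘ₗ mapCoeff Z φ) (opAt₂ i ∘ₗ mapCoeff Z' φ)) c =
        opAt₂ i (TensorProduct.lift (opMul μ (mapCoeff Z φ) (mapCoeff Z' φ)) c) := by
    intro c
    induction c with
    | zero => simp
    | add x y hx hy => simp only [map_add, hx, hy]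
    | tmul h k =>
      match i with
      | 0 => exact extendScalars_opL_opL hμ _ _
      | 1 => exact extendScalars_opR_opR hμ _ _
  rw [LinearMap.comp_apply, e1]
  have e2 := fun v => mapCoeff_convolution_aux (Z := Z) (Z' := Z') φ hφ hinv hφ1 h v
  induction m with
  | zero => simp
  | add x y hx hy => simp only [map_add, hx, hy, TensorProduct.add_tmul, smul_add]
  | tmul a b =>
    match i with
    | 0 =>
      refine (opL_tmul _ _ _).trans ?_
      rw [e2]; simp
    | 1 =>
      refine (opR_tmul _ _ _).trans ?_
      rw [e2]; simp

theorem extendScalars_legOp₂_inverse (hr : IsCoaction ρ) (hμ : IsCommMul μ e)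
    (φ : LaurentSeries ℂ →ₗ[ℂ] K)
    (hφ : ∀ f g, φ (mulSeries f g) = μ (φ f) (φ g)) (hφ1 : φ 1 = e)
    (hZ' : ∀ h, CommOp ρ (Z' h)) (hinv : convolution Z Z' = counitAction) (i j : Fin 2)
    (t : (V ⊗[ℂ] V) ⊗[ℂ] K) :
    extendScalars μ (legOp₂ ρ Z φ i j) (extendScalars μ (legOp₂ ρ Z' φ i j) t) = t := by
  rw [← extendScalars_comp hμ]
  induction t with
  | zero => simp
  | add x y hx hy => simp only [map_add, hx, hy]
  | tmul a f =>
    rw [extendScalars_tmul, LinearMap.comp_apply, legOp₂_inverse hr hμ φ hφ hφ1 hZ' hinv]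
    simp [hμ.one_mul]

theorem extendScalars_legOp_inverse (hr : IsCoaction ρ) (hμ : IsCommMul μ e)
    (φ : LaurentSeries ℂ →ₗ[ℂ] K)
    (hφ : ∀ f g, φ (mulSeries f g) = μ (φ f) (φ g)) (hφ1 : φ 1 = e)
    (hZ' : ∀ h, CommOp ρ (Z' h)) (hinv : convolution Z Z' = counitAction)
    (t : ((V ⊗[ℂ] V) ⊗[ℂ] V) ⊗[ℂ] K) :
    extendScalars μ (legOp ρ Z φ 1 0) (extendScalars μ (legOp ρ Z' φ 1 0) t) = t := by
  rw [← extendScalars_comp hμ, ← opL_legOp₂', ← opL_legOp₂', extendScalars_opL_opL hμ]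
  induction t with
  | zero => simp
  | add x y hx hy => simp only [map_add, hx, hy]
  | tmul a f =>
    rw [extendScalars_tmul]
    induction a with
    | zero => simp
    | add x y hx hy => simp only [map_add, hx, hy, TensorProduct.add_tmul]
    | tmul a b =>
      rw [opL_tmul, LinearMap.comp_apply, legOp₂_inverse hr hμ φ hφ hφ1 hZ' hinv]
      simp [hμ.one_mul]

/-- S21(x) = L_10(Z, -x) L_01(Z', x) and S(-x) = L_01(Z, x) L_10(Z', -x). The two middle legs cancel
by Z' * Z = ε, then the outer two by Z * Z' = ε. -/
theorem isUnitaryOperator_braiding (hr : IsCoaction ρ) (hZ : ∀ h, CommOp ρ (Z h))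
    (hZ' : ∀ h, CommOp ρ (Z' h)) (hinv : convolution Z Z' = counitAction)
    (hinv' : convolution Z' Z = counitAction) : IsUnitaryOperator (braiding ρ Z Z') := by
  have hμ := isCommMul_mulSeries
  intro t
  have e1 : S21 (braiding ρ Z Z') = conjOp (TensorProduct.comm ℂ V V) (braiding ρ Z Z') := rfl
  have e2 : LinearMap.lTensor (V ⊗[ℂ] V) negVar (braiding ρ Z Z' t) =
      extendScalars mulSeries (legOp₂ ρ Z (negVar ∘ₗ negVar) 0 1) (legOp₂ ρ Z' negVar 1 0 t) :=
    LinearMap.congr_fun (lTensor_braiding hZ' negVar negVar_mulSeries) t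
  have e3 : negVar ∘ₗ negVar = LinearMap.id := LinearMap.ext negVar_negVar
  rw [e1, e2, e3, braiding_eq hZ', conjOp_extendScalars, conjOp_comm_legOp₂, conjOp_comm_legOp₂',
    extendScalars_comp hμ, extendScalars_legOp₂_inverse hr hμ LinearMap.id (fun _ _ => rfl) rfl hZ
      hinv', legOp₂_inverse hr hμ negVar negVar_mulSeries negVar_one hZ' hinv]

end Braiding


/-! ### The hypotheses of the theorem as commutation relations -/

section Hypotheses

variable {V H : Type*} [AddCommGroup V] [Module ℂ V] [AddCommGroup H] [Module ℂ H] [Coalgebra ℂ H]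
  {YH : H →ₗ[ℂ] H →ₗ[ℂ] LaurentSeries H} {vacH : H} {Y : V →ₗ[ℂ] V →ₗ[ℂ] LaurentSeries V} {vac : V}
  {ρ : V →ₗ[ℂ] V ⊗[ℂ] H} {Z Z' : H →ₗ[ℂ] V →ₗ[ℂ] V ⊗[ℂ] LaurentSeries ℂ}

theorem IsComoduleNonlocalVertexAlgebra.isCoaction
    (h : IsComoduleNonlocalVertexAlgebra YH vacH Y vac ρ) : IsCoaction ρ where
  coassoc m := by
    rw [LinearEquiv.eq_symm_apply]
    exact LinearMap.congr_fun h.coassoc m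
  counit m := LinearMap.congr_fun h.counit m

/-- By coassociativity, the two orders of coacting twice differ by the flip of the coproduct, which
cocommutativity removes. -/
theorem IsCoaction.commOp_self [Coalgebra.IsCocomm ℂ H] (h : IsCoaction ρ) : CommOp ρ ρ := by
  intro m
  rw [h.coassoc]
  induction ρ m with
  | zero => simp
  | add x y hx hy => simp only [map_add]; rw [← hx, ← hy]
  | tmul a k =>
    rw [LinearMap.lTensor_tmul]
    conv_lhs => rw [← Coalgebra.comm_comul ℂ k]
    induction Coalgebra.comul (R := ℂ) k with
    | zero => simp
    | add x y hx hy => simp only [TensorProduct.tmul_add, map_add, hx, hy]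
    | tmul x y => simp

theorem IsCompatibleModule.commOp (h : IsCompatibleModule YH vacH Y vac ρ Z) (k : H) :
    CommOp ρ (Z k) := h.compatible k

/-- The hypothesis concerns the coefficients of x ^ m z ^ n. Two applications of
`toLaurent_injective`, one for each variable, recover the tensors from these coefficients. -/
theorem CommOp.of_commute (h : Commute Z Z') (k l : H) : CommOp (Z k) (Z' l) := by
  intro v
  have e1 : ∀ (φ : V →ₗ[ℂ] V ⊗[ℂ] LaurentSeries ℂ) (t : V ⊗[ℂ] LaurentSeries ℂ) (n : ℤ),
      (toLaurent (LinearMap.rTensor (LaurentSeries ℂ) φ t)).coeff n =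
        φ ((toLaurent t).coeff n) := by
    intro φ t n
    induction t with
    | zero => simp
    | add x y hx hy => simp [hx, hy]
    | tmul a f => rw [LinearMap.rTensor_tmul, toLaurent_tmul, toLaurent_tmul, vecMulSeries_coeff,
        vecMulSeries_coeff, map_smul]
  have e2 : ∀ (t : (V ⊗[ℂ] LaurentSeries ℂ) ⊗[ℂ] LaurentSeries ℂ) (m n : ℤ),
      (toLaurent ((toLaurent (TensorProduct.rightComm ℂ V _ _ t)).coeff n)).coeff m =
        (toLaurent ((toLaurent t).coeff m)).coeff n := by
    intro t m n
    induction t with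
    | zero => simp
    | add x y hx hy => simp [hx, hy]
    | tmul a g =>
      induction a with
      | zero => simp
      | add x y hx hy => simp only [TensorProduct.add_tmul, map_add, HahnSeries.coeff_add, hx, hy]
      | tmul a f =>
        rw [TensorProduct.rightComm_tmul, toLaurent_tmul, toLaurent_tmul, vecMulSeries_coeff,
          vecMulSeries_coeff, map_smul, map_smul, HahnSeries.coeff_smul, HahnSeries.coeff_smul,
          toLaurent_tmul, toLaurent_tmul, vecMulSeries_coeff, vecMulSeries_coeff, smul_comm]
  apply toLaurent_injective
  ext1; funext n
  apply toLaurent_injective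
  ext m
  rw [e2, e1, e1]
  exact h k l v m n

end Hypotheses

/-! ### Explicit formulas for operators and legs on pure tensors -/

section Insertion

variable {V X : Type*} [AddCommGroup V] [Module ℂ V] [AddCommGroup X] [Module ℂ X]

theorem opAt_zero_tmul (φ : V →ₗ[ℂ] V ⊗[ℂ] X) (a b c : V) :
    opAt 0 φ ((a ⊗ₜ b) ⊗ₜ c) = LinearMap.rTensor X
      ((TensorProduct.mk ℂ (V ⊗[ℂ] V) V).flip c ∘ₗ (TensorProduct.mk ℂ V V).flip b) (φ a) := by
  change opL V (opL V φ) ((a ⊗ₜ b) ⊗ₜ c) = _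
  rw [opL_tmul, opL_tmul, rTensor_comp_apply']

theorem opAt_one_tmul (φ : V →ₗ[ℂ] V ⊗[ℂ] X) (a b c : V) :
    opAt 1 φ ((a ⊗ₜ b) ⊗ₜ c) = LinearMap.rTensor X
      ((TensorProduct.mk ℂ (V ⊗[ℂ] V) V).flip c ∘ₗ TensorProduct.mk ℂ V V a) (φ b) := by
  change opL V (opR V φ) ((a ⊗ₜ b) ⊗ₜ c) = _
  rw [opL_tmul, opR_tmul, rTensor_comp_apply']

theorem opAt_two_tmul (φ : V →ₗ[ℂ] V ⊗[ℂ] X) (a b c : V) :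
    opAt 2 φ ((a ⊗ₜ b) ⊗ₜ c) = LinearMap.rTensor X
      (TensorProduct.mk ℂ (V ⊗[ℂ] V) V (a ⊗ₜ b)) (φ c) := opR_tmul _ _ _

end Insertion

section LegExt

variable {V H : Type*} [AddCommGroup V] [Module ℂ V] [AddCommGroup H] [Module ℂ H]

/-- A finite set of pairs whose tensors add up to `t`. -/
def terms {M X : Type*} [AddCommMonoid M] [Module ℂ M] [AddCommMonoid X] [Module ℂ X]
    (t : M ⊗[ℂ] X) : Finset (M × X) := (TensorProduct.exists_finset t).choose

theorem sum_terms {M X : Type*} [AddCommMonoid M] [Module ℂ M] [AddCommMonoid X] [Module ℂ X]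
    (t : M ⊗[ℂ] X) : ∑ p ∈ terms t, p.1 ⊗ₜ[ℂ] p.2 = t :=
    (TensorProduct.exists_finset t).choose_spec.symm

theorem map_eq_sum_terms {M X P : Type*} [AddCommMonoid M] [Module ℂ M] [AddCommMonoid X]
    [Module ℂ X]
    [AddCommMonoid P] [Module ℂ P] (f : M ⊗[ℂ] X →ₗ[ℂ] P) (t : M ⊗[ℂ] X) :
    f t = ∑ p ∈ terms t, f (p.1 ⊗ₜ[ℂ] p.2) := by
  rw [← map_sum, sum_terms]

section

variable {X K : Type*} [AddCommGroup X] [Module ℂ X] [AddCommGroup K] [Module ℂ K]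
  (ρ : V →ₗ[ℂ] V ⊗[ℂ] H) (Z : H →ₗ[ℂ] V →ₗ[ℂ] V ⊗[ℂ] X) (α : X →ₗ[ℂ] K)

theorem opAt_zero_mapCoeff (h : H) (a b c : V) : opAt 0 (mapCoeff Z α h) ((a ⊗ₜ b) ⊗ₜ c) =
    ∑ q ∈ terms (Z h a), ((q.1 ⊗ₜ b) ⊗ₜ c) ⊗ₜ α q.2 := by
  rw [opAt_zero_tmul, mapCoeff_apply, LinearMap.comp_apply, ← LinearMap.comp_apply,
    map_eq_sum_terms]
  rfl

theorem opAt_one_mapCoeff (h : H) (a b c : V) : opAt 1 (mapCoeff Z α h) ((a ⊗ₜ b) ⊗ₜ c) =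
    ∑ q ∈ terms (Z h b), ((a ⊗ₜ q.1) ⊗ₜ c) ⊗ₜ α q.2 := by
  rw [opAt_one_tmul, mapCoeff_apply, LinearMap.comp_apply, ← LinearMap.comp_apply,
    map_eq_sum_terms]
  rfl

theorem opAt_two_mapCoeff (h : H) (a b c : V) : opAt 2 (mapCoeff Z α h) ((a ⊗ₜ b) ⊗ₜ c) =
    ∑ q ∈ terms (Z h c), ((a ⊗ₜ b) ⊗ₜ q.1) ⊗ₜ α q.2 := by
  rw [opAt_two_tmul, mapCoeff_apply, LinearMap.comp_apply, ← LinearMap.comp_apply,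
    map_eq_sum_terms]
  rfl

theorem legOp_zero_right (i : Fin 3) (a b c : V) : legOp ρ Z α i 0 ((a ⊗ₜ b) ⊗ₜ c) =
    ∑ p ∈ terms (ρ a), opAt i (mapCoeff Z α p.2) ((p.1 ⊗ₜ b) ⊗ₜ c) := by
  rw [legOp, actThrough, LinearMap.comp_apply, opAt_zero_tmul, ← LinearMap.comp_apply,
    map_eq_sum_terms]
  rfl

theorem legOp_one_right (i : Fin 3) (a b c : V) : legOp ρ Z α i 1 ((a ⊗ₜ b) ⊗ₜ c) =
    ∑ p ∈ terms (ρ b), opAt i (mapCoeff Z α p.2) ((a ⊗ₜ p.1) ⊗ₜ c) := by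
  rw [legOp, actThrough, LinearMap.comp_apply, opAt_one_tmul, ← LinearMap.comp_apply,
    map_eq_sum_terms]
  rfl

end

/-- The scalar extension of `legOp` to `ℂ((x₁))((x₂))`. -/
def legExt (ρ : V →ₗ[ℂ] V ⊗[ℂ] H) (Z : H →ₗ[ℂ] V →ₗ[ℂ] V ⊗[ℂ] LaurentSeries ℂ)
    (α : LaurentSeries ℂ →ₗ[ℂ] LaurentSeries (LaurentSeries ℂ)) (i j : Fin 3) :
    ((V ⊗[ℂ] V) ⊗[ℂ] V) ⊗[ℂ] LaurentSeries (LaurentSeries ℂ) →ₗ[ℂ]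
      ((V ⊗[ℂ] V) ⊗[ℂ] V) ⊗[ℂ] LaurentSeries (LaurentSeries ℂ) :=
  extendScalars mulSeries₂ (legOp (K := LaurentSeries (LaurentSeries ℂ)) ρ Z α i j)

variable (ρ : V →ₗ[ℂ] V ⊗[ℂ] H) (Z : H →ₗ[ℂ] V →ₗ[ℂ] V ⊗[ℂ] LaurentSeries ℂ)
  (α : LaurentSeries ℂ →ₗ[ℂ] LaurentSeries (LaurentSeries ℂ))

theorem legExt_tmul (i j : Fin 3) (t : (V ⊗[ℂ] V) ⊗[ℂ] V) (F : LaurentSeries (LaurentSeries ℂ)) :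
    legExt ρ Z α i j (t ⊗ₜ F) = LinearMap.lTensor ((V ⊗[ℂ] V) ⊗[ℂ] V) (mulSeries₂.flip F)
      (legOp (K := LaurentSeries (LaurentSeries ℂ)) ρ Z α i j t) :=
  extendScalars_tmul (K := LaurentSeries (LaurentSeries ℂ)) _ _ _ _

theorem legExt_zero_one (a b c : V) (F : LaurentSeries (LaurentSeries ℂ)) :
    legExt ρ Z α 0 1 (((a ⊗ₜ b) ⊗ₜ c) ⊗ₜ F) = ∑ p ∈ terms (ρ b), ∑ q ∈ terms (Z p.2 a),
      ((q.1 ⊗ₜ p.1) ⊗ₜ c) ⊗ₜ mulSeries₂ (α q.2) F := by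
  rw [legExt_tmul, legOp_one_right, map_sum]
  simp_rw [opAt_zero_mapCoeff, map_sum]
  rfl

theorem legExt_one_zero (a b c : V) (F : LaurentSeries (LaurentSeries ℂ)) :
    legExt ρ Z α 1 0 (((a ⊗ₜ b) ⊗ₜ c) ⊗ₜ F) = ∑ p ∈ terms (ρ a), ∑ q ∈ terms (Z p.2 b),
      ((p.1 ⊗ₜ q.1) ⊗ₜ c) ⊗ₜ mulSeries₂ (α q.2) F := by
  rw [legExt_tmul, legOp_zero_right, map_sum]
  simp_rw [opAt_one_mapCoeff, map_sum]
  rfl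

theorem legExt_two_zero (a b c : V) (F : LaurentSeries (LaurentSeries ℂ)) :
    legExt ρ Z α 2 0 (((a ⊗ₜ b) ⊗ₜ c) ⊗ₜ F) = ∑ p ∈ terms (ρ a), ∑ q ∈ terms (Z p.2 c),
      ((p.1 ⊗ₜ b) ⊗ₜ q.1) ⊗ₜ mulSeries₂ (α q.2) F := by
  rw [legExt_tmul, legOp_zero_right, map_sum]
  simp_rw [opAt_two_mapCoeff, map_sum]
  rfl

theorem legExt_two_one (a b c : V) (F : LaurentSeries (LaurentSeries ℂ)) :
    legExt ρ Z α 2 1 (((a ⊗ₜ b) ⊗ₜ c) ⊗ₜ F) = ∑ p ∈ terms (ρ b), ∑ q ∈ terms (Z p.2 c),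
      ((a ⊗ₜ p.1) ⊗ₜ q.1) ⊗ₜ mulSeries₂ (α q.2) F := by
  rw [legExt_tmul, legOp_one_right, map_sum]
  simp_rw [opAt_two_mapCoeff, map_sum]
  rfl

end LegExt

/-! ### Products and iterates of vertex operators as maps on triple tensors -/

section Series

variable {A B C P : Type*} [AddCommGroup A] [Module ℂ A] [AddCommGroup B] [Module ℂ B]
  [AddCommGroup C] [Module ℂ C] [AddCommGroup P] [Module ℂ P]

/-- The bilinear map `(b, g) ↦ j(b) ⊗ g` attached to a linear map `j`. -/
def tensorSeries (j : A →ₗ[ℂ] B) : A →ₗ[ℂ] LaurentSeries ℂ →ₗ[ℂ] B ⊗[ℂ] LaurentSeries ℂ :=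
  TensorProduct.mk ℂ B (LaurentSeries ℂ) ∘ₗ j

/-- A series attached to `a` is in the variable of `a`, which is the outer variable of F; hence
`atSnd`. -/
theorem laurentMul_mulScalar_left (β : A →ₗ[ℂ] LaurentSeries ℂ →ₗ[ℂ] P) (a : LaurentSeries A)
    (f : LaurentSeries ℂ) (F : LaurentSeries (LaurentSeries ℂ)) :
    laurentMul β (mulScalar a f) F = laurentMul β a (atSnd f * F) := by
  have e : laurentMul (LinearMap.lsmul ℂ (LaurentSeries ℂ)) f F = atSnd f * F := by
    rw [← mulSeries₂_eq]
    unfold mulSeries₂ mulScalar₂ atSnd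
    rw [laurentMul_laurentMap_left]
    refine laurentMul_congr (fun c g => ?_) f F
    change c • g = mulScalar (HahnSeries.single 0 c) g
    rw [mulScalar_single_zero]
    ext n
    rw [vecMulSeries_coeff]
    simp [mul_comm]
  rw [← e]
  exact laurentMul_assoc _ _ _ _ (fun a c g => by simp) a f F

end Series

section Vertex

variable {V H : Type*} [AddCommGroup V] [Module ℂ V] [AddCommGroup H] [Module ℂ H]
  (Y : V →ₗ[ℂ] V →ₗ[ℂ] LaurentSeries V)
  {ρ : V →ₗ[ℂ] V ⊗[ℂ] H} {Z : H →ₗ[ℂ] V →ₗ[ℂ] V ⊗[ℂ] LaurentSeries ℂ}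

theorem vertexTensorOne_tmul (a b c : V) (F : LaurentSeries (LaurentSeries ℂ)) :
    vertexTensorOne Y (((a ⊗ₜ b) ⊗ₜ c) ⊗ₜ F) =
      laurentMul (tensorSeries ((TensorProduct.mk ℂ V V).flip c)) (Y a b) F := by
  change laurentMul (TensorProduct.mk ℂ (V ⊗[ℂ] V) (LaurentSeries ℂ))
    (laurentMul (TensorProduct.mk ℂ V V) (Y a b) (HahnSeries.single 0 c)) F = _
  rw [laurentMul_single_zero_right, laurentMul_laurentMap_left]
  rfl

/-- The map `1 ⊗ Y(z)`, sending `((a ⊗ b) ⊗ c) ⊗ F(x, z)` to `F(x, z) (a ⊗ Y(b, z) c)`. -/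
def oneTensorVertex : ((V ⊗[ℂ] V) ⊗[ℂ] V) ⊗[ℂ] LaurentSeries (LaurentSeries ℂ) →ₗ[ℂ]
    LaurentSeries ((V ⊗[ℂ] V) ⊗[ℂ] LaurentSeries ℂ) :=
  TensorProduct.lift <|
    laurentMul (TensorProduct.mk ℂ (V ⊗[ℂ] V) (LaurentSeries ℂ)) ∘ₗ
      TensorProduct.lift
        (laurentMul (TensorProduct.mk ℂ V V) ∘ₗ HahnSeries.single.linearMap 0) ∘ₗ
      LinearMap.lTensor V (TensorProduct.lift Y) ∘ₗ (TensorProduct.assoc ℂ V V V).toLinearMap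

theorem oneTensorVertex_tmul (a b c : V) (F : LaurentSeries (LaurentSeries ℂ)) :
    oneTensorVertex Y (((a ⊗ₜ b) ⊗ₜ c) ⊗ₜ F) =
      laurentMul (tensorSeries (TensorProduct.mk ℂ V V a)) (Y b c) F := by
  change laurentMul (TensorProduct.mk ℂ (V ⊗[ℂ] V) (LaurentSeries ℂ))
    (laurentMul (TensorProduct.mk ℂ V V) (HahnSeries.single 0 a) (Y b c)) F = _
  rw [laurentMul_single_zero_left, laurentMul_laurentMap_left]
  rfl

theorem triple_ext {P : Type*} [AddCommGroup P] [Module ℂ P]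
    {φ ψ : ((V ⊗[ℂ] V) ⊗[ℂ] V) ⊗[ℂ] LaurentSeries (LaurentSeries ℂ) →ₗ[ℂ] P}
    (h : ∀ a b c F, φ (((a ⊗ₜ b) ⊗ₜ c) ⊗ₜ F) = ψ (((a ⊗ₜ b) ⊗ₜ c) ⊗ₜ F)) (t) : φ t = ψ t := by
  have : φ = ψ := by
    ext a b c F
    exact h a b c F
  rw [this]

/-- In this form the deformed map is the original one preceded by a leg, so its properties reduce to
moving legs past `Y`. -/
theorem deformedVertex_apply (a b : V) :
    deformedVertex Y ρ Z a b = extendField (TensorProduct.lift Y)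
    (legOp₂ ρ Z LinearMap.id 1 0 (a ⊗ₜ b)) := by
  change (TensorProduct.lift _ (ρ a) : V →ₗ[ℂ] LaurentSeries V) b =
    extendField (TensorProduct.lift Y) (TensorProduct.lift _ (opL V ρ (a ⊗ₜ b)))
  rw [opL_tmul]
  induction ρ a with
  | zero => simp
  | add x y hx hy => simp only [map_add, LinearMap.add_apply, hx, hy]
  | tmul a h =>
    rw [LinearMap.rTensor_tmul, TensorProduct.lift.tmul, TensorProduct.lift.tmul]
    change extendField (Y a) (Z h b) = extendField (TensorProduct.lift Y)
      (opR V (mapCoeff Z LinearMap.id h) (a ⊗ₜ b))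
    rw [opR_tmul, mapCoeff_apply, LinearMap.lTensor_id, LinearMap.id_comp]
    induction Z h b with
    | zero => simp
    | add x y hx hy => simp only [map_add, hx, hy]
    | tmul b f => rfl

theorem extendField_lTensor_mul {A B : Type*} [AddCommGroup A] [Module ℂ A] [AddCommGroup B]
    [Module ℂ B] (φ : A →ₗ[ℂ] LaurentSeries B) (f : LaurentSeries ℂ) (t : A ⊗[ℂ] LaurentSeries ℂ) :
    extendField φ (LinearMap.lTensor A (mulSeries.flip f) t) = mulScalar (extendField φ t) f := by
  induction t with
  | zero => simp
  | add x y hx hy => simp only [map_add, LinearMap.add_apply, hx, hy]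
  | tmul a g =>
    change mulScalar (φ a) (mulSeries g f) = mulScalar (mulScalar (φ a) g) f
    rw [mulScalar_mul, mulSeries_eq]

theorem extendField_deformedVertex (t : (V ⊗[ℂ] V) ⊗[ℂ] LaurentSeries ℂ) :
    extendField (TensorProduct.lift (deformedVertex Y ρ Z)) t =
      extendField (TensorProduct.lift Y)
        (extendScalars mulSeries (legOp₂ ρ Z LinearMap.id 1 0) t) := by
  induction t with
  | zero => simp
  | add x y hx hy => simp only [map_add, hx, hy]
  | tmul t f =>
    rw [extendScalars_tmul, extendField_lTensor_mul]
    change mulScalar (TensorProduct.lift (deformedVertex Y ρ Z) t) f = _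
    congr 2
    induction t with
    | zero => simp
    | add x y hx hy => simp only [map_add, hx, hy]
    | tmul a b => exact deformedVertex_apply Y a b

theorem deformedVertex_eq_sum (a b : V) :
    deformedVertex Y ρ Z a b =
      ∑ p ∈ terms (ρ a), ∑ q ∈ terms (Z p.2 b), mulScalar (Y p.1 q.1) q.2 := by
  rw [deformedVertex, LinearMap.comp_apply, map_eq_sum_terms, LinearMap.sum_apply]
  refine Finset.sum_congr rfl fun p _ => ?_
  change extendField (Y p.1) (Z p.2 b) = _
  rw [map_eq_sum_terms]
  rfl

theorem vertexTensorOne_deformedVertex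
    (t : ((V ⊗[ℂ] V) ⊗[ℂ] V) ⊗[ℂ] LaurentSeries (LaurentSeries ℂ)) :
    vertexTensorOne (deformedVertex Y ρ Z) t =
      vertexTensorOne Y (legExt ρ Z atSnd 1 0 t) := by
  refine triple_ext (P := LaurentSeries ((V ⊗[ℂ] V) ⊗[ℂ] LaurentSeries ℂ))
    (φ := vertexTensorOne (deformedVertex Y ρ Z))
    (ψ := vertexTensorOne Y ∘ₗ legExt ρ Z atSnd 1 0) (fun a b c F => ?_) t
  rw [vertexTensorOne_tmul, LinearMap.comp_apply, legExt_one_zero, deformedVertex_eq_sum]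
  simp_rw [map_sum, LinearMap.sum_apply, laurentMul_mulScalar_left, vertexTensorOne_tmul,
    mulSeries₂_eq]

theorem oneTensorVertex_deformedVertex
    (t : ((V ⊗[ℂ] V) ⊗[ℂ] V) ⊗[ℂ] LaurentSeries (LaurentSeries ℂ)) :
    oneTensorVertex (deformedVertex Y ρ Z) t =
      oneTensorVertex Y (legExt ρ Z atSnd 2 1 t) := by
  refine triple_ext (P := LaurentSeries ((V ⊗[ℂ] V) ⊗[ℂ] LaurentSeries ℂ))
    (φ := oneTensorVertex (deformedVertex Y ρ Z))
    (ψ := oneTensorVertex Y ∘ₗ legExt ρ Z atSnd 2 1) (fun a b c F => ?_) t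
  rw [oneTensorVertex_tmul, LinearMap.comp_apply, legExt_two_one, deformedVertex_eq_sum]
  simp_rw [map_sum, LinearMap.sum_apply, laurentMul_mulScalar_left, oneTensorVertex_tmul,
    mulSeries₂_eq]

/-- `((a ⊗ b) ⊗ c) ⊗ F(x₁, x₂) ↦ F(x₁, x₂) Y(a, x₁) Y(b, x₂) c`. -/
def productVertex : ((V ⊗[ℂ] V) ⊗[ℂ] V) ⊗[ℂ] LaurentSeries (LaurentSeries ℂ) →ₗ[ℂ]
    LaurentSeries (LaurentSeries V) :=
  laurentMap (extendField (TensorProduct.lift Y)) ∘ₗ oneTensorVertex Y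

/-- `((a ⊗ b) ⊗ c) ⊗ F(x₂, x₀) ↦ F(x₂, x₀) Y(Y(a, x₀) b, x₂) c`. -/
def iterateVertex : ((V ⊗[ℂ] V) ⊗[ℂ] V) ⊗[ℂ] LaurentSeries (LaurentSeries ℂ) →ₗ[ℂ]
    LaurentSeries (LaurentSeries V) :=
  laurentMap (extendField (TensorProduct.lift Y)) ∘ₗ vertexTensorOne Y

theorem productVertex_tmul (a b c : V) (F : LaurentSeries (LaurentSeries ℂ)) :
    productVertex Y (((a ⊗ₜ b) ⊗ₜ c) ⊗ₜ F) = mulScalar₂ (laurentMap (Y a) (Y b c)) F := by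
  rw [productVertex, LinearMap.comp_apply, oneTensorVertex_tmul, laurentMap_laurentMul]
  unfold mulScalar₂
  rw [laurentMul_laurentMap_left]
  exact laurentMul_congr (fun x f => rfl) _ _

theorem iterateVertex_tmul (a b c : V) (F : LaurentSeries (LaurentSeries ℂ)) :
    iterateVertex Y (((a ⊗ₜ b) ⊗ₜ c) ⊗ₜ F) = mulScalar₂ (laurentMap (Y.flip c) (Y a b)) F := by
  rw [iterateVertex, LinearMap.comp_apply, vertexTensorOne_tmul, laurentMap_laurentMul]
  unfold mulScalar₂
  rw [laurentMul_laurentMap_left]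
  exact laurentMul_congr (fun x f => rfl) _ _

end Vertex


/-! ### A common frame for associativity and locality -/

section SeriesRelations

variable {V : Type*} [AddCommGroup V] [Module ℂ V]

/-- A family of additive relations between series which gets weaker as the parameter grows. -/
structure IsSeriesRelation
    (R : ℕ → LaurentSeries (LaurentSeries V) → LaurentSeries (LaurentSeries V) → Prop) : Prop where
  zero : ∀ k, R k 0 0
  add : ∀ {k F G F' G'}, R k F G → R k F' G' → R k (F + F') (G + G')
  mono : ∀ {k l F G}, R k F G → k ≤ l → R l F G

theorem isSeriesRelation_expands : IsSeriesRelation (V := V) Expands where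
  zero := Expands.zero
  add h h' := h.add h'
  mono h hl := h.mono hl

theorem isSeriesRelation_mutuallyLocal : IsSeriesRelation (V := V) MutuallyLocal where
  zero := MutuallyLocal.zero
  add h h' := h.add h'
  mono h hl := h.mono hl

variable {R : ℕ → LaurentSeries (LaurentSeries V) → LaurentSeries (LaurentSeries V) → Prop}

theorem IsSeriesRelation.sum (hR : IsSeriesRelation R) {ι : Type*} {k : ℕ} (s : Finset ι)
    {F G : ι → LaurentSeries (LaurentSeries V)} (h : ∀ i ∈ s, R k (F i) (G i)) :
    R k (∑ i ∈ s, F i) (∑ i ∈ s, G i) := by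
  classical
  induction s using Finset.induction_on with
  | empty => simpa using hR.zero k
  | insert i s hi ih =>
    rw [Finset.sum_insert hi, Finset.sum_insert hi]
    exact hR.add (h i (Finset.mem_insert_self i s))
      (ih fun j hj => h j (Finset.mem_insert_of_mem hj))

end SeriesRelations

/-! ### The module axioms as identities of tensors -/

section ModuleIdentities

variable {V H : Type*} [AddCommGroup V] [Module ℂ V] [AddCommGroup H] [Module ℂ H]
  {YH : H →ₗ[ℂ] H →ₗ[ℂ] LaurentSeries H} {vacH : H} {Y : V →ₗ[ℂ] V →ₗ[ℂ] LaurentSeries V} {vac : V}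
  {Z : H →ₗ[ℂ] V →ₗ[ℂ] V ⊗[ℂ] LaurentSeries ℂ}

theorem mulScalar₂_single_zero (w : V) (F : LaurentSeries (LaurentSeries ℂ)) :
    mulScalar₂ (HahnSeries.single 0 (HahnSeries.single 0 w)) F = laurentMap (vecMulSeries w) F :=
  laurentMul_single_zero_left mulScalar (HahnSeries.single 0 w) F

theorem mulScalar₂_single_toLaurent (t : V ⊗[ℂ] LaurentSeries ℂ)
    (G : LaurentSeries (LaurentSeries ℂ)) :
    mulScalar₂ (HahnSeries.single 0 (toLaurent t)) G = ∑ q ∈ terms t,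
      mulScalar₂ (mulScalar₂ (HahnSeries.single 0 (HahnSeries.single 0 q.1)) (atFst q.2)) G := by
  have e : ∀ x : LaurentSeries V, mulScalar₂ (HahnSeries.single 0 x) G = laurentMap (mulScalar x) G
    :=
    fun x => laurentMul_single_zero_left mulScalar x G
  simp_rw [mulScalar₂_atFst, laurentMap_single, e, LinearMap.flip_apply, mulScalar_single_zero,
    ← toLaurent_tmul]
  rw [map_eq_sum_terms toLaurent, map_sum]
  ext1
  funext n
  rw [laurentMap_coeff, LinearMap.sum_apply, HahnSeries.coeff_sum]
  rfl

theorem laurentMap_toLaurent_action (h k : H) (c : V) :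
    laurentMap (toLaurent ∘ₗ Z h) (toLaurent (Z k c)) =
      ∑ p ∈ terms (Z k c), ∑ q ∈ terms (Z h p.1),
        mulScalar₂ (mulScalar₂ (HahnSeries.single 0 (HahnSeries.single 0 q.1)) (atFst q.2))
          (atSnd p.2) := by
  rw [map_eq_sum_terms toLaurent, map_sum]
  refine Finset.sum_congr rfl fun p _ => ?_
  rw [toLaurent_tmul, ← mulScalar_single_zero, laurentMap_mulScalar_atSnd, laurentMap_single,
    LinearMap.comp_apply, mulScalar₂_single_toLaurent]

/-- Associativity of an `H`-module with values in `V ⊗ ℂ((x))`. -/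
theorem laurentMap_flip_action
    (hZ : ∀ h k, Associative YH (Z.compr₂ toLaurent) h k) (h k : H) (c : V) :
    laurentMap (Z.flip c) (YH h k) =
      ∑ p ∈ terms (Z k c), ∑ q ∈ terms (Z h p.1),
        laurentMap (TensorProduct.mk ℂ V (LaurentSeries ℂ) q.1) (atAdd q.2 * atFst p.2) := by
  apply laurentMap_injective toLaurent_injective
  obtain ⟨n, hn⟩ := hZ h k
  have e1 : Expands n (laurentMap (toLaurent ∘ₗ Z h) (toLaurent (Z k c)))
      (laurentMap toLaurent (laurentMap (Z.flip c) (YH h k))) := hn c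
  -- With values in V ⊗ ℂ((x)), the product Z(h, x₁) Z(k, x₂) c is a finite sum of terms w f(x₁)
  -- g(x₂), which needs no power of x₁ - x₂. Uniqueness of expansions then gives Z(Y(h, x₀)k, x₂) =
  -- Z(h, x₂ + x₀) Z(k, x₂) exactly.
  have e2 : Expands 0 (laurentMap (toLaurent ∘ₗ Z h) (toLaurent (Z k c)))
      (∑ p ∈ terms (Z k c), ∑ q ∈ terms (Z h p.1),
        mulScalar₂ (mulScalar₂ (HahnSeries.single 0 (HahnSeries.single 0 q.1)) (atAdd q.2))
          (atFst p.2)) := by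
    rw [laurentMap_toLaurent_action]
    exact isSeriesRelation_expands.sum _ fun p _ => isSeriesRelation_expands.sum _ fun q _ =>
      ((Expands.const q.1).mul_atFst q.2).mul_atSnd p.2
  rw [e1.unique e2]
  simp_rw [map_sum, mulScalar₂_mul, mulScalar₂_single_zero]
  rfl

theorem IsModuleNonlocalVertexAlgebra.laurentMap_action [Coalgebra ℂ H]
    (hZ : IsModuleNonlocalVertexAlgebra YH vacH Y vac Z) (h : H) (u v : V) :
    laurentMap (Z h) (Y u v) = ∑ d ∈ terms (Coalgebra.comul (R := ℂ) h),
      ∑ q ∈ terms (Z d.1 u), ∑ s ∈ terms (Z d.2 v),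
        laurentMul (TensorProduct.mk ℂ V (LaurentSeries ℂ)) (Y q.1 s.1)
          (atSub q.2 * atFst s.2) := by
  apply laurentMap_injective toLaurent_injective
  have e := hZ.act_vertex h u v
  refine (laurentMap_comp_apply _ _ _).trans (e.trans ?_)
  rw [map_eq_sum_terms, map_sum]
  refine Finset.sum_congr rfl fun d _ => ?_
  rw [TensorProduct.lift.tmul, LinearMap.compl₁₂_apply, LinearMap.flip_apply, LinearMap.flip_apply]
  conv_lhs => rw [← sum_terms (Z d.1 u), ← sum_terms (Z d.2 v)]
  simp_rw [map_sum, LinearMap.sum_apply, laurentMap_laurentMul]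
  rw [Finset.sum_comm]
  refine Finset.sum_congr rfl fun q _ => Finset.sum_congr rfl fun s _ => ?_
  rw [← mulSeries₂_eq]
  rfl

end ModuleIdentities

/-! ### The coaction on products, and legs on pure tensors of two factors -/

section Intertwiners

variable {V H : Type*} [AddCommGroup V] [Module ℂ V] [AddCommGroup H] [Module ℂ H]
  {YH : H →ₗ[ℂ] H →ₗ[ℂ] LaurentSeries H} {vacH : H} {Y : V →ₗ[ℂ] V →ₗ[ℂ] LaurentSeries V} {vac : V}
  {ρ : V →ₗ[ℂ] V ⊗[ℂ] H} {Z : H →ₗ[ℂ] V →ₗ[ℂ] V ⊗[ℂ] LaurentSeries ℂ}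

theorem IsHom.laurentMap_eq_sum (h : IsHom Y vac (tensorVertex Y YH) (vac ⊗ₜ[ℂ] vacH) ρ) (a b : V) :
    laurentMap ρ (Y a b) = ∑ p ∈ terms (ρ a), ∑ r ∈ terms (ρ b),
      laurentMul (TensorProduct.mk ℂ V H) (Y p.1 r.1) (YH p.2 r.2) := by
  rw [h.map_vertex]
  conv_lhs => rw [← sum_terms (ρ a), ← sum_terms (ρ b)]
  simp_rw [map_sum, LinearMap.sum_apply]
  rw [Finset.sum_comm]
  rfl

section

variable {X K : Type*} [AddCommGroup X] [Module ℂ X] [AddCommGroup K] [Module ℂ K]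
  (ρ : V →ₗ[ℂ] V ⊗[ℂ] H) (Z : H →ₗ[ℂ] V →ₗ[ℂ] V ⊗[ℂ] X) (α : X →ₗ[ℂ] K)

theorem opAt₂_zero (φ : V →ₗ[ℂ] V ⊗[ℂ] X) : opAt₂ 0 φ = opL V φ := rfl

theorem opAt₂_one (φ : V →ₗ[ℂ] V ⊗[ℂ] X) : opAt₂ 1 φ = opR V φ := rfl

theorem legOp₂_one_zero (a b : V) : legOp₂ ρ Z α 1 0 (a ⊗ₜ b) =
    ∑ p ∈ terms (ρ a), LinearMap.rTensor K (TensorProduct.mk ℂ V V p.1)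
      (LinearMap.lTensor V α (Z p.2 b)) := by
  rw [legOp₂, actThrough, LinearMap.comp_apply, opAt₂_zero, opL_tmul, ← LinearMap.comp_apply,
    map_eq_sum_terms]
  refine Finset.sum_congr rfl fun p _ => ?_
  rw [LinearMap.comp_apply, LinearMap.rTensor_tmul, TensorProduct.lift.tmul, LinearMap.flip_apply,
    LinearMap.comp_apply, LinearMap.flip_apply, TensorProduct.mk_apply, opAt₂_one, opR_tmul]
  rfl

theorem legOp₂_zero_one (a b : V) : legOp₂ ρ Z α 0 1 (a ⊗ₜ b) =
    ∑ p ∈ terms (ρ b), LinearMap.rTensor K ((TensorProduct.mk ℂ V V).flip p.1)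
      (LinearMap.lTensor V α (Z p.2 a)) := by
  rw [legOp₂, actThrough, LinearMap.comp_apply, opAt₂_one, opR_tmul, ← LinearMap.comp_apply,
    map_eq_sum_terms]
  refine Finset.sum_congr rfl fun p _ => ?_
  rw [LinearMap.comp_apply, LinearMap.rTensor_tmul, TensorProduct.lift.tmul, LinearMap.flip_apply,
    LinearMap.comp_apply, TensorProduct.mk_apply, opAt₂_zero, opL_tmul]
  rfl

end

end Intertwiners


/-! ### Scalar factors inside series of tensors -/

section Scale

variable {A B : Type*} [AddCommGroup A] [Module ℂ A] [AddCommGroup B] [Module ℂ B]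

/-- The multiplication of elements of `B ⊗ ℂ((x))` by series. -/
def scaleSeries (B : Type*) [AddCommGroup B] [Module ℂ B] :
    B ⊗[ℂ] LaurentSeries ℂ →ₗ[ℂ] LaurentSeries ℂ →ₗ[ℂ] B ⊗[ℂ] LaurentSeries ℂ :=
  (LinearMap.lTensorHom B ∘ₗ mulSeries.flip).flip

theorem laurentMap_extendScalars_tensorSeries (T : B →ₗ[ℂ] B ⊗[ℂ] LaurentSeries ℂ) (j : A →ₗ[ℂ] B)
    (a : LaurentSeries A) (F : LaurentSeries (LaurentSeries ℂ)) :
    laurentMap (extendScalars mulSeries T) (laurentMul (tensorSeries j) a F) =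
      laurentMul (scaleSeries B) (laurentMap (T ∘ₗ j) a) F := by
  rw [laurentMap_laurentMul, laurentMul_laurentMap_left]
  exact laurentMul_congr (fun x f => extendScalars_tmul _ _ _ _) a F

theorem laurentMul_scaleSeries (j : A →ₗ[ℂ] B) (a : LaurentSeries A)
    (G F : LaurentSeries (LaurentSeries ℂ)) :
    laurentMul (scaleSeries B) (laurentMul (tensorSeries j) a G) F =
      laurentMul (tensorSeries j) a (mulSeries₂ G F) :=
  laurentMul_assoc _ _ mulSeries _ (fun _ _ _ => rfl) a G F

end Scale

/-! ### Two actions fed by the same coaction -/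

section Coproduct

variable {V H K : Type*} [AddCommGroup V] [Module ℂ V] [AddCommGroup H] [Module ℂ H] [Coalgebra ℂ H]
  [AddCommGroup K] [Module ℂ K] {μ : K →ₗ[ℂ] K →ₗ[ℂ] K} {e : K}

/-- One coaction followed by a second is a coaction followed by a coproduct, whose parts are given
to `A` and `A'`. The hypothesis `hm` records that `r` touches only the factor N inside M. -/
theorem extendScalars_actThrough_actThrough {M N : Type*} [AddCommGroup M] [Module ℂ M]
    [AddCommGroup N] [Module ℂ N]
    {A A' : H →ₗ[ℂ] M →ₗ[ℂ] M ⊗[ℂ] K} {r : M →ₗ[ℂ] M ⊗[ℂ] H} (hμ : IsCommMul μ e)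
    (hr : IsCoaction r) (hrA : ∀ k, CommOp r (A' k)) {m : M} {j : N →ₗ[ℂ] M} {t : N ⊗[ℂ] H}
    (hm : r m = LinearMap.rTensor H j t) (f : K) :
    extendScalars μ (actThrough A r) (extendScalars μ (actThrough A' r) (m ⊗ₜ f)) =
      ∑ p ∈ terms t, ∑ d ∈ terms (Coalgebra.comul (R := ℂ) p.2),
        extendScalars μ (A d.1) (extendScalars μ (A' d.2) (j p.1 ⊗ₜ f)) := by
  rw [extendScalars_tmul, extendScalars_lTensor_mul hμ, extendScalars_actThrough_comp hr hrA,
    actThrough, LinearMap.comp_apply, hm, map_eq_sum_terms _ t, map_sum, map_sum]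
  refine Finset.sum_congr rfl fun p _ => ?_
  rw [LinearMap.rTensor_tmul, TensorProduct.lift.tmul, LinearMap.flip_apply, LinearMap.comp_apply,
    map_eq_sum_terms _ (Coalgebra.comul (R := ℂ) p.2), LinearMap.sum_apply, map_sum]
  refine Finset.sum_congr rfl fun d _ => ?_
  rw [TensorProduct.lift.tmul, extendScalars_tmul, extendScalars_lTensor_mul hμ]
  rfl

theorem extendScalars_opAt_zero {X : Type*} [AddCommGroup X] [Module ℂ X]
    (Z : H →ₗ[ℂ] V →ₗ[ℂ] V ⊗[ℂ] X) (α : X →ₗ[ℂ] K) (h : H) (a b c : V) (f : K) :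
    extendScalars μ (opAt 0 (mapCoeff Z α h)) (((a ⊗ₜ b) ⊗ₜ c) ⊗ₜ f) =
      ∑ q ∈ terms (Z h a), ((q.1 ⊗ₜ b) ⊗ₜ c) ⊗ₜ μ (α q.2) f := by
  rw [extendScalars_tmul, opAt_zero_mapCoeff, map_sum]
  rfl

theorem extendScalars_opAt_one {X : Type*} [AddCommGroup X] [Module ℂ X]
    (Z : H →ₗ[ℂ] V →ₗ[ℂ] V ⊗[ℂ] X) (α : X →ₗ[ℂ] K) (h : H) (a b c : V) (f : K) :
    extendScalars μ (opAt 1 (mapCoeff Z α h)) (((a ⊗ₜ b) ⊗ₜ c) ⊗ₜ f) =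
      ∑ q ∈ terms (Z h b), ((a ⊗ₜ q.1) ⊗ₜ c) ⊗ₜ μ (α q.2) f := by
  rw [extendScalars_tmul, opAt_one_mapCoeff, map_sum]
  rfl

theorem extendScalars_opAt_two {X : Type*} [AddCommGroup X] [Module ℂ X]
    (Z : H →ₗ[ℂ] V →ₗ[ℂ] V ⊗[ℂ] X) (α : X →ₗ[ℂ] K) (h : H) (a b c : V) (f : K) :
    extendScalars μ (opAt 2 (mapCoeff Z α h)) (((a ⊗ₜ b) ⊗ₜ c) ⊗ₜ f) =
      ∑ q ∈ terms (Z h c), ((a ⊗ₜ b) ⊗ₜ q.1) ⊗ₜ μ (α q.2) f := by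
  rw [extendScalars_tmul, opAt_two_mapCoeff, map_sum]
  rfl

section Generic

variable {X : Type*} [AddCommGroup X] [Module ℂ X] {ρ : V →ₗ[ℂ] V ⊗[ℂ] H}
  {Z : H →ₗ[ℂ] V →ₗ[ℂ] V ⊗[ℂ] X} (α β : X →ₗ[ℂ] K)

/-- Legs from the factor 2 into the factors 0 and 1 split its coaction by the coproduct. This is the
shape of the right side of `act_vertex`. -/
theorem extendScalars_legOp_zero_two_one_two (hμ : IsCommMul μ e) (hr : IsCoaction ρ)
    (hZ : ∀ h, CommOp ρ (Z h)) (a b c : V) (f : K) :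
    extendScalars μ (legOp ρ Z α 0 2) (extendScalars μ (legOp ρ Z β 1 2) (((a ⊗ₜ b) ⊗ₜ c) ⊗ₜ f)) =
      ∑ p ∈ terms (ρ c), ∑ d ∈ terms (Coalgebra.comul (R := ℂ) p.2),
        ∑ q ∈ terms (Z d.1 a), ∑ s ∈ terms (Z d.2 b),
          ((q.1 ⊗ₜ s.1) ⊗ₜ p.1) ⊗ₜ μ (μ (α q.2) (β s.2)) f := by
  rw [legOp, legOp, extendScalars_actThrough_actThrough (A' := opAt 1 ∘ₗ mapCoeff Z β) hμ
    (show IsCoaction (opAt 2 ρ) from hr.opR) (fun k => ((hZ k).symm.lTensor_left β).symm.opAt 2 1)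
      (opAt_two_tmul ρ a b c)]
  refine Finset.sum_congr rfl fun p _ => Finset.sum_congr rfl fun d _ => ?_
  rw [TensorProduct.mk_apply, LinearMap.comp_apply, LinearMap.comp_apply, extendScalars_opAt_one,
    map_sum]
  simp_rw [extendScalars_opAt_zero]
  rw [Finset.sum_comm]
  simp_rw [hμ.assoc]

theorem extendScalars_legOp_one_zero_two_zero (hμ : IsCommMul μ e) (hr : IsCoaction ρ)
    (hZ : ∀ h, CommOp ρ (Z h)) (a b c : V) (f : K) :
    extendScalars μ (legOp ρ Z α 1 0) (extendScalars μ (legOp ρ Z β 2 0) (((a ⊗ₜ b) ⊗ₜ c) ⊗ₜ f)) =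
      ∑ p ∈ terms (ρ a), ∑ d ∈ terms (Coalgebra.comul (R := ℂ) p.2),
        ∑ q ∈ terms (Z d.1 b), ∑ s ∈ terms (Z d.2 c),
          ((p.1 ⊗ₜ q.1) ⊗ₜ s.1) ⊗ₜ μ (μ (α q.2) (β s.2)) f := by
  rw [legOp, legOp, extendScalars_actThrough_actThrough (A' := opAt 2 ∘ₗ mapCoeff Z β) hμ
    (show IsCoaction (opAt 0 ρ) from hr.opL.opL) (fun k => ((hZ k).symm.lTensor_left β).symm.opAt 0
      2) (opAt_zero_tmul ρ a b c)]
  refine Finset.sum_congr rfl fun p _ => Finset.sum_congr rfl fun d _ => ?_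
  rw [LinearMap.comp_apply, LinearMap.comp_apply, LinearMap.comp_apply, LinearMap.flip_apply,
    LinearMap.flip_apply, TensorProduct.mk_apply, TensorProduct.mk_apply, extendScalars_opAt_two,
    map_sum]
  simp_rw [extendScalars_opAt_one]
  rw [Finset.sum_comm]
  simp_rw [hμ.assoc]

end Generic

end Coproduct

/-! ### Moving legs past vertex operators -/

section Intertwiners

variable {V H : Type*} [AddCommGroup V] [Module ℂ V] [AddCommGroup H] [Module ℂ H] [Coalgebra ℂ H]
  {YH : H →ₗ[ℂ] H →ₗ[ℂ] LaurentSeries H} {vacH : H} {Y : V →ₗ[ℂ] V →ₗ[ℂ] LaurentSeries V} {vac : V}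
  {ρ : V →ₗ[ℂ] V ⊗[ℂ] H} {Z : H →ₗ[ℂ] V →ₗ[ℂ] V ⊗[ℂ] LaurentSeries ℂ}
  (α β : LaurentSeries ℂ →ₗ[ℂ] LaurentSeries (LaurentSeries ℂ))

theorem legExt_zero_two_legExt_one_two (hr : IsCoaction ρ) (hZ : ∀ h, CommOp ρ (Z h)) (a b c : V)
    (F : LaurentSeries (LaurentSeries ℂ)) :
    legExt ρ Z α 0 2 (legExt ρ Z β 1 2 (((a ⊗ₜ b) ⊗ₜ c) ⊗ₜ F)) =
      ∑ p ∈ terms (ρ c), ∑ d ∈ terms (Coalgebra.comul (R := ℂ) p.2),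
        ∑ q ∈ terms (Z d.1 a), ∑ s ∈ terms (Z d.2 b),
          ((q.1 ⊗ₜ s.1) ⊗ₜ p.1) ⊗ₜ mulSeries₂ (mulSeries₂ (α q.2) (β s.2)) F := by
  unfold legExt
  have := extendScalars_legOp_zero_two_one_two (K := LaurentSeries (LaurentSeries ℂ)) α β
    isCommMul_mulSeries₂ hr hZ a b c F
  rw [this]

theorem legExt_one_zero_legExt_two_zero (hr : IsCoaction ρ) (hZ : ∀ h, CommOp ρ (Z h)) (a b c : V)
    (F : LaurentSeries (LaurentSeries ℂ)) :
    legExt ρ Z α 1 0 (legExt ρ Z β 2 0 (((a ⊗ₜ b) ⊗ₜ c) ⊗ₜ F)) =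
      ∑ p ∈ terms (ρ a), ∑ d ∈ terms (Coalgebra.comul (R := ℂ) p.2),
        ∑ q ∈ terms (Z d.1 b), ∑ s ∈ terms (Z d.2 c),
          ((p.1 ⊗ₜ q.1) ⊗ₜ s.1) ⊗ₜ mulSeries₂ (mulSeries₂ (α q.2) (β s.2)) F := by
  unfold legExt
  have := extendScalars_legOp_one_zero_two_zero (K := LaurentSeries (LaurentSeries ℂ)) α β
    isCommMul_mulSeries₂ hr hZ a b c F
  rw [this]

theorem laurentMap_action_tensorSeries (hZ : IsModuleNonlocalVertexAlgebra YH vacH Y vac Z)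
    (κ : LaurentSeries ℂ →ₗ[ℂ] LaurentSeries ℂ) (j : V →ₗ[ℂ] V ⊗[ℂ] V) (h : H) (u v : V) :
    laurentMap (LinearMap.rTensor (LaurentSeries ℂ) j ∘ₗ LinearMap.lTensor V κ ∘ₗ Z h) (Y u v) =
      ∑ d ∈ terms (Coalgebra.comul (R := ℂ) h),
        ∑ q ∈ terms (Z d.1 u), ∑ s ∈ terms (Z d.2 v),
          laurentMul (tensorSeries j) (Y q.1 s.1) (laurentMap κ (atSub q.2 * atFst s.2)) := by
  rw [← laurentMap_comp_apply, ← laurentMap_comp_apply, hZ.laurentMap_action]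
  simp_rw [map_sum, laurentMap_laurentMul, laurentMul_laurentMap_right]
  rfl

/-- The leg acts on Y(a, z) b, so `act_vertex` distributes it over a and b with arguments x - z and
x. Replacing x by -x gives -(x + z) and -x. -/
theorem laurentMap_legOp₂_vertexTensorOne (hr : IsCoaction ρ) (hρ : ∀ h, CommOp ρ (Z h))
    (hZ : IsModuleNonlocalVertexAlgebra YH vacH Y vac Z)
    (t : ((V ⊗[ℂ] V) ⊗[ℂ] V) ⊗[ℂ] LaurentSeries (LaurentSeries ℂ)) :
    laurentMap (extendScalars mulSeries (legOp₂ ρ Z negVar 0 1)) (vertexTensorOne Y t) =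
      vertexTensorOne Y
        (legExt ρ Z (atAdd ∘ₗ negVar) 0 2 (legExt ρ Z (atFst ∘ₗ negVar) 1 2 t)) := by
  refine triple_ext (P := LaurentSeries ((V ⊗[ℂ] V) ⊗[ℂ] LaurentSeries ℂ))
    (φ := laurentMap (extendScalars mulSeries (legOp₂ ρ Z negVar 0 1)) ∘ₗ vertexTensorOne Y)
    (ψ := vertexTensorOne Y ∘ₗ legExt ρ Z (atAdd ∘ₗ negVar) 0 2 ∘ₗ
      legExt ρ Z (atFst ∘ₗ negVar) 1 2) (fun a b c F => ?_) t
  rw [LinearMap.comp_apply, LinearMap.comp_apply, LinearMap.comp_apply,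
    legExt_zero_two_legExt_one_two _ _ hr hρ, vertexTensorOne_tmul,
    laurentMap_extendScalars_tensorSeries]
  have e : legOp₂ ρ Z negVar 0 1 ∘ₗ (TensorProduct.mk ℂ V V).flip c = ∑ p ∈ terms (ρ c),
      LinearMap.rTensor (LaurentSeries ℂ) ((TensorProduct.mk ℂ V V).flip p.1) ∘ₗ
        LinearMap.lTensor V negVar ∘ₗ Z p.2 := by
    ext1 a
    rw [LinearMap.sum_apply]
    exact legOp₂_zero_one ρ Z negVar a c
  have e' : laurentMap (∑ p ∈ terms (ρ c),
      LinearMap.rTensor (LaurentSeries ℂ) ((TensorProduct.mk ℂ V V).flip p.1) ∘ₗ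
        LinearMap.lTensor V negVar ∘ₗ Z p.2) = ∑ p ∈ terms (ρ c), laurentMap (
      LinearMap.rTensor (LaurentSeries ℂ) ((TensorProduct.mk ℂ V V).flip p.1) ∘ₗ
        LinearMap.lTensor V negVar ∘ₗ Z p.2) := map_sum laurentMapₗ _ _
  rw [e, e', LinearMap.sum_apply]
  simp_rw [laurentMap_action_tensorSeries hZ, map_sum, LinearMap.sum_apply, vertexTensorOne_tmul,
    laurentMul_scaleSeries, laurentMap_negVar_mul, laurentMap_negVar_atSub, laurentMap_negVar_atFst,
    mulSeries₂_eq]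
  rfl

/-- The coaction of the first vector acts on Y(b, x₂) c at x₁; by `act_vertex` it acts on b at x₁ -
x₂ and on c at x₁. -/
theorem laurentMap_legOp₂_oneTensorVertex (hr : IsCoaction ρ) (hρ : ∀ h, CommOp ρ (Z h))
    (hZ : IsModuleNonlocalVertexAlgebra YH vacH Y vac Z)
    (t : ((V ⊗[ℂ] V) ⊗[ℂ] V) ⊗[ℂ] LaurentSeries (LaurentSeries ℂ)) :
    laurentMap (extendScalars mulSeries (legOp₂ ρ Z LinearMap.id 1 0)) (oneTensorVertex Y t) =
      oneTensorVertex Y (legExt ρ Z atSub 1 0 (legExt ρ Z atFst 2 0 t)) := by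
  refine triple_ext (P := LaurentSeries ((V ⊗[ℂ] V) ⊗[ℂ] LaurentSeries ℂ))
    (φ := laurentMap (extendScalars mulSeries (legOp₂ ρ Z LinearMap.id 1 0)) ∘ₗ oneTensorVertex Y)
    (ψ := oneTensorVertex Y ∘ₗ legExt ρ Z atSub 1 0 ∘ₗ legExt ρ Z atFst 2 0)
    (fun a b c F => ?_) t
  rw [LinearMap.comp_apply, LinearMap.comp_apply, LinearMap.comp_apply,
    legExt_one_zero_legExt_two_zero _ _ hr hρ, oneTensorVertex_tmul,
    laurentMap_extendScalars_tensorSeries]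
  have e : legOp₂ ρ Z LinearMap.id 1 0 ∘ₗ TensorProduct.mk ℂ V V a = ∑ p ∈ terms (ρ a),
      LinearMap.rTensor (LaurentSeries ℂ) (TensorProduct.mk ℂ V V p.1) ∘ₗ
        LinearMap.lTensor V LinearMap.id ∘ₗ Z p.2 := by
    ext1 b
    rw [LinearMap.sum_apply]
    exact legOp₂_one_zero ρ Z LinearMap.id a b
  have e' : laurentMap (∑ p ∈ terms (ρ a),
      LinearMap.rTensor (LaurentSeries ℂ) (TensorProduct.mk ℂ V V p.1) ∘ₗ
        LinearMap.lTensor V LinearMap.id ∘ₗ Z p.2) = ∑ p ∈ terms (ρ a), laurentMap (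
      LinearMap.rTensor (LaurentSeries ℂ) (TensorProduct.mk ℂ V V p.1) ∘ₗ
        LinearMap.lTensor V LinearMap.id ∘ₗ Z p.2) := map_sum laurentMapₗ _ _
  rw [e, e', LinearMap.sum_apply]
  simp_rw [laurentMap_action_tensorSeries hZ, map_sum, LinearMap.sum_apply, oneTensorVertex_tmul,
    laurentMul_scaleSeries, laurentMap_id, mulSeries₂_eq]

/-- Here the coaction is applied to Y(a, z) b. Since ρ is a homomorphism, its `H`-part is Y(h, z) k,
and this acts at x as Z(h, x + z) Z(k, x). -/
theorem laurentMap_legOp₂_vertexTensorOne'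
    (h : IsHom Y vac (tensorVertex Y YH) (vac ⊗ₜ[ℂ] vacH) ρ)
    (hZ : ∀ h k, Associative YH (Z.compr₂ toLaurent) h k)
    (t : ((V ⊗[ℂ] V) ⊗[ℂ] V) ⊗[ℂ] LaurentSeries (LaurentSeries ℂ)) :
    laurentMap (extendScalars mulSeries (legOp₂ ρ Z LinearMap.id 1 0)) (vertexTensorOne Y t) =
      vertexTensorOne Y (legExt ρ Z atAdd 2 0 (legExt ρ Z atFst 2 1 t)) := by
  refine triple_ext (P := LaurentSeries ((V ⊗[ℂ] V) ⊗[ℂ] LaurentSeries ℂ))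
    (φ := laurentMap (extendScalars mulSeries (legOp₂ ρ Z LinearMap.id 1 0)) ∘ₗ vertexTensorOne Y)
    (ψ := vertexTensorOne Y ∘ₗ legExt ρ Z atAdd 2 0 ∘ₗ legExt ρ Z atFst 2 1)
    (fun a b c F => ?_) t
  rw [LinearMap.comp_apply, LinearMap.comp_apply, LinearMap.comp_apply, vertexTensorOne_tmul,
    laurentMap_extendScalars_tensorSeries, legExt_two_one]
  let γ : V →ₗ[ℂ] V ⊗[ℂ] LaurentSeries ℂ →ₗ[ℂ] (V ⊗[ℂ] V) ⊗[ℂ] LaurentSeries ℂ :=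
    LinearMap.rTensorHom (LaurentSeries ℂ) ∘ₗ TensorProduct.mk ℂ V V
  have e : legOp₂ ρ Z LinearMap.id 1 0 ∘ₗ (TensorProduct.mk ℂ V V).flip c =
      TensorProduct.lift (γ.compl₂ (Z.flip c)) ∘ₗ ρ := by
    ext1 a
    rw [LinearMap.comp_apply, LinearMap.comp_apply, map_eq_sum_terms _ (ρ a)]
    refine (legOp₂_one_zero ρ Z LinearMap.id a c).trans (Finset.sum_congr rfl fun p _ => ?_)
    rw [LinearMap.lTensor_id]
    rfl
  have e2 : ∀ p r : V × H, laurentMap (TensorProduct.lift (γ.compl₂ (Z.flip c)))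
      (laurentMul (TensorProduct.mk ℂ V H) (Y p.1 r.1) (YH p.2 r.2)) =
        ∑ s ∈ terms (Z r.2 c), ∑ q ∈ terms (Z p.2 s.1),
          laurentMul (tensorSeries ((TensorProduct.mk ℂ V V).flip q.1)) (Y p.1 r.1)
            (atAdd q.2 * atFst s.2) := by
    intro p r
    -- The `H`-part of the product enters only through its action on c, so `laurentMap_flip_action`
    -- can be applied to that factor alone.
    have e3 : (TensorProduct.mk ℂ V H).compr₂ (TensorProduct.lift (γ.compl₂ (Z.flip c))) =
        γ.compl₂ (Z.flip c) := rfl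
    rw [laurentMap_laurentMul, e3, ← laurentMul_laurentMap_right, laurentMap_flip_action hZ]
    simp_rw [map_sum, laurentMul_laurentMap_right]
    rfl
  rw [e, ← laurentMap_comp_apply, h.laurentMap_eq_sum]
  simp_rw [map_sum, legExt_two_zero, e2, map_sum, LinearMap.sum_apply, vertexTensorOne_tmul,
    laurentMul_scaleSeries]
  rw [Finset.sum_comm]
  refine Finset.sum_congr rfl fun r _ => ?_
  rw [Finset.sum_comm]
  refine Finset.sum_congr rfl fun s _ => Finset.sum_congr rfl fun p _ =>
    Finset.sum_congr rfl fun q _ => ?_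
  rw [← mulSeries₂_eq, isCommMul_mulSeries₂.assoc]

end Intertwiners


/-! ### Commutation of extended legs -/

section LegCommutation

variable {V H : Type*} [AddCommGroup V] [Module ℂ V] [AddCommGroup H] [Module ℂ H]
  {ρ : V →ₗ[ℂ] V ⊗[ℂ] H} {Z Z' : H →ₗ[ℂ] V →ₗ[ℂ] V ⊗[ℂ] LaurentSeries ℂ}

namespace Compatible

variable (hc : Compatible ρ Z Z') (α β : LaurentSeries ℂ →ₗ[ℂ] LaurentSeries (LaurentSeries ℂ))
  (i j k l : Fin 3) (t : ((V ⊗[ℂ] V) ⊗[ℂ] V) ⊗[ℂ] LaurentSeries (LaurentSeries ℂ))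
include hc

theorem legExt_left_left : legExt ρ Z α i j (legExt ρ Z β k l t) =
    legExt ρ Z β k l (legExt ρ Z α i j t) := by
  have := CommOp.extendScalars (K := LaurentSeries (LaurentSeries ℂ)) isCommMul_mulSeries₂
    (hc.legOp_left_left (K := LaurentSeries (LaurentSeries ℂ))
      (K' := LaurentSeries (LaurentSeries ℂ)) α β i j k l) t
  unfold legExt
  rw [this]

theorem legExt_left_right : legExt ρ Z α i j (legExt ρ Z' β k l t) =
    legExt ρ Z' β k l (legExt ρ Z α i j t) := by
  have := CommOp.extendScalars (K := LaurentSeries (LaurentSeries ℂ)) isCommMul_mulSeries₂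
    (hc.legOp_left_right (K := LaurentSeries (LaurentSeries ℂ))
      (K' := LaurentSeries (LaurentSeries ℂ)) α β i j k l) t
  unfold legExt
  rw [this]

theorem legExt_right_right : legExt ρ Z' α i j (legExt ρ Z' β k l t) =
    legExt ρ Z' β k l (legExt ρ Z' α i j t) := by
  have := CommOp.extendScalars (K := LaurentSeries (LaurentSeries ℂ)) isCommMul_mulSeries₂
    (hc.legOp_right_right (K := LaurentSeries (LaurentSeries ℂ))
      (K' := LaurentSeries (LaurentSeries ℂ)) α β i j k l) t
  unfold legExt
  rw [this]

end Compatible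

theorem extendScalars_S23_braiding (hZ' : ∀ h, CommOp ρ (Z' h))
    (φ : LaurentSeries ℂ →ₗ[ℂ] LaurentSeries (LaurentSeries ℂ))
    (hφ : ∀ f g, φ (mulSeries f g) = mulSeries₂ (φ f) (φ g))
    (t : ((V ⊗[ℂ] V) ⊗[ℂ] V) ⊗[ℂ] LaurentSeries (LaurentSeries ℂ)) :
    extendScalars mulSeries₂ (S23 (braiding ρ Z Z') φ) t =
      legExt ρ Z (φ ∘ₗ negVar) 1 2 (legExt ρ Z' φ 2 1 t) := by
  have := S23_braiding (K := LaurentSeries (LaurentSeries ℂ)) isCommMul_mulSeries₂ (Z := Z) hZ' φ hφ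
  rw [this]
  exact extendScalars_comp (K := LaurentSeries (LaurentSeries ℂ)) isCommMul_mulSeries₂ _ _ t

theorem extendScalars_S13_braiding (hZ' : ∀ h, CommOp ρ (Z' h))
    (φ : LaurentSeries ℂ →ₗ[ℂ] LaurentSeries (LaurentSeries ℂ))
    (hφ : ∀ f g, φ (mulSeries f g) = mulSeries₂ (φ f) (φ g))
    (t : ((V ⊗[ℂ] V) ⊗[ℂ] V) ⊗[ℂ] LaurentSeries (LaurentSeries ℂ)) :
    extendScalars mulSeries₂ (S13 (braiding ρ Z Z') φ) t =
      legExt ρ Z (φ ∘ₗ negVar) 0 2 (legExt ρ Z' φ 2 0 t) := by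
  have := S13_braiding (K := LaurentSeries (LaurentSeries ℂ)) isCommMul_mulSeries₂ (Z := Z) hZ' φ hφ
  rw [this]
  exact extendScalars_comp (K := LaurentSeries (LaurentSeries ℂ)) isCommMul_mulSeries₂ _ _ t

theorem laurentMul_scaleSeries_one {B : Type*} [AddCommGroup B] [Module ℂ B]
    (a : LaurentSeries (B ⊗[ℂ] LaurentSeries ℂ)) :
    laurentMul (scaleSeries B) a (1 : LaurentSeries (LaurentSeries ℂ)) = a := by
  have e : (scaleSeries B).flip 1 = LinearMap.id := by
    ext b f
    change b ⊗ₜ[ℂ] mulSeries f 1 = b ⊗ₜ[ℂ] f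
    rw [isCommMul_mulSeries.mul_one]
  have := laurentMul_single_zero_right (scaleSeries B) a 1
  rw [e] at this
  exact this

end LegCommutation

/-! ### The hexagon identity -/

section Hexagon

variable {V H : Type*} [AddCommGroup V] [Module ℂ V] [AddCommGroup H] [Module ℂ H] [Coalgebra ℂ H]
  {YH : H →ₗ[ℂ] H →ₗ[ℂ] LaurentSeries H} {vacH : H} {Y : V →ₗ[ℂ] V →ₗ[ℂ] LaurentSeries V} {vac : V}
  {ρ : V →ₗ[ℂ] V ⊗[ℂ] H} {Z Z' : H →ₗ[ℂ] V →ₗ[ℂ] V ⊗[ℂ] LaurentSeries ℂ}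

/-- Both sides are Y(z) ⊗ 1 applied after the same five legs: L_02(Z, -(x + z)), L_12(Z, -x),
L_20(Z', x + z), L_21(Z', x) and L_10(Z, z). Only their order differs. -/
theorem hexagon_deformedVertex (hc : Compatible ρ Z Z')
    (hρ : IsComoduleNonlocalVertexAlgebra YH vacH Y vac ρ)
    (hZ : IsModuleNonlocalVertexAlgebra YH vacH Y vac Z)
    (hZ' : IsModuleNonlocalVertexAlgebra YH vacH Y vac Z') (u v w : V) :
    laurentMap (braiding ρ Z Z' ∘ₗ (TensorProduct.mk ℂ V V).flip w) (deformedVertex Y ρ Z u v) =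
      vertexTensorOne (deformedVertex Y ρ Z) (extendScalars mulSeries₂ (S23 (braiding ρ Z Z') atFst)
        (S13 (braiding ρ Z Z') atAdd ((u ⊗ₜ v) ⊗ₜ w))) := by
  have e1 := extendScalars_one (K := LaurentSeries (LaurentSeries ℂ)) isCommMul_mulSeries₂
    (S13 (K := LaurentSeries (LaurentSeries ℂ)) (braiding ρ Z Z') atAdd) ((u ⊗ₜ v) ⊗ₜ w)
  rw [← e1, extendScalars_S13_braiding hc.right atAdd atAdd_mulSeries,
    extendScalars_S23_braiding hc.right atFst atFst_mulSeries, vertexTensorOne_deformedVertex]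
  have e2 : laurentMap (braiding ρ Z Z' ∘ₗ (TensorProduct.mk ℂ V V).flip w)
      (deformedVertex Y ρ Z u v) = laurentMap (extendScalars mulSeries (braiding ρ Z Z'))
        (vertexTensorOne (deformedVertex Y ρ Z) (((u ⊗ₜ v) ⊗ₜ w) ⊗ₜ 1)) := by
    rw [vertexTensorOne_tmul, laurentMap_extendScalars_tensorSeries, laurentMul_scaleSeries_one]
  have e3 : extendScalars mulSeries (braiding ρ Z Z') =
      extendScalars mulSeries (legOp₂ ρ Z negVar 0 1) ∘ₗ
        extendScalars mulSeries (legOp₂ ρ Z' LinearMap.id 1 0) := by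
    rw [braiding_eq hc.right]
    exact LinearMap.ext fun t => extendScalars_comp isCommMul_mulSeries _ _ t
  rw [e2, e3, ← laurentMap_comp_apply, vertexTensorOne_deformedVertex,
    laurentMap_legOp₂_vertexTensorOne' hρ.hom hZ'.module_associative,
    laurentMap_legOp₂_vertexTensorOne hρ.isCoaction hc.left hZ]
  -- The leg L_10(Z, z) is moved inward past the four legs of the braidings, and those are then
  -- regrouped.
  rw [hc.legExt_left_left atSnd (atFst ∘ₗ negVar) 1 0 1 2, hc.legExt_left_right atSnd atFst 1 0 2 1,
    hc.legExt_left_left atSnd (atAdd ∘ₗ negVar) 1 0 0 2, hc.legExt_left_right atSnd atAdd 1 0 2 0,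
    ← hc.legExt_left_right (atAdd ∘ₗ negVar) atFst 0 2 2 1,
    hc.legExt_left_left (atFst ∘ₗ negVar) (atAdd ∘ₗ negVar) 1 2 0 2,
    hc.legExt_right_right atFst atAdd 2 1 2 0]

end Hexagon


/-! ### Vacuum and creation properties of the deformed map -/

section Creation

variable {V H : Type*} [AddCommGroup V] [Module ℂ V] [AddCommGroup H] [Module ℂ H] [Coalgebra ℂ H]
  {YH : H →ₗ[ℂ] H →ₗ[ℂ] LaurentSeries H} {vacH : H} {Y : V →ₗ[ℂ] V →ₗ[ℂ] LaurentSeries V} {vac : V}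
  {ρ : V →ₗ[ℂ] V ⊗[ℂ] H} {Z Z' : H →ₗ[ℂ] V →ₗ[ℂ] V ⊗[ℂ] LaurentSeries ℂ}

theorem IsComoduleNonlocalVertexAlgebra.sum_counit
    (h : IsComoduleNonlocalVertexAlgebra YH vacH Y vac ρ) (v : V) :
    ∑ p ∈ terms (ρ v), Coalgebra.counit (R := ℂ) p.2 • p.1 = v := by
  have e := h.isCoaction.counit v
  conv_rhs => rw [← e]
  change _ = ((TensorProduct.rid ℂ V).toLinearMap ∘ₗ LinearMap.lTensor V Coalgebra.counit) (ρ v)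
  rw [map_eq_sum_terms]
  refine Finset.sum_congr rfl fun p _ => ?_
  simp

/-- On the vacuum Z(h) is the scalar ε(h), and the counit axiom undoes the coaction. Thus the
creation property and the translation operator survive the deformation unchanged. -/
theorem deformedVertex_vac (hρ : IsComoduleNonlocalVertexAlgebra YH vacH Y vac ρ)
    (hZ : IsModuleNonlocalVertexAlgebra YH vacH Y vac Z) (v : V) :
    deformedVertex Y ρ Z v vac = Y v vac := by
  rw [deformedVertex, LinearMap.comp_apply, map_eq_sum_terms, LinearMap.sum_apply]
  conv_rhs => rw [← hρ.sum_counit v]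
  rw [map_sum, LinearMap.sum_apply]
  refine Finset.sum_congr rfl fun p _ => ?_
  change extendField (Y p.1) (Z p.2 vac) = _
  rw [hZ.act_vacuum]
  change mulScalar (Y p.1 (Coalgebra.counit (R := ℂ) p.2 • vac)) 1 = _
  rw [mulScalar_one, map_smul, map_smul, LinearMap.smul_apply]

theorem deformedVertex_vacuum (hY : ∀ v, Y vac v = HahnSeries.single 0 v)
    (hρ : IsHom Y vac (tensorVertex Y YH) (vac ⊗ₜ[ℂ] vacH) ρ)
    (hZ : ∀ v, Z vacH v = v ⊗ₜ 1) (v : V) :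
    deformedVertex Y ρ Z vac v = HahnSeries.single 0 v := by
  rw [deformedVertex, LinearMap.comp_apply, hρ.map_vac]
  change extendField (Y vac) (Z vacH v) = _
  rw [hZ]
  change mulScalar (Y vac v) 1 = _
  rw [mulScalar_one, hY]

theorem translation_deformedVertex (hρ : IsComoduleNonlocalVertexAlgebra YH vacH Y vac ρ)
    (hZ : IsModuleNonlocalVertexAlgebra YH vacH Y vac Z) :
    translation (deformedVertex Y ρ Z) vac = translation Y vac := by
  ext v
  change (deformedVertex Y ρ Z v vac).coeff 1 = (Y v vac).coeff 1
  rw [deformedVertex_vac hρ hZ]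

end Creation

/-! ### Translation operators against the coaction and the action -/

section Translation

variable {V H : Type*} [AddCommGroup V] [Module ℂ V] [AddCommGroup H] [Module ℂ H]
  {YH : H →ₗ[ℂ] H →ₗ[ℂ] LaurentSeries H} {vacH : H} {Y : V →ₗ[ℂ] V →ₗ[ℂ] LaurentSeries V} {vac : V}
  {ρ : V →ₗ[ℂ] V ⊗[ℂ] H} {Z Z' : H →ₗ[ℂ] V →ₗ[ℂ] V ⊗[ℂ] LaurentSeries ℂ}

/-- Y(a, x) 1 begins with a + x 𝒟a, and `b` has no negative powers, so exactly two terms reach the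
linear coefficient. -/
theorem IsNonlocalVertexAlgebra.laurentMul_coeff_one {B C : Type*} [AddCommGroup B] [Module ℂ B]
    [AddCommGroup C] [Module ℂ C] (hV : IsNonlocalVertexAlgebra Y vac) (β : V →ₗ[ℂ] B →ₗ[ℂ] C)
    (a : V) (b : LaurentSeries B) (hb : ∀ n < 0, b.coeff n = 0) :
    (laurentMul β (Y a vac) b).coeff 1 = β (translation Y vac a) (b.coeff 0) + β a (b.coeff 1) := by
  rw [laurentMul_coeff_Icc β _ _ 1 (hV.creation_regular a) hb (lo := 0) (hi := 1) le_rfl (by simp)]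
  have : Finset.Icc (0 : ℤ) 1 = {0, 1} := by decide
  rw [this, Finset.sum_pair (by decide), sub_self, hV.creation_limit]
  rfl

/-- The coaction intertwines the translation operators. -/
theorem coaction_translation (hV : IsNonlocalVertexAlgebra Y vac)
    (hH : IsNonlocalVertexAlgebra YH vacH)
    (hρ : IsHom Y vac (tensorVertex Y YH) (vac ⊗ₜ[ℂ] vacH) ρ) (v : V) :
    ρ (translation Y vac v) = LinearMap.rTensor H (translation Y vac) (ρ v) +
      LinearMap.lTensor V (translation YH vacH) (ρ v) := by
  -- In the linear coefficient of ρ(Y(v, x) 1), each tensor factor contributes its own translation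
  -- operator.
  have e := congrArg (fun a => a.coeff 1) (hρ.map_vertex v vac)
  rw [hρ.map_vac] at e
  refine Eq.trans (show _ = (laurentMap ρ (Y v vac)).coeff 1 from rfl) (e.trans ?_)
  change (tensorVertex Y YH (ρ v) (vac ⊗ₜ vacH)).coeff 1 = _
  induction ρ v with
  | zero => simp
  | add x y hx hy =>
    rw [map_add, LinearMap.add_apply, HahnSeries.coeff_add, hx, hy, map_add, map_add]
    abel
  | tmul a h =>
    change (laurentMul (TensorProduct.mk ℂ V H) (Y a vac) (YH h vacH)).coeff 1 = _
    rw [hV.laurentMul_coeff_one _ _ _ (hH.creation_regular h), hH.creation_limit]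
    rfl

theorem atSub_coeff_of_neg (f : LaurentSeries ℂ) {n : ℤ} (hn : n < 0) : (atSub f).coeff n = 0 :=
  taylor_coeff_of_neg _ _ hn

theorem taylor_coeff_zero (c : ℂ) (f : LaurentSeries ℂ) : (taylor c f).coeff 0 = f := by
  have := taylor_coeff_of_nonneg c f 0
  simpa using this

theorem taylor_coeff_one (c : ℂ) (f : LaurentSeries ℂ) :
    (taylor c f).coeff 1 = c • LaurentSeries.derivative ℂ f := by
  have := taylor_coeff_of_nonneg c f 1
  rw [LaurentSeries.derivative_apply]
  simpa using this

/-- The operators of a module are compatible with the translation operator of `V`. -/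
theorem action_translation [Coalgebra ℂ H] (hV : IsNonlocalVertexAlgebra Y vac)
    (hZ : IsModuleNonlocalVertexAlgebra YH vacH Y vac Z) (h : H) (v : V) :
    Z h (translation Y vac v) = LinearMap.rTensor _ (translation Y vac) (Z h v) -
      LinearMap.lTensor V (LaurentSeries.derivative ℂ) (Z h v) := by
  apply toLaurent_injective
  -- Because h₍₂₎ acts on the vacuum by its counit, the sum over the coproduct collapses to a single
  -- term in h.
  have e1 : ∀ c : H ⊗[ℂ] H,
      TensorProduct.lift ((twistedAction Y).compl₁₂ (Z.flip v) (Z.flip vac)) c =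
        twistedAction Y (Z (TensorProduct.rid ℂ H
          (LinearMap.lTensor H (Coalgebra.counit (R := ℂ)) c)) v) (vac ⊗ₜ 1) := by
    intro c
    induction c with
    | zero => simp
    | add x y hx hy => simp only [map_add, LinearMap.add_apply, hx, hy]
    | tmul h k =>
      rw [TensorProduct.lift.tmul, LinearMap.compl₁₂_apply, LinearMap.flip_apply,
        LinearMap.flip_apply, hZ.act_vacuum, LinearMap.lTensor_tmul, TensorProduct.rid_tmul,
        map_smul, LinearMap.smul_apply, map_smul, LinearMap.smul_apply,
        ← TensorProduct.smul_tmul', map_smul]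
  have e2 := hZ.act_vertex h v vac
  rw [e1, Coalgebra.lTensor_counit_comul, TensorProduct.rid_tmul, one_smul] at e2
  -- The linear coefficient in x₂ of Y(Z(h, x₁ - x₂) v, x₂) 1: the creation series gives the
  -- translation operator, and the argument x₁ - x₂ gives minus the derivative.
  have e3 := congrArg (fun a => a.coeff 1) e2
  refine Eq.trans (show _ = (laurentMap (toLaurent ∘ₗ Z h) (Y v vac)).coeff 1 from rfl)
    (e3.trans ?_)
  change (twistedAction Y (Z h v) (vac ⊗ₜ 1)).coeff 1 = _
  induction Z h v with
  | zero => simp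
  | add x y hx hy =>
    rw [map_add, LinearMap.add_apply, HahnSeries.coeff_add, hx, hy, ← map_add]
    congr 1
    rw [map_add, map_add]
    abel
  | tmul a f =>
    change (laurentMul vecMulSeries (Y a vac) (mulSeries₂ (atSub f) 1)).coeff 1 = _
    rw [isCommMul_mulSeries₂.mul_one, hV.laurentMul_coeff_one _ _ _
      (fun n hn => atSub_coeff_of_neg f hn)]
    unfold atSub
    rw [taylor_coeff_zero, taylor_coeff_one, LinearMap.rTensor_tmul, LinearMap.lTensor_tmul,
      map_sub, toLaurent_tmul, toLaurent_tmul, map_smul, neg_one_smul, sub_eq_add_neg]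

/-- The operators of a module are compatible with the translation operator of `H`. -/
theorem translation_action (hZ : ∀ h k, Associative YH (Z.compr₂ toLaurent) h k)
    (hZ1 : ∀ v, Z vacH v = v ⊗ₜ 1)
    (h : H) (v : V) :
    Z (translation YH vacH h) v = LinearMap.lTensor V (LaurentSeries.derivative ℂ) (Z h v) := by
  -- The linear coefficient in x₀ of Z(Y(h, x₀) 1, x) v = Z(h, x + x₀) Z(1, x) v.
  have e := congrArg (fun a => a.coeff 1) (laurentMap_flip_action hZ h vacH v)
  refine Eq.trans (show _ = (laurentMap (Z.flip v) (YH h vacH)).coeff 1 from rfl) (e.trans ?_)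
  have e1 : ∀ p q : V × LaurentSeries ℂ,
      (laurentMap (TensorProduct.mk ℂ V (LaurentSeries ℂ) q.1) (atAdd q.2 * atFst p.2)).coeff 1 =
        q.1 ⊗ₜ mulSeries (LaurentSeries.derivative ℂ q.2) p.2 := by
    intro p q
    rw [← mulSeries₂_eq, laurentMap_coeff]
    change _ ⊗ₜ (mulScalar₂ (atAdd q.2) (atFst p.2)).coeff 1 = _
    rw [mulScalar₂_atFst, laurentMap_coeff, atAdd, taylor_coeff_one, one_smul]
    rfl
  have e2 := extendScalars_one isCommMul_mulSeries
    (LinearMap.lTensor V (LaurentSeries.derivative ℂ) ∘ₗ Z h) v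
  rw [← hZ1, map_eq_sum_terms] at e2
  refine Eq.trans ?_ e2
  simp only [HahnSeries.coeff_sum, e1]
  refine Finset.sum_congr rfl fun p _ => ?_
  rw [extendScalars_tmul, ← LinearMap.comp_apply, ← LinearMap.comp_assoc, LinearMap.comp_apply,
    map_eq_sum_terms _ (Z h p.1)]
  rfl

end Translation

/-! ### The shift axiom -/

section Shift

variable {V H : Type*} [AddCommGroup V] [Module ℂ V] [AddCommGroup H] [Module ℂ H] [Coalgebra ℂ H]
  {YH : H →ₗ[ℂ] H →ₗ[ℂ] LaurentSeries H} {vacH : H} {Y : V →ₗ[ℂ] V →ₗ[ℂ] LaurentSeries V} {vac : V}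
  {ρ : V →ₗ[ℂ] V ⊗[ℂ] H} {Z Z' : H →ₗ[ℂ] V →ₗ[ℂ] V ⊗[ℂ] LaurentSeries ℂ}

theorem lTensor_derivative_tensorProductSeries (s t : V ⊗[ℂ] LaurentSeries ℂ) :
    LinearMap.lTensor (V ⊗[ℂ] V) (LaurentSeries.derivative ℂ) (tensorProductSeries s t) =
      tensorProductSeries (LinearMap.lTensor V (LaurentSeries.derivative ℂ) s) t +
        tensorProductSeries s (LinearMap.lTensor V (LaurentSeries.derivative ℂ) t) := by
  induction s with
  | zero => simp
  | add x y hx hy => simp only [map_add, LinearMap.add_apply, hx, hy]; abel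
  | tmul a f =>
    induction t with
    | zero => simp
    | add x y hx hy => simp only [map_add, hx, hy]; abel
    | tmul b g =>
      change (a ⊗ₜ b) ⊗ₜ LaurentSeries.derivative ℂ (mulSeries f g) =
        (a ⊗ₜ b) ⊗ₜ mulSeries (LaurentSeries.derivative ℂ f) g +
          (a ⊗ₜ[ℂ] b) ⊗ₜ[ℂ] mulSeries f (LaurentSeries.derivative ℂ g)
      rw [mulSeries_eq, mulSeries_eq, mulSeries_eq, derivative_mul, TensorProduct.tmul_add]

theorem rTensor_tensorProductSeries (d : V →ₗ[ℂ] V) (s t : V ⊗[ℂ] LaurentSeries ℂ) :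
    LinearMap.rTensor (LaurentSeries ℂ) (LinearMap.rTensor V d) (tensorProductSeries s t) =
      tensorProductSeries (LinearMap.rTensor (LaurentSeries ℂ) d s) t := by
  induction s with
  | zero => simp
  | add x y hx hy => simp only [map_add, LinearMap.add_apply, hx, hy]
  | tmul a f =>
    induction t with
    | zero => simp
    | add x y hx hy => simp only [map_add, hx, hy]
    | tmul b g => rfl

theorem braiding_eq_sum (v u : V) : braiding ρ Z Z' (v ⊗ₜ u) = ∑ p ∈ terms (ρ v), ∑ q ∈ terms (ρ u),
    tensorProductSeries (LinearMap.lTensor V negVar (Z q.2 p.1)) (Z' p.2 q.1) := by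
  conv_lhs => 
    simp only [braiding, LinearMap.comp_apply, TensorProduct.map_tmul]
    rw [← sum_terms (ρ v), ← sum_terms (ρ u)]
    simp only [map_sum,
      LinearEquiv.coe_coe, TensorProduct.sum_tmul, TensorProduct.tmul_sum,
      TensorProduct.comm_tmul, TensorProduct.tensorTensorTensorComm_tmul,
      TensorProduct.congr_tmul, LinearEquiv.refl_apply, TensorProduct.lift.tmul, 
      TensorProduct.map_tmul, LinearMap.comp_apply,
      LinearMap.flip_apply]
  rw [Finset.sum_comm]

/-- By the product rule the derivative of S has two terms. The one from Z(·, -x) is the commutator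
of 𝒟 with Z, with a sign from -x; the one from Z' comes from 𝒟 on the `H`-part of ρ(𝒟 v). -/
theorem shift_braiding (hV : IsNonlocalVertexAlgebra Y vac) (hH : IsNonlocalVertexAlgebra YH vacH)
    (hρ : IsHom Y vac (tensorVertex Y YH) (vac ⊗ₜ[ℂ] vacH) ρ)
    (hZ : IsModuleNonlocalVertexAlgebra YH vacH Y vac Z)
    (hZ' : IsModuleNonlocalVertexAlgebra YH vacH Y vac Z') (t : V ⊗[ℂ] V) :
    LinearMap.rTensor (LaurentSeries ℂ) (LinearMap.rTensor V (translation Y vac))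
        (braiding ρ Z Z' t) - braiding ρ Z Z' (LinearMap.rTensor V (translation Y vac) t) =
      - LinearMap.lTensor (V ⊗[ℂ] V) (LaurentSeries.derivative ℂ) (braiding ρ Z Z' t) := by
  induction t with
  | zero => simp
  | add x y hx hy =>
    simp only [map_add, neg_add]
    rw [← hx, ← hy]
    abel
  | tmul v u =>
    -- For a fixed term of ρ(u), the braiding is linear in ρ(v). The identity can therefore be
    -- proved for an arbitrary tensor in place of ρ(v), hence on pure tensors.
    let b : V × H → (V ⊗[ℂ] H →ₗ[ℂ] (V ⊗[ℂ] V) ⊗[ℂ] LaurentSeries ℂ) := fun q =>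
      TensorProduct.lift (tensorProductSeries.compl₁₂ (LinearMap.lTensor V negVar ∘ₗ Z q.2)
        (Z'.flip q.1))
    have e1 : ∀ v', braiding ρ Z Z' (v' ⊗ₜ u) = ∑ q ∈ terms (ρ u), b q (ρ v') := by
      intro v'
      rw [braiding_eq_sum, Finset.sum_comm]
      refine Finset.sum_congr rfl fun q _ => ?_
      rw [map_eq_sum_terms (b q)]
      rfl
    have e2 : ∀ s : V ⊗[ℂ] LaurentSeries ℂ,
        LinearMap.lTensor V (LaurentSeries.derivative ℂ) (LinearMap.lTensor V negVar s) =
          - LinearMap.lTensor V negVar (LinearMap.lTensor V (LaurentSeries.derivative ℂ) s) := by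
      intro s
      induction s with
      | zero => simp
      | add x y hx hy => simp only [map_add, hx, hy, neg_add]
      | tmul a f =>
        simp only [LinearMap.lTensor_tmul, derivative_negVar, TensorProduct.tmul_neg]
    have e3 : ∀ s : V ⊗[ℂ] LaurentSeries ℂ,
        LinearMap.rTensor _ (translation Y vac) (LinearMap.lTensor V negVar s) =
          LinearMap.lTensor V negVar (LinearMap.rTensor _ (translation Y vac) s) := fun s =>
      LinearMap.congr_fun ((LinearMap.rTensor_comp_lTensor ..).trans
        (LinearMap.lTensor_comp_rTensor ..).symm) s
    have key : ∀ (q : V × H) (s : V ⊗[ℂ] H),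
        LinearMap.rTensor (LaurentSeries ℂ) (LinearMap.rTensor V (translation Y vac)) (b q s) -
          b q (LinearMap.rTensor H (translation Y vac) s +
            LinearMap.lTensor V (translation YH vacH) s) =
        - LinearMap.lTensor (V ⊗[ℂ] V) (LaurentSeries.derivative ℂ) (b q s) := by
      intro q s
      induction s with
      | zero => simp
      | add x y hx hy =>
        simp only [map_add, neg_add] at hx hy ⊢
        rw [← hx, ← hy]
        abel
      | tmul a h =>
        have e : ∀ a h, b q (a ⊗ₜ h) =
            tensorProductSeries (LinearMap.lTensor V negVar (Z q.2 a)) (Z' h q.1) := fun _ _ => rfl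
        rw [map_add, LinearMap.rTensor_tmul, LinearMap.lTensor_tmul, e, e, e,
          action_translation hV hZ, translation_action hZ'.module_associative hZ'.module_vacuum,
          rTensor_tensorProductSeries, lTensor_derivative_tensorProductSeries, e2, e3, map_sub,
          map_sub, LinearMap.sub_apply, map_neg, LinearMap.neg_apply]
        abel
    rw [LinearMap.rTensor_tmul, e1, e1, coaction_translation hV hH hρ, map_sum, map_sum,
      ← Finset.sum_sub_distrib, ← Finset.sum_neg_distrib]
    exact Finset.sum_congr rfl fun q _ => key q (ρ v)

end Shift


/-! ### Stability of series relations under legs, with uniform order -/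

section Relations

variable {V H : Type*} [AddCommGroup V] [Module ℂ V] [AddCommGroup H] [Module ℂ H]

variable {R : ℕ → LaurentSeries (LaurentSeries V) → LaurentSeries (LaurentSeries V) → Prop}

/-- The index set does not depend on w, so the largest of finitely many orders serves every w. -/
theorem IsSeriesRelation.exists_sum (hR : IsSeriesRelation R) {ι W : Type*} (s : Finset ι)
    {F G : ι → W → LaurentSeries (LaurentSeries V)} (h : ∀ i ∈ s, ∃ k, ∀ w, R k (F i w) (G i w)) :
    ∃ k, ∀ w, R k (∑ i ∈ s, F i w) (∑ i ∈ s, G i w) := by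
  classical
  choose! k hk using h
  exact ⟨s.sup k, fun w => hR.sum s fun i hi => hR.mono (hk i hi w) (Finset.le_sup hi)⟩

variable {ρ : V →ₗ[ℂ] V ⊗[ℂ] H} {Z : H →ₗ[ℂ] V →ₗ[ℂ] V ⊗[ℂ] LaurentSeries ℂ}
  {Φ Ψ : ((V ⊗[ℂ] V) ⊗[ℂ] V) ⊗[ℂ] LaurentSeries (LaurentSeries ℂ) →ₗ[ℂ]
    LaurentSeries (LaurentSeries V)}
  {α α' β β' γ γ' : LaurentSeries ℂ →ₗ[ℂ] LaurentSeries (LaurentSeries ℂ)}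

/-- Relations are preserved when the third vector is acted upon, with a uniform parameter. -/
theorem IsSeriesRelation.legExt_two (hR : IsSeriesRelation R)
    (hα : ∀ f k t F G, R k (Φ (t ⊗ₜ F)) (Ψ (t ⊗ₜ G)) →
      R k (Φ (t ⊗ₜ mulSeries₂ (α f) F)) (Ψ (t ⊗ₜ mulSeries₂ (α' f) G)))
    (hβ : ∀ f k t F G, R k (Φ (t ⊗ₜ F)) (Ψ (t ⊗ₜ G)) →
      R k (Φ (t ⊗ₜ mulSeries₂ (β f) F)) (Ψ (t ⊗ₜ mulSeries₂ (β' f) G)))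
    {F G : LaurentSeries (LaurentSeries ℂ)}
    (h : ∀ a b, ∃ k, ∀ c, R k (Φ (((a ⊗ₜ b) ⊗ₜ c) ⊗ₜ F)) (Ψ (((a ⊗ₜ b) ⊗ₜ c) ⊗ₜ G))) (a b : V) :
    ∃ k, ∀ c, R k (Φ (legExt ρ Z α 2 0 (legExt ρ Z β 2 1 (((a ⊗ₜ b) ⊗ₜ c) ⊗ₜ F))))
      (Ψ (legExt ρ Z α' 2 0 (legExt ρ Z β' 2 1 (((a ⊗ₜ b) ⊗ₜ c) ⊗ₜ G)))) := by
  have e : ∀ (Θ : ((V ⊗[ℂ] V) ⊗[ℂ] V) ⊗[ℂ] LaurentSeries (LaurentSeries ℂ) →ₗ[ℂ]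
      LaurentSeries (LaurentSeries V)) (α β : LaurentSeries ℂ →ₗ[ℂ] LaurentSeries (LaurentSeries ℂ))
      (c : V) (F : LaurentSeries (LaurentSeries ℂ)),
      Θ (legExt ρ Z α 2 0 (legExt ρ Z β 2 1 (((a ⊗ₜ b) ⊗ₜ c) ⊗ₜ F))) =
        ∑ r ∈ terms (ρ b), ∑ p ∈ terms (ρ a), ∑ s ∈ terms (Z r.2 c), ∑ q ∈ terms (Z p.2 s.1),
          Θ (((p.1 ⊗ₜ r.1) ⊗ₜ q.1) ⊗ₜ mulSeries₂ (α q.2) (mulSeries₂ (β s.2) F)) := by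
    intro Θ α β c F
    simp_rw [legExt_two_one, map_sum, legExt_two_zero, map_sum]
    exact Finset.sum_congr rfl fun r _ => Finset.sum_comm
  simp_rw [e]
  -- The terms of ρ(a) and ρ(b) are independent of c, so each may have its own order. Those of the
  -- action on c are not; they are harmless because factors through α and β preserve the order.
  refine hR.exists_sum _ fun r _ => hR.exists_sum _ fun p _ => ?_
  obtain ⟨k, hk⟩ := h p.1 r.1
  exact ⟨k, fun c => hR.sum _ fun s _ => hR.sum _ fun q _ => hα _ _ _ _ _ (hβ _ _ _ _ _ (hk q.1))⟩

/-- The leg through γ may raise the order. It stands innermost, where it involves only a and b, so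
that finitely many series, independent of c, occur in it. -/
theorem IsSeriesRelation.legExt_two_one_zero (hR : IsSeriesRelation R)
    (hα : ∀ f k t F G, R k (Φ (t ⊗ₜ F)) (Ψ (t ⊗ₜ G)) →
      R k (Φ (t ⊗ₜ mulSeries₂ (α f) F)) (Ψ (t ⊗ₜ mulSeries₂ (α' f) G)))
    (hβ : ∀ f k t F G, R k (Φ (t ⊗ₜ F)) (Ψ (t ⊗ₜ G)) →
      R k (Φ (t ⊗ₜ mulSeries₂ (β f) F)) (Ψ (t ⊗ₜ mulSeries₂ (β' f) G)))
    (hγ : ∀ f, ∃ N, ∀ k t F G, R k (Φ (t ⊗ₜ F)) (Ψ (t ⊗ₜ G)) →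
      R (k + N) (Φ (t ⊗ₜ mulSeries₂ (γ f) F)) (Ψ (t ⊗ₜ mulSeries₂ (γ' f) G)))
    (h : ∀ a b, ∃ k, ∀ c, R k (Φ (((a ⊗ₜ b) ⊗ₜ c) ⊗ₜ 1)) (Ψ (((a ⊗ₜ b) ⊗ₜ c) ⊗ₜ 1))) (a b : V) :
    ∃ k, ∀ c, R k
      (Φ (legExt ρ Z α 2 0 (legExt ρ Z β 2 1 (legExt ρ Z γ 1 0 (((a ⊗ₜ b) ⊗ₜ c) ⊗ₜ 1)))))
      (Ψ (legExt ρ Z α' 2 0 (legExt ρ Z β' 2 1 (legExt ρ Z γ' 1 0 (((a ⊗ₜ b) ⊗ₜ c) ⊗ₜ 1))))) := by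
  simp_rw [legExt_one_zero, map_sum]
  refine hR.exists_sum _ fun p _ => hR.exists_sum _ fun q _ => ?_
  refine hR.legExt_two hα hβ (fun a b => ?_) p.1 q.1
  obtain ⟨k, hk⟩ := h a b
  obtain ⟨N, hN⟩ := hγ q.2
  exact ⟨k + N, fun c => hN _ _ _ _ (hk c)⟩

theorem IsSeriesRelation.legExt_two_zero_one (hR : IsSeriesRelation R)
    (hα : ∀ f k t F G, R k (Φ (t ⊗ₜ F)) (Ψ (t ⊗ₜ G)) →
      R k (Φ (t ⊗ₜ mulSeries₂ (α f) F)) (Ψ (t ⊗ₜ mulSeries₂ (α' f) G)))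
    (hβ : ∀ f k t F G, R k (Φ (t ⊗ₜ F)) (Ψ (t ⊗ₜ G)) →
      R k (Φ (t ⊗ₜ mulSeries₂ (β f) F)) (Ψ (t ⊗ₜ mulSeries₂ (β' f) G)))
    (hγ : ∀ f, ∃ N, ∀ k t F G, R k (Φ (t ⊗ₜ F)) (Ψ (t ⊗ₜ G)) →
      R (k + N) (Φ (t ⊗ₜ mulSeries₂ (γ f) F)) (Ψ (t ⊗ₜ mulSeries₂ (γ' f) G)))
    (h : ∀ a b, ∃ k, ∀ c, R k (Φ (((a ⊗ₜ b) ⊗ₜ c) ⊗ₜ 1)) (Ψ (((a ⊗ₜ b) ⊗ₜ c) ⊗ₜ 1))) (a b : V) :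
    ∃ k, ∀ c, R k
      (Φ (legExt ρ Z α 2 0 (legExt ρ Z β 2 1 (legExt ρ Z γ 0 1 (((a ⊗ₜ b) ⊗ₜ c) ⊗ₜ 1)))))
      (Ψ (legExt ρ Z α' 2 0 (legExt ρ Z β' 2 1 (legExt ρ Z γ' 0 1 (((a ⊗ₜ b) ⊗ₜ c) ⊗ₜ 1))))) := by
  simp_rw [legExt_zero_one, map_sum]
  refine hR.exists_sum _ fun p _ => hR.exists_sum _ fun q _ => ?_
  refine hR.legExt_two hα hβ (fun a b => ?_) q.1 p.1
  obtain ⟨k, hk⟩ := h a b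
  obtain ⟨N, hN⟩ := hγ q.2
  exact ⟨k + N, fun c => hN _ _ _ _ (hk c)⟩

end Relations

/-! ### Products and iterates of the deformed map; associativity -/

section Products

variable {V H : Type*} [AddCommGroup V] [Module ℂ V] [AddCommGroup H] [Module ℂ H] [Coalgebra ℂ H]
  {YH : H →ₗ[ℂ] H →ₗ[ℂ] LaurentSeries H} {vacH : H} {Y : V →ₗ[ℂ] V →ₗ[ℂ] LaurentSeries V} {vac : V}
  {ρ : V →ₗ[ℂ] V ⊗[ℂ] H} {Z Z' : H →ₗ[ℂ] V →ₗ[ℂ] V ⊗[ℂ] LaurentSeries ℂ}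

theorem productVertex_mul (t : (V ⊗[ℂ] V) ⊗[ℂ] V) (Q F : LaurentSeries (LaurentSeries ℂ)) :
    productVertex Y (t ⊗ₜ mulSeries₂ Q F) = mulScalar₂ (productVertex Y (t ⊗ₜ F)) Q := by
  induction t with
  | zero => simp
  | add x y hx hy => simp only [TensorProduct.add_tmul, map_add, LinearMap.add_apply, hx, hy]
  | tmul ab c =>
    induction ab with
    | zero => simp
    | add x y hx hy => simp only [TensorProduct.add_tmul, map_add, LinearMap.add_apply, hx, hy]
    | tmul a b =>
      rw [productVertex_tmul, productVertex_tmul, mulScalar₂_mul, isCommMul_mulSeries₂.comm,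
        mulSeries₂_eq]

theorem iterateVertex_mul (t : (V ⊗[ℂ] V) ⊗[ℂ] V) (Q F : LaurentSeries (LaurentSeries ℂ)) :
    iterateVertex Y (t ⊗ₜ mulSeries₂ Q F) = mulScalar₂ (iterateVertex Y (t ⊗ₜ F)) Q := by
  induction t with
  | zero => simp
  | add x y hx hy => simp only [TensorProduct.add_tmul, map_add, LinearMap.add_apply, hx, hy]
  | tmul ab c =>
    induction ab with
    | zero => simp
    | add x y hx hy => simp only [TensorProduct.add_tmul, map_add, LinearMap.add_apply, hx, hy]
    | tmul a b =>
      rw [iterateVertex_tmul, iterateVertex_tmul, mulScalar₂_mul, isCommMul_mulSeries₂.comm,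
        mulSeries₂_eq]

theorem laurentMap_extendField_deformedVertex
    (a : LaurentSeries ((V ⊗[ℂ] V) ⊗[ℂ] LaurentSeries ℂ)) :
    laurentMap (extendField (TensorProduct.lift (deformedVertex Y ρ Z))) a =
      laurentMap (extendField (TensorProduct.lift Y))
        (laurentMap (extendScalars mulSeries (legOp₂ ρ Z LinearMap.id 1 0)) a) := by
  ext1
  funext n
  exact extendField_deformedVertex Y (a.coeff n)

/-- The inner vertex operator supplies L_21(x₂); the outer one supplies L_10(x₁), which moves past 1
⊗ Y(x₂) as L_10(x₁ - x₂) L_20(x₁). -/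
theorem productVertex_deformedVertex (hr : IsCoaction ρ) (hρ : ∀ h, CommOp ρ (Z h))
    (hZ : IsModuleNonlocalVertexAlgebra YH vacH Y vac Z)
    (t : ((V ⊗[ℂ] V) ⊗[ℂ] V) ⊗[ℂ] LaurentSeries (LaurentSeries ℂ)) :
    productVertex (deformedVertex Y ρ Z) t = productVertex Y
      (legExt ρ Z atSub 1 0 (legExt ρ Z atFst 2 0 (legExt ρ Z atSnd 2 1 t))) := by
  rw [productVertex, LinearMap.comp_apply, laurentMap_extendField_deformedVertex,
    oneTensorVertex_deformedVertex, laurentMap_legOp₂_oneTensorVertex hr hρ hZ]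
  rfl

theorem iterateVertex_deformedVertex
    (h : IsHom Y vac (tensorVertex Y YH) (vac ⊗ₜ[ℂ] vacH) ρ)
    (hZ : ∀ h k, Associative YH (Z.compr₂ toLaurent) h k)
    (t : ((V ⊗[ℂ] V) ⊗[ℂ] V) ⊗[ℂ] LaurentSeries (LaurentSeries ℂ)) :
    iterateVertex (deformedVertex Y ρ Z) t = iterateVertex Y
      (legExt ρ Z atAdd 2 0 (legExt ρ Z atFst 2 1 (legExt ρ Z atSnd 1 0 t))) := by
  rw [iterateVertex, LinearMap.comp_apply, laurentMap_extendField_deformedVertex,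
    vertexTensorOne_deformedVertex, laurentMap_legOp₂_vertexTensorOne' h hZ]
  rfl

theorem productVertex_one (a b c : V) :
    productVertex Y (((a ⊗ₜ b) ⊗ₜ c) ⊗ₜ 1) = laurentMap (Y a) (Y b c) := by
  rw [productVertex_tmul, mulScalar₂_one]

theorem iterateVertex_one (a b c : V) :
    iterateVertex Y (((a ⊗ₜ b) ⊗ₜ c) ⊗ₜ 1) = laurentMap (Y.flip c) (Y a b) := by
  rw [iterateVertex_tmul, mulScalar₂_one]

/-- Associativity of the deformed vertex operator map. -/
theorem associative_deformedVertex (hV : ∀ a b, Associative Y Y a b)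
    (hρ : IsComoduleNonlocalVertexAlgebra YH vacH Y vac ρ) (hc : Compatible ρ Z Z')
    (hZ : IsModuleNonlocalVertexAlgebra YH vacH Y vac Z) (u v : V) :
    Associative (deformedVertex Y ρ Z) (deformedVertex Y ρ Z) u v := by
  -- Under x₁ = x₂ + x₀ the arguments x₁, x₂, x₁ - x₂ of the legs of the product become x₂ + x₀, x₂,
  -- x₀. In the iterate x₂ is the inner and x₀ the outer variable, which explains the pairs of
  -- substitutions.
  have key := isSeriesRelation_expands.legExt_two_one_zero (ρ := ρ) (Z := Z)
    (Φ := productVertex Y) (Ψ := iterateVertex Y) (α := atFst) (α' := atAdd) (β := atSnd)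
    (β' := atFst) (γ := atSub) (γ' := atSnd)
    (fun f k t F G h => by rw [productVertex_mul, iterateVertex_mul]; exact h.mul_atFst f)
    (fun f k t F G h => by rw [productVertex_mul, iterateVertex_mul]; exact h.mul_atSnd f)
    (fun f => by
      obtain ⟨N, hN⟩ := exists_var_pow_mul f
      refine ⟨N, fun k t F G h => ?_⟩
      rw [productVertex_mul, iterateVertex_mul]
      exact h.mul_atSub hN)
    (fun a b => by
      obtain ⟨k, hk⟩ := hV a b
      refine ⟨k, fun c => ?_⟩
      rw [productVertex_one, iterateVertex_one]
      exact hk c) u v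
  obtain ⟨k, hk⟩ := key
  refine ⟨k, fun w => ?_⟩
  have h1 : Expands k (productVertex (deformedVertex Y ρ Z) (((u ⊗ₜ v) ⊗ₜ w) ⊗ₜ 1))
      (iterateVertex (deformedVertex Y ρ Z) (((u ⊗ₜ v) ⊗ₜ w) ⊗ₜ 1)) := by
    -- The leg in x₁ - x₂, the only one that can raise the order, is commuted into the innermost
    -- place.
    rw [productVertex_deformedVertex hρ.isCoaction hc.left hZ,
      iterateVertex_deformedVertex hρ.hom hZ.module_associative,
      hc.legExt_left_left atSub atFst 1 0 2 0, hc.legExt_left_left atSub atSnd 1 0 2 1]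
    exact hk w
  rw [productVertex_one, iterateVertex_one] at h1
  exact h1

end Products


/-! ### Braided locality of the deformed map -/

section Locality

variable {V H : Type*} [AddCommGroup V] [Module ℂ V] [AddCommGroup H] [Module ℂ H] [Coalgebra ℂ H]
  {YH : H →ₗ[ℂ] H →ₗ[ℂ] LaurentSeries H} {vacH : H} {Y : V →ₗ[ℂ] V →ₗ[ℂ] LaurentSeries V} {vac : V}
  {ρ : V →ₗ[ℂ] V ⊗[ℂ] H} {Z Z' : H →ₗ[ℂ] V →ₗ[ℂ] V ⊗[ℂ] LaurentSeries ℂ}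

/-- The exchange of the first two factors of `V ⊗ V ⊗ V ⊗ K`. -/
def swapFactors (V K : Type*) [AddCommGroup V] [Module ℂ V] [AddCommMonoid K] [Module ℂ K] :
    ((V ⊗[ℂ] V) ⊗[ℂ] V) ⊗[ℂ] K →ₗ[ℂ] ((V ⊗[ℂ] V) ⊗[ℂ] V) ⊗[ℂ] K :=
  LinearMap.rTensor K (LinearMap.rTensor V (TensorProduct.comm ℂ V V).toLinearMap)

theorem swapFactors_tmul {K : Type*} [AddCommMonoid K] [Module ℂ K] (a b c : V) (F : K) :
    swapFactors V K (((a ⊗ₜ b) ⊗ₜ c) ⊗ₜ F) = ((b ⊗ₜ a) ⊗ₜ c) ⊗ₜ F := rfl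

theorem swapFactors_tmul' {K : Type*} [AddCommMonoid K] [Module ℂ K] (t : (V ⊗[ℂ] V) ⊗[ℂ] V) (F : K) :
    swapFactors V K (t ⊗ₜ F) =
      LinearMap.rTensor V (TensorProduct.comm ℂ V V).toLinearMap t ⊗ₜ F := rfl

section

variable (α : LaurentSeries ℂ →ₗ[ℂ] LaurentSeries (LaurentSeries ℂ))
  (t : ((V ⊗[ℂ] V) ⊗[ℂ] V) ⊗[ℂ] LaurentSeries (LaurentSeries ℂ))

theorem swapFactors_legExt_zero_one : swapFactors V _ (legExt ρ Z α 0 1 t) =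
    legExt ρ Z α 1 0 (swapFactors V _ t) := by
  refine triple_ext (P := ((V ⊗[ℂ] V) ⊗[ℂ] V) ⊗[ℂ] LaurentSeries (LaurentSeries ℂ))
    (φ := swapFactors V _ ∘ₗ legExt ρ Z α 0 1) (ψ := legExt ρ Z α 1 0 ∘ₗ swapFactors V _)
    (fun a b c F => ?_) t
  rw [LinearMap.comp_apply, LinearMap.comp_apply, swapFactors_tmul, legExt_zero_one,
    legExt_one_zero]
  simp_rw [map_sum, swapFactors_tmul]

theorem swapFactors_legExt_two_zero : swapFactors V _ (legExt ρ Z α 2 0 t) =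
    legExt ρ Z α 2 1 (swapFactors V _ t) := by
  refine triple_ext (P := ((V ⊗[ℂ] V) ⊗[ℂ] V) ⊗[ℂ] LaurentSeries (LaurentSeries ℂ))
    (φ := swapFactors V _ ∘ₗ legExt ρ Z α 2 0) (ψ := legExt ρ Z α 2 1 ∘ₗ swapFactors V _)
    (fun a b c F => ?_) t
  rw [LinearMap.comp_apply, LinearMap.comp_apply, swapFactors_tmul, legExt_two_zero,
    legExt_two_one]
  simp_rw [map_sum, swapFactors_tmul]

theorem swapFactors_legExt_two_one : swapFactors V _ (legExt ρ Z α 2 1 t) =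
    legExt ρ Z α 2 0 (swapFactors V _ t) := by
  refine triple_ext (P := ((V ⊗[ℂ] V) ⊗[ℂ] V) ⊗[ℂ] LaurentSeries (LaurentSeries ℂ))
    (φ := swapFactors V _ ∘ₗ legExt ρ Z α 2 1) (ψ := legExt ρ Z α 2 0 ∘ₗ swapFactors V _)
    (fun a b c F => ?_) t
  rw [LinearMap.comp_apply, LinearMap.comp_apply, swapFactors_tmul, legExt_two_one,
    legExt_two_zero]
  simp_rw [map_sum, swapFactors_tmul]

end

theorem twoPoint_eq (s : (V ⊗[ℂ] V) ⊗[ℂ] LaurentSeries ℂ) (w : V) :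
    twoPoint Y w s = productVertex Y
      (LinearMap.rTensor (LaurentSeries (LaurentSeries ℂ))
      ((TensorProduct.mk ℂ (V ⊗[ℂ] V) V).flip w)
        (LinearMap.lTensor (V ⊗[ℂ] V) atSub s)) := by
  induction s with
  | zero => simp
  | add x y hx hy => simp only [map_add, hx, hy]
  | tmul ab f =>
    induction ab with
    | zero => simp
    | add x y hx hy => simp only [TensorProduct.add_tmul, map_add, hx, hy]
    | tmul a b =>
      change mulScalar₂ (laurentMap (Y a) (Y b w)) (atSub f) =
        productVertex Y (((a ⊗ₜ b) ⊗ₜ w) ⊗ₜ atSub f)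
      rw [productVertex_tmul]

theorem embed_braiding (hZ' : ∀ h, CommOp ρ (Z' h)) (u v w : V) :
    LinearMap.rTensor (LaurentSeries (LaurentSeries ℂ)) ((TensorProduct.mk ℂ (V ⊗[ℂ] V) V).flip w)
        (LinearMap.lTensor (V ⊗[ℂ] V) atSub (braiding ρ Z Z' (u ⊗ₜ v))) =
      legExt ρ Z (atSub ∘ₗ negVar) 0 1 (legExt ρ Z' atSub 1 0 (((u ⊗ₜ v) ⊗ₜ w) ⊗ₜ 1)) := by
  have e1 := S12_braiding (K := LaurentSeries (LaurentSeries ℂ)) isCommMul_mulSeries₂ (Z := Z) hZ'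
    atSub atSub_mulSeries
  have e2 := extendScalars_one (K := LaurentSeries (LaurentSeries ℂ)) isCommMul_mulSeries₂
    (legOp (K := LaurentSeries (LaurentSeries ℂ)) ρ Z' atSub 1 0) ((u ⊗ₜ v) ⊗ₜ w)
  have e3 := opL_tmul (X := LaurentSeries (LaurentSeries ℂ)) (N := V)
    (LinearMap.lTensor (V ⊗[ℂ] V) atSub ∘ₗ braiding ρ Z Z') (u ⊗ₜ v) w
  refine e3.symm.trans ((LinearMap.congr_fun e1 ((u ⊗ₜ v) ⊗ₜ w)).trans ?_)
  unfold legExt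
  rw [e2]
  rfl

theorem legExt_one_zero_inverse (hr : IsCoaction ρ) (hZ' : ∀ h, CommOp ρ (Z' h))
    (hinv : convolution Z Z' = counitAction)
    (t : ((V ⊗[ℂ] V) ⊗[ℂ] V) ⊗[ℂ] LaurentSeries (LaurentSeries ℂ)) :
    legExt ρ Z atSub 1 0 (legExt ρ Z' atSub 1 0 t) = t :=
  extendScalars_legOp_inverse (K := LaurentSeries (LaurentSeries ℂ)) hr isCommMul_mulSeries₂ atSub
    atSub_mulSeries (taylor_one _) hZ' hinv t

theorem atSub_negVar_mul_mutuallyLocal (f : LaurentSeries ℂ) : ∃ N : ℕ, ∀ k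
    (F G : LaurentSeries (LaurentSeries V)), MutuallyLocal k F G →
      MutuallyLocal (k + N) (mulScalar₂ F (atSub (negVar f))) (mulScalar₂ G (atSub f)) := by
  obtain ⟨N, hN⟩ := exists_var_pow_mul (negVar f)
  refine ⟨N, fun k F G h => ?_⟩
  have := h.mul_atSub hN
  rwa [negVar_negVar] at this

/-- The braided locality of the deformed vertex operator map. -/
theorem mutuallyLocal_deformedVertex (hV : IsVertexAlgebra Y vac)
    (hρ : IsComoduleNonlocalVertexAlgebra YH vacH Y vac ρ) (hc : Compatible ρ Z Z')
    (hZ : IsModuleNonlocalVertexAlgebra YH vacH Y vac Z)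
    (hinv : convolution Z Z' = counitAction) (u v : V) :
    ∃ k, ∀ w, MutuallyLocal k (twoPoint (deformedVertex Y ρ Z) w (braiding ρ Z Z' (u ⊗ₜ v)))
      (laurentMap (deformedVertex Y ρ Z v) (deformedVertex Y ρ Z u w)) := by
  -- The opposite product has inner variable x₂ and outer variable x₁. So x₁ is `atFst` on the left
  -- and `atSnd` on the right, x₂ the reverse, and x₂ - x₁ is `atSub ∘ₗ negVar` on the left and
  -- `atSub` on the right.
  obtain ⟨k, hk⟩ := isSeriesRelation_mutuallyLocal.legExt_two_zero_one (ρ := ρ) (Z := Z)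
    (Φ := productVertex Y) (Ψ := productVertex Y ∘ₗ swapFactors V _) (α := atFst) (α' := atSnd)
    (β := atSnd) (β' := atFst) (γ := atSub ∘ₗ negVar) (γ' := atSub)
    (fun f k t F G h => by
      rw [LinearMap.comp_apply, swapFactors_tmul'] at h ⊢
      rw [productVertex_mul, productVertex_mul]; exact h.mul_atFst f)
    (fun f k t F G h => by
      rw [LinearMap.comp_apply, swapFactors_tmul'] at h ⊢
      rw [productVertex_mul, productVertex_mul]; exact h.mul_atSnd f)
    (fun f => by
      obtain ⟨N, hN⟩ := atSub_negVar_mul_mutuallyLocal (V := V) f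
      refine ⟨N, fun k t F G h => ?_⟩
      rw [LinearMap.comp_apply, swapFactors_tmul'] at h
      rw [LinearMap.comp_apply, LinearMap.comp_apply, swapFactors_tmul', productVertex_mul,
        productVertex_mul]
      exact hN _ _ _ h)
    (fun a b => by
      obtain ⟨k, hk⟩ := hV.locality a b
      refine ⟨k, fun c => ?_⟩
      rw [LinearMap.comp_apply, swapFactors_tmul, productVertex_one, productVertex_one]
      exact hk c) u v
  refine ⟨k, fun w => ?_⟩
  have h1 := hk w
  rw [LinearMap.comp_apply, swapFactors_legExt_two_zero, swapFactors_legExt_two_one,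
    swapFactors_legExt_zero_one, swapFactors_tmul] at h1
  -- The leg L_10(Z, x₁ - x₂) of the deformed product is commuted inward until it meets and cancels
  -- L_10(Z', x₁ - x₂) from the braiding. The surviving L_01(Z, x₂ - x₁) matches the leg of the
  -- opposite product.
  rw [twoPoint_eq, embed_braiding hc.right, productVertex_deformedVertex hρ.isCoaction hc.left hZ,
    ← productVertex_one, productVertex_deformedVertex hρ.isCoaction hc.left hZ,
    hc.legExt_left_left atSub atFst 1 0 2 0, hc.legExt_left_left atSub atSnd 1 0 2 1,
    hc.legExt_left_left atSub (atSub ∘ₗ negVar) 1 0 0 1,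
    legExt_one_zero_inverse hρ.isCoaction hc.right hinv,
    hc.legExt_left_left atSub atFst 1 0 2 0, hc.legExt_left_left atSub atSnd 1 0 2 1,
    hc.legExt_left_left atFst atSnd 2 0 2 1 (legExt ρ Z atSub 1 0 _)]
  exact h1

theorem exists_fin_sum (t : (V ⊗[ℂ] V) ⊗[ℂ] LaurentSeries ℂ) :
    ∃ (r : ℕ) (u' v' : Fin r → V) (f : Fin r → LaurentSeries ℂ),
      t = ∑ i, (v' i ⊗ₜ[ℂ] u' i) ⊗ₜ[ℂ] f i := by
  let s := (terms t).sigma fun p => terms p.1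
  refine ⟨s.card, fun i => (s.equivFin.symm i).1.2.2, fun i => (s.equivFin.symm i).1.2.1,
    fun i => (s.equivFin.symm i).1.1.2, ?_⟩
  rw [Equiv.sum_comp s.equivFin.symm fun x : s =>
    (x.1.2.1 ⊗ₜ[ℂ] x.1.2.2) ⊗ₜ[ℂ] x.1.1.2, Finset.sum_coe_sort s fun x =>
    (x.2.1 ⊗ₜ[ℂ] x.2.2) ⊗ₜ[ℂ] x.1.2, Finset.sum_sigma]
  conv_lhs => rw [← sum_terms t]
  refine Finset.sum_congr rfl fun p _ => ?_
  conv_lhs => rw [← sum_terms p.1, TensorProduct.sum_tmul]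

end Locality


end VertexAlg

end


/-! ### Assembly of the theorem -/

open scoped TensorProduct in
theorem theorem3p6 {H : Type*} [AddCommGroup H] [Module ℂ H] [Coalgebra ℂ H]
    [Coalgebra.IsCocomm ℂ H] {V : Type*} [AddCommGroup V] [Module ℂ V]
    (YH : H →ₗ[ℂ] H →ₗ[ℂ] LaurentSeries H) (vacH : H)
    (hH : VertexAlg.IsNonlocalVertexBialgebra YH vacH)
    (Y : V →ₗ[ℂ] V →ₗ[ℂ] LaurentSeries V) (vac : V)
    (hV : VertexAlg.IsVertexAlgebra Y vac)
    (ρ : V →ₗ[ℂ] V ⊗[ℂ] H)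
    (hρ : VertexAlg.IsComoduleNonlocalVertexAlgebra YH vacH Y vac ρ)
    (YM YM' : H →ₗ[ℂ] V →ₗ[ℂ] V ⊗[ℂ] LaurentSeries ℂ)
    (hYM : VertexAlg.IsCompatibleModule YH vacH Y vac ρ YM)
    (hYM' : VertexAlg.IsCompatibleModule YH vacH Y vac ρ YM')
    (hcomm : ∀ Z ∈ ({YM, YM'} : Set _), ∀ Z' ∈ ({YM, YM'} : Set _), VertexAlg.Commute Z Z')
    (hinv : VertexAlg.convolution YM YM' = VertexAlg.counitAction)
    (hinv' : VertexAlg.convolution YM' YM = VertexAlg.counitAction) :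
    (VertexAlg.IsRationalYangBaxter (VertexAlg.braiding ρ YM YM') ∧
      VertexAlg.IsUnitaryOperator (VertexAlg.braiding ρ YM YM')) ∧
    VertexAlg.IsQuantumVertexAlgebra (VertexAlg.deformedVertex Y ρ YM) vac
      (VertexAlg.braiding ρ YM YM') := by
  have h1 : YM ∈ ({YM, YM'} : Set _) := Or.inl rfl
  have h2 : YM' ∈ ({YM, YM'} : Set _) := Or.inr rfl
  have hc : VertexAlg.Compatible ρ YM YM' :=
    { coaction := hρ.isCoaction.commOp_self
      left := hYM.commOp
      right := hYM'.commOp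
      left_left := VertexAlg.CommOp.of_commute (hcomm _ h1 _ h1)
      left_right := VertexAlg.CommOp.of_commute (hcomm _ h1 _ h2)
      right_right := VertexAlg.CommOp.of_commute (hcomm _ h2 _ h2) }
  have hZ := hYM.toIsModuleNonlocalVertexAlgebra
  have hZ' := hYM'.toIsModuleNonlocalVertexAlgebra
  have hu := VertexAlg.isUnitaryOperator_braiding hρ.isCoaction hc.left hc.right hinv hinv'
  have hloc := VertexAlg.mutuallyLocal_deformedVertex hV hρ hc hZ hinv
  refine ⟨⟨hc.yangBaxter, hu⟩, ?_⟩
  exact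
    { vacuum := VertexAlg.deformedVertex_vacuum hV.vacuum hρ.hom hZ.module_vacuum
      creation_regular := fun v n hn => by
        rw [VertexAlg.deformedVertex_vac hρ hZ]
        exact hV.creation_regular v n hn
      creation_limit := fun v => by
        rw [VertexAlg.deformedVertex_vac hρ hZ]
        exact hV.creation_limit v
      associative := VertexAlg.associative_deformedVertex hV.associative hρ hc hZ
      S_locality := fun u v => by
        obtain ⟨r, u', v', f, e⟩ := VertexAlg.exists_fin_sum (VertexAlg.braiding ρ YM YM' (v ⊗ₜ u))
        obtain ⟨k, hk⟩ := hloc v u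
        refine ⟨r, u', v', f, k, fun w => ?_⟩
        -- The expression containing S stands on the right in this axiom. Hence braided locality is
        -- taken for the pair (v, u) and read in the opposite direction.
        have h := (hk w).swap
        rw [e, map_sum] at h
        exact h
      yangBaxter := hc.yangBaxter
      unitary := hu
      S_locality' := hloc
      shift := fun t => by
        rw [VertexAlg.translation_deformedVertex hρ hZ]
        exact VertexAlg.shift_braiding hV.toIsNonlocalVertexAlgebra
          hH.toIsNonlocalVertexAlgebra hρ.hom hZ hZ' t
      hexagon := VertexAlg.hexagon_deformedVertex hc hρ hZ hZ' }
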